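/- All vector spaces are over $\mathbb{C}$, which carries the discrete topology, and subspaces and ideals of superspaces are $\mathbb{Z}/2\mathbb{Z}$-graded. A Lie conformal superalgebra is a $\mathbb{Z}/2\mathbb{Z}$-graded $\mathbb{C}[\partial]$-module $R$ with a parity-preserving $\lambda$-bracket $[a_\lambda b]=\sum_{n\ge 0}\frac{\lambda^n}{n!}\,a_{(n)}b\in\mathbb{C}[\lambda]\otimes R$ satisfying sesquilinearity, skew-commutativity and the Jacobi identity; it is finite if it is finitely generated over $\mathbb{C}[\partial]$, and simple if its $\lambda$-bracket is not identically zero and its only ideals are $0$ and $R$. Let $\mathrm{Lie}\,R=R[t,t^{-1}]/(\partial+\partial_t)R[t,t^{-1}]$, let $a_n$ be the image of $at^n$, with bracket $[a_m,b_n]=\sum_{j\ge 0}\binom{m}{j}(a_{(j)}b)_{m+n-j}$, and let $(\mathrm{Lie}\,R)_-$ be the span of all $a_n$ with $a\in R$, $n\ge 0$. For $R$ finite, the annihilation algebra $\mathcal{A}(R)$ is the completion of $(\mathrm{Lie}\,R)_-$ with respect to the subspaces $\mathcal{L}_m=\mathrm{span}\{a^j_i : i\ge m\}$, where $\{a^j\}$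 is a finite set of generators of the $\mathbb{C}[\partial]$-module $R$ (the completion does not depend on its choice). Theorem. Let $R$ be a finite simple Lie conformal superalgebra. Then there are $r\in\{0,1\}$ and a simple linearly compact Lie superalgebra $\mathfrak{s}$ (simple: non-abelian, with no closed graded ideals other than $0$ and $\mathfrak{s}$) such that $\mathcal{A}(R)$ is isomorphic, as a topological Lie superalgebra, to an irreducible central extension of $\mathbb{C}[[t_1,\dots,t_r]]\,\widehat{\otimes}\,\mathfrak{s}$. That is, $\mathcal{A}(R)$ is a linearly compact Lie superalgebra with $\mathcal{A}(R)=[\mathcal{A}(R),\mathcal{A}(R)]$, and there is a continuous open surjective even homomorphism of Lie superalgebras $\mathcal{A}(R)\to\mathbb{C}[[t_1,\dots,t_r]]\,\widehat{\otimes}\,\mathfrak{s}$ whose kernel is central. Here $V\widehat{\otimes}W=(V^\star\otimes W^\star)^\star$ is the completed tensor product of linearly compact spaces ($\star$ denotes the topological dual), and the bracket is the continuous one with $[a\otimes x,b\otimes y]=ab\otimes[x,y]$. -/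

import Mathlib

open scoped TensorProduct

universe u v

noncomputable section

/-! # Superspaces and Lie superalgebras over `ℂ` -/

/-- The sign `(-1)^{αβ}` for parities `α, β ∈ ℤ/2`. -/
def superSign (α β : ZMod 2) : ℂ := (-1) ^ (α.val * β.val)

/-- `U` is a graded subspace of the superspace `V = p 0 ⊕ p 1`, i.e.
`U = (U ∩ p 0) ⊕ (U ∩ p 1)`. -/
def IsGradedSubspace {V : Type u} [AddCommGroup V] [Module ℂ V] (p : ZMod 2 → Submodule ℂ V)
    (U : Submodule ℂ V) : Prop :=
  U ≤ (U ⊓ p 0) ⊔ (U ⊓ p 1)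

/-- The data underlying a superalgebra with a bracket: the two parity subspaces and a bilinear
bracket.  The axioms are in `IsLieSuperalgebra`. -/
class SuperBracket (V : Type u) [AddCommGroup V] [Module ℂ V] where
  parity : ZMod 2 → Submodule ℂ V
  bracket : V →ₗ[ℂ] V →ₗ[ℂ] V

open SuperBracket

/-- The axioms of a Lie superalgebra over `ℂ`. -/
structure IsLieSuperalgebra (V : Type u) [AddCommGroup V] [Module ℂ V] [SuperBracket V] :
    Prop where
  isCompl : IsCompl (parity (V := V) 0) (parity 1)
  bracket_mem : ∀ (α β : ZMod 2) (x y : V), x ∈ parity α → y ∈ parity β →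
    bracket x y ∈ parity (α + β)
  skew : ∀ (α β : ZMod 2) (x y : V), x ∈ parity α → y ∈ parity β →
    bracket x y = -(superSign α β • bracket y x)
  jacobi : ∀ (α β : ZMod 2) (x y z : V), x ∈ parity α → y ∈ parity β →
    bracket x (bracket y z) =
      bracket (bracket x y) z + superSign α β • bracket y (bracket x z)

/-! # Linear compactness (the field `ℂ` carries the discrete topology) -/

/-- Linearly compact vector spaces: Hausdorff linearly topologized vector spaces (over the discrete
field `ℂ`) in which every family of closed affine linear varieties with the finite intersection
property has non-empty intersection. -/
class IsLinearlyCompact (V : Type u) [AddCommGroup V] [Module ℂ V] [TopologicalSpace V] :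
    Prop where
  t2 : T2Space V
  addGroup : IsTopologicalAddGroup V
  smul : ContinuousConstSMul ℂ V
  linear : ∀ U ∈ nhds (0 : V), ∃ W : Submodule ℂ V, IsOpen (W : Set V) ∧ (W : Set V) ⊆ U
  inter : ∀ 𝓕 : Set (AffineSubspace ℂ V), (∀ A ∈ 𝓕, IsClosed (A : Set V)) →
    (∀ 𝓣 ⊆ 𝓕, 𝓣.Finite → (⋂ A ∈ 𝓣, (A : Set V)).Nonempty) →
    (⋂ A ∈ 𝓕, (A : Set V)).Nonempty

/-- Linearly compact (topological) Lie superalgebras: the bracket is (jointly) continuous and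
`V` is the topological direct sum of its even and odd parts. -/
structure IsLinearlyCompactLieSuperalgebra (V : Type u) [AddCommGroup V] [Module ℂ V]
    [TopologicalSpace V] [SuperBracket V] : Prop where
  lie : IsLieSuperalgebra V
  linearlyCompact : IsLinearlyCompact V
  parity_closed : ∀ α : ZMod 2, IsClosed (parity (V := V) α : Set V)
  continuous_bracket : Continuous fun p : V × V => bracket p.1 p.2

/-- A topological Lie superalgebra is simple if it is non-abelian and it has no closed graded
ideals other than `0` and itself. -/
structure IsSimpleTopLieSuperalgebra (V : Type u) [AddCommGroup V] [Module ℂ V]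
    [TopologicalSpace V] [SuperBracket V] : Prop where
  nonabelian : ∃ x y : V, bracket x y ≠ 0
  ideal_trivial : ∀ I : Submodule ℂ V, IsGradedSubspace parity I → IsClosed (I : Set V) →
    (∀ x : V, ∀ y ∈ I, bracket x y ∈ I) → I = ⊥ ∨ I = ⊤

/-- `π : E → L` exhibits the linearly compact Lie superalgebra `E` as an irreducible central
extension of the linearly compact Lie superalgebra `L`: `π` is a surjective even homomorphism,
`L` carries the quotient topology, the kernel of `π` is central, and `E = [E, E]`. -/
structure IsIrreducibleCentralExtension {E : Type u} {L : Type v}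
    [AddCommGroup E] [Module ℂ E] [TopologicalSpace E] [SuperBracket E]
    [AddCommGroup L] [Module ℂ L] [TopologicalSpace L] [SuperBracket L]
    (π : E →ₗ[ℂ] L) : Prop where
  total : IsLinearlyCompactLieSuperalgebra E
  base : IsLinearlyCompactLieSuperalgebra L
  even : ∀ (α : ZMod 2) (x : E), x ∈ parity α → π x ∈ parity α
  map_bracket : ∀ x y : E, π (bracket x y) = bracket (π x) (π y)
  surjective : Function.Surjective π
  continuous : Continuous π
  isOpenMap : IsOpenMap π
  central : ∀ x : E, π x = 0 → ∀ y : E, bracket x y = 0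
  perfect : Submodule.span ℂ {z : E | ∃ x y : E, z = bracket x y} = ⊤

/-! # Topological duals and the completed tensor product -/

/-- The topological dual `V^⋆`: linear functionals that are continuous for the discrete topology
of `ℂ`, i.e. locally constant ones. -/
def topDual (V : Type u) [AddCommGroup V] [Module ℂ V] [TopologicalSpace V] :
    Submodule ℂ (Module.Dual ℂ V) where
  carrier := {f | IsLocallyConstant f}
  zero_mem' := IsLocallyConstant.const 0
  add_mem' := fun ha hb => ha.comp₂ hb (· + ·)
  smul_mem' := fun c _ ha => ha.comp (c • ·)

/-- The completed tensor product `V ⊗̂ W = (V^⋆ ⊗ W^⋆)^⋆`, where `V^⋆ ⊗ W^⋆` is discrete. -/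
def CompletedTensor (V : Type u) (W : Type v) [AddCommGroup V] [Module ℂ V] [TopologicalSpace V]
    [AddCommGroup W] [Module ℂ W] [TopologicalSpace W] : Type (max u v) :=
  Module.Dual ℂ (topDual V ⊗[ℂ] topDual W)

namespace CompletedTensor

variable (V : Type u) (W : Type v) [AddCommGroup V] [Module ℂ V] [TopologicalSpace V]
    [AddCommGroup W] [Module ℂ W] [TopologicalSpace W]

instance : AddCommGroup (CompletedTensor V W) :=
  inferInstanceAs (AddCommGroup (Module.Dual ℂ (topDual V ⊗[ℂ] topDual W)))

instance : Module ℂ (CompletedTensor V W) :=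
  inferInstanceAs (Module ℂ (Module.Dual ℂ (topDual V ⊗[ℂ] topDual W)))

/-- The topology of the dual of a discrete space: the annihilators of the finite-dimensional
(i.e. linearly compact) subspaces form a fundamental system of neighbourhoods of `0`. -/
instance : TopologicalSpace (CompletedTensor V W) :=
  ⨅ z : topDual V ⊗[ℂ] topDual W,
    TopologicalSpace.induced (fun F : Module.Dual ℂ (topDual V ⊗[ℂ] topDual W) => F z) ⊥

variable {V W}

/-- An element of `V ⊗̂ W` as a functional on `V^⋆ ⊗ W^⋆`. -/
def toDual : CompletedTensor V W ≃ₗ[ℂ] Module.Dual ℂ (topDual V ⊗[ℂ] topDual W) :=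
  LinearEquiv.refl ℂ _

/-- The pure tensor `x ⊗ y`, as the functional `φ ⊗ ψ ↦ φ(x) ψ(y)`. -/
def tmul (x : V) (y : W) : CompletedTensor V W :=
  TensorProduct.lift (((LinearMap.mul ℂ ℂ).compl₁₂
    ((Module.Dual.eval ℂ V x).comp (topDual V).subtype))
    ((Module.Dual.eval ℂ W y).comp (topDual W).subtype))

end CompletedTensor

/-- `ℂ[[t_1, …, t_r]]` -/
def FormalSeries (r : ℕ) : Type := MvPowerSeries (Fin r) ℂ

namespace FormalSeries

variable (r : ℕ)

instance : CommRing (FormalSeries r) := inferInstanceAs (CommRing (MvPowerSeries (Fin r) ℂ))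

instance : Algebra ℂ (FormalSeries r) :=
  inferInstanceAs (Algebra ℂ (MvPowerSeries (Fin r) ℂ))

variable {r}

/-- The coefficient functionals. -/
def coeff (n : Fin r →₀ ℕ) : FormalSeries r →ₗ[ℂ] ℂ := MvPowerSeries.coeff n

variable (r) in
/-- The formal topology, i.e. the topology of coefficientwise stabilization; the powers of the
ideal `(t_1, …, t_r)` are a fundamental system of neighbourhoods of `0`. -/
instance : TopologicalSpace (FormalSeries r) :=
  ⨅ n : Fin r →₀ ℕ, TopologicalSpace.induced (coeff n) ⊥

/-- The series with given coefficients. -/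
def ofCoeff (f : (Fin r →₀ ℕ) → ℂ) : FormalSeries r := f

lemma coeff_ofCoeff (n : Fin r →₀ ℕ) (f : (Fin r →₀ ℕ) → ℂ) : coeff n (ofCoeff f) = f n := rfl

lemma isLocallyConstant_coeff (n : Fin r →₀ ℕ) : IsLocallyConstant (coeff (r := r) n) := by
  intro s
  refine TopologicalSpace.le_def.1 (iInf_le _ n) _ ?_
  exact ⟨s, trivial, rfl⟩

/-- The coefficient functionals as elements of the topological dual. -/
def coeffDual (n : Fin r →₀ ℕ) : topDual (FormalSeries r) := ⟨coeff n, isLocallyConstant_coeff n⟩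

lemma isOpen_iff_zero {U : Set (FormalSeries r)} (hU : IsOpen U) (h0 : (0 : FormalSeries r) ∈ U) :
    ∃ T : Finset (Fin r →₀ ℕ), ∀ f : FormalSeries r, (∀ n ∈ T, coeff n f = 0) → f ∈ U := by
  have h := hU.mem_nhds h0
  rw [nhds_iInf, Filter.mem_iInf] at h
  obtain ⟨I, hI, W, hW, rfl⟩ := h
  refine ⟨hI.toFinset, fun f hf => ?_⟩
  rw [Set.mem_iInter]
  intro i
  obtain ⟨t, ht, hts⟩ := (@mem_nhds_induced ℂ (FormalSeries r) ⊥ _ _ _).1 (hW i)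
  apply hts
  have h1 : coeff (i : Fin r →₀ ℕ) f = coeff (i : Fin r →₀ ℕ) 0 := by
    rw [hf i (by simp), map_zero]
  change coeff (i : Fin r →₀ ℕ) f ∈ t
  rw [h1]
  exact @mem_of_mem_nhds ℂ ⊥ _ _ ht

lemma topDual_eq_span (φ : topDual (FormalSeries r)) :
    φ ∈ Submodule.span ℂ (Set.range (coeffDual (r := r))) := by
  obtain ⟨φ, hφ⟩ := φ
  obtain ⟨T, hT⟩ := isOpen_iff_zero (hφ {0}) (by simp)
  have h : φ ∈ Submodule.span ℂ (Set.range fun n : T => coeff (n : Fin r →₀ ℕ)) := by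
    apply mem_span_of_iInf_ker_le_ker
    intro f hf
    simp only [Submodule.mem_iInf, LinearMap.mem_ker] at hf
    exact hT f fun n hn => hf ⟨n, hn⟩
  have h2 : φ ∈ (Submodule.span ℂ (Set.range (coeffDual (r := r)))).map
      (topDual (FormalSeries r)).subtype := by
    refine (Submodule.span_le.2 ?_ : Submodule.span ℂ _ ≤ _) h
    rintro _ ⟨n, rfl⟩
    exact ⟨coeffDual n, Submodule.subset_span ⟨_, rfl⟩, rfl⟩
  obtain ⟨φ', h', e⟩ := h2
  have : φ' = ⟨φ, hφ⟩ := Subtype.ext e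
  rwa [← this]

end FormalSeries

/-! # Duality for linearly compact spaces -/

namespace IsLinearlyCompact

variable {V : Type u} [AddCommGroup V] [Module ℂ V] [TopologicalSpace V] [IsLinearlyCompact V]

variable (V) in
/-- The continuous functionals on a linearly compact space separate points. -/
lemma eq_zero_of_topDual (x : V) (hx : ∀ ψ : topDual V, ψ.1 x = 0) : x = 0 := by
  by_contra hne
  have := t2 (V := V)
  have := addGroup (V := V)
  obtain ⟨W, hW, hWx⟩ := linear (V := V) {x}ᶜ
    (isOpen_compl_singleton.mem_nhds (by simpa using Ne.symm hne))
  have hxW : x ∉ W := fun h => hWx h rfl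
  obtain ⟨f, hf, hfW⟩ := Submodule.exists_le_ker_of_notMem hxW
  refine hf (hx ⟨f, ?_⟩)
  change IsLocallyConstant f
  rw [IsLocallyConstant.iff_eventually_eq]
  intro y
  have h1 : (fun z => z - y) ⁻¹' (W : Set V) ∈ nhds y :=
    (hW.preimage (by fun_prop)).mem_nhds (by simp)
  filter_upwards [h1] with z hz
  have := hfW hz
  rw [LinearMap.mem_ker, map_sub, sub_eq_zero] at this
  exact this

/-- Every linear functional on the topological dual of a linearly compact space is the evaluation
at some vector. -/
lemma exists_eval (F : topDual V →ₗ[ℂ] ℂ) : ∃ x : V, ∀ ψ : topDual V, ψ.1 x = F ψ := by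
  let A : topDual V → AffineSubspace ℂ V := fun ψ =>
    { carrier := {x | ψ.1 x = F ψ}
      smul_vsub_vadd_mem' := by
        intro c p q s hp hq hs
        simp only [Set.mem_ofPred_eq] at *
        simp [hp, hq, hs] }
  have key := inter (V := V) (Set.range A) ?_ ?_
  · obtain ⟨x, hx⟩ := key
    refine ⟨x, fun ψ => ?_⟩
    simp only [Set.mem_iInter] at hx
    exact hx (A ψ) ⟨ψ, rfl⟩
  · rintro _ ⟨ψ, rfl⟩
    exact ψ.2.isClosed_fiber (F ψ)
  · intro 𝓣 h𝓣 hfin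
    obtain ⟨T, hT, rfl⟩ : ∃ T : Set (topDual V), T.Finite ∧ A '' T = 𝓣 := by
      rw [← Set.image_univ] at h𝓣
      obtain ⟨T, -, hT, e⟩ := Set.exists_subset_image_finite_and.1 ⟨𝓣, h𝓣, hfin, rfl⟩
      exact ⟨T, hT, e.symm⟩
    have := hT.fintype
    classical
    let Φ : V →ₗ[ℂ] (T → ℂ) := LinearMap.pi fun ψ => ψ.1.1
    have hmem : (fun ψ : T => F ψ.1) ∈ LinearMap.range Φ := by
      by_contra hn
      obtain ⟨f, hf, hfk⟩ := Submodule.exists_le_ker_of_notMem hn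
      apply hf
      have hexp : ∀ v : T → ℂ, f v = ∑ ψ, v ψ * f (Pi.single ψ 1) := by
        intro v
        conv_lhs => rw [← Finset.univ_sum_single v]
        rw [map_sum]
        refine Finset.sum_congr rfl fun ψ _ => ?_
        rw [← smul_eq_mul, ← map_smul, ← Pi.single_smul, smul_eq_mul, mul_one]
      have hz : ∑ ψ : T, f (Pi.single ψ 1) • ψ.1 = 0 := by
        ext x
        have := hfk ⟨x, rfl⟩
        rw [LinearMap.mem_ker, hexp] at this
        simpa [Φ, mul_comm] using this
      rw [hexp]
      have := congrArg F hz
      simpa [mul_comm] using this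
    obtain ⟨x, hx⟩ := hmem
    refine ⟨x, ?_⟩
    simp only [Set.mem_iInter]
    rintro _ ⟨ψ, hψ, rfl⟩
    exact congrFun hx ⟨ψ, hψ⟩

end IsLinearlyCompact

/-! # The Lie superalgebra `ℂ[[t_1, …, t_r]] ⊗̂ 𝔰` -/

namespace CompletedTensor

variable (r : ℕ) (V : Type u) [AddCommGroup V] [Module ℂ V] [TopologicalSpace V]

/-- The canonical map from formal series `∑ f_n t^n` with coefficients in `V` to
`ℂ[[t_1, …, t_r]] ⊗̂ V`; as a functional, `∑ f_n t^n` is `φ ⊗ ψ ↦ φ (∑ ψ(f_n) t^n)`. -/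
def ofSeries : ((Fin r →₀ ℕ) → V) →ₗ[ℂ] CompletedTensor (FormalSeries r) V where
  toFun f := TensorProduct.lift (LinearMap.mk₂ ℂ
    (fun (φ : topDual (FormalSeries r)) (ψ : topDual V) =>
      φ.1 (FormalSeries.ofCoeff fun n => ψ.1 (f n)))
    (fun _ _ _ => rfl) (fun _ _ _ => rfl)
    (fun φ ψ ψ' => φ.1.map_add (FormalSeries.ofCoeff fun n => ψ.1 (f n))
      (FormalSeries.ofCoeff fun n => ψ'.1 (f n)))
    (fun c φ ψ => φ.1.map_smul c (FormalSeries.ofCoeff fun n => ψ.1 (f n))))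
  map_add' f g := by
    refine TensorProduct.ext' fun φ ψ => ?_
    refine Eq.trans (congrArg φ.1 ?_) (φ.1.map_add (FormalSeries.ofCoeff fun n => ψ.1 (f n))
      (FormalSeries.ofCoeff fun n => ψ.1 (g n)))
    exact funext fun n => map_add ψ.1 _ _
  map_smul' c f := by
    refine TensorProduct.ext' fun φ ψ => ?_
    refine Eq.trans (congrArg φ.1 ?_) (φ.1.map_smul c (FormalSeries.ofCoeff fun n => ψ.1 (f n)))
    exact funext fun n => map_smul ψ.1 _ _

variable {r V}

lemma ofSeries_apply (f : (Fin r →₀ ℕ) → V) (φ : topDual (FormalSeries r)) (ψ : topDual V) :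
    toDual (ofSeries r V f) (φ ⊗ₜ ψ) =
      φ.1 (FormalSeries.ofCoeff fun n => ψ.1 (f n)) := rfl

variable (r V)

lemma ofSeries_bijective [IsLinearlyCompact V] : Function.Bijective (ofSeries r V) := by
  constructor
  · rw [injective_iff_map_eq_zero]
    intro f hf
    funext n
    refine IsLinearlyCompact.eq_zero_of_topDual V _ fun ψ => ?_
    have h := ofSeries_apply f (FormalSeries.coeffDual n) ψ
    rw [hf] at h
    exact h.symm
  · intro F
    have h : ∀ n, ∃ x : V, ∀ ψ : topDual V, ψ.1 x = toDual F (FormalSeries.coeffDual n ⊗ₜ ψ) := fun n =>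
      IsLinearlyCompact.exists_eval ((toDual F).comp (TensorProduct.mk ℂ _ _ (FormalSeries.coeffDual n)))
    choose f hf using h
    refine ⟨f, toDual.injective (TensorProduct.ext' fun φ ψ => ?_)⟩
    have hφ := FormalSeries.topDual_eq_span φ
    induction hφ using Submodule.span_induction with
    | mem φ h =>
      obtain ⟨n, rfl⟩ := h
      exact hf n ψ
    | zero => simp
    | add φ φ' _ _ h h' => rw [TensorProduct.add_tmul, map_add, map_add, h, h']
    | smul c φ _ h => rw [← TensorProduct.smul_tmul', map_smul, map_smul, h]

/-- `V[[t_1, …, t_r]] ≃ ℂ[[t_1, …, t_r]] ⊗̂ V` for linearly compact `V`. -/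
def seriesEquiv [IsLinearlyCompact V] :
    ((Fin r →₀ ℕ) → V) ≃ₗ[ℂ] CompletedTensor (FormalSeries r) V :=
  LinearEquiv.ofBijective (ofSeries r V) (ofSeries_bijective r V)

/-- The bracket `[∑ f_i t^i, ∑ g_j t^j] = ∑_n (∑_{i + j = n} [f_i, g_j]) t^n`. -/
def seriesBracket [SuperBracket V] :
    ((Fin r →₀ ℕ) → V) →ₗ[ℂ] ((Fin r →₀ ℕ) → V) →ₗ[ℂ] ((Fin r →₀ ℕ) → V) :=
  LinearMap.mk₂ ℂ (fun f g n => ∑ p ∈ Finset.HasAntidiagonal.antidiagonal n, bracket (f p.1) (g p.2))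
    (fun _ _ _ => by funext n; simp [Finset.sum_add_distrib])
    (fun _ _ _ => by funext n; simp [Finset.smul_sum])
    (fun _ _ _ => by funext n; simp [Finset.sum_add_distrib])
    (fun _ _ _ => by funext n; simp [Finset.smul_sum])

/-- The super structure of `ℂ[[t_1, …, t_r]] ⊗̂ 𝔰`: the `t_i` are even, and the bracket is the
continuous one with `[a ⊗ x, b ⊗ y] = ab ⊗ [x, y]` (see `bracket_tmul`). -/
instance [IsLinearlyCompact V] [SuperBracket V] :
    SuperBracket (CompletedTensor (FormalSeries r) V) where
  parity α := (Submodule.pi Set.univ fun _ => parity α).map (seriesEquiv r V).toLinearMap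
  bracket := (seriesEquiv r V).arrowCongr
    ((seriesEquiv r V).arrowCongr (seriesEquiv r V)) (seriesBracket r V)

variable {r V}

lemma ofSeries_tmul (a : FormalSeries r) (x : V) :
    ofSeries r V (fun n => FormalSeries.coeff n a • x) = tmul a x := by
  refine toDual.injective (TensorProduct.ext' fun φ ψ => ?_)
  rw [ofSeries_apply]
  have h : (FormalSeries.ofCoeff fun n => ψ.1 (FormalSeries.coeff n a • x)) = ψ.1 x • a := by
    funext n
    rw [FormalSeries.ofCoeff, map_smul, smul_eq_mul, mul_comm]
    rfl
  rw [h, map_smul, smul_eq_mul, mul_comm]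
  rfl

theorem bracket_tmul [IsLinearlyCompact V] [SuperBracket V] (a b : FormalSeries r) (x y : V) :
    bracket (tmul a x) (tmul b y) = tmul (a * b) (bracket x y) := by
  have h : ∀ (a : FormalSeries r) (x : V),
      tmul a x = seriesEquiv r V (fun n => FormalSeries.coeff n a • x) :=
    fun a x => (ofSeries_tmul a x).symm
  simp only [h]
  change (seriesEquiv r V).arrowCongr ((seriesEquiv r V).arrowCongr (seriesEquiv r V))
    (seriesBracket r V) _ _ = _
  rw [LinearEquiv.arrowCongr_apply, LinearEquiv.arrowCongr_apply, LinearEquiv.symm_apply_apply,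
    LinearEquiv.symm_apply_apply]
  congr 1
  funext n
  change ∑ p ∈ Finset.HasAntidiagonal.antidiagonal n, bracket (FormalSeries.coeff p.1 a • x)
    (FormalSeries.coeff p.2 b • y) = FormalSeries.coeff n (a * b) • bracket x y
  have h2 : FormalSeries.coeff n (a * b) =
      ∑ p ∈ Finset.HasAntidiagonal.antidiagonal n, FormalSeries.coeff p.1 a * FormalSeries.coeff p.2 b :=
    MvPowerSeries.coeff_mul n a b
  rw [h2, Finset.sum_smul]
  refine Finset.sum_congr rfl fun p _ => ?_
  rw [map_smul, map_smul, LinearMap.smul_apply, smul_smul, mul_comm]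

end CompletedTensor

/-! # Lie conformal superalgebras -/

/-- A Lie conformal superalgebra structure on the complex vector space `R`.

The `λ`-bracket `[a_λ b] = ∑_n (λ^n / n!) a_{(n)} b ∈ ℂ[λ] ⊗ R` is recorded as the finitely
supported sequence `lam a b : n ↦ a_{(n)} b` of its coefficients in the basis `λ^n / n!` of `ℂ[λ]`.
Each axiom is the comparison of coefficients in the corresponding identity between polynomials:
* `[∂a_λ b] = -λ [a_λ b]` and `[a_λ ∂b] = (∂ + λ) [a_λ b]`;
* `[b_λ a] = -(-1)^{p(a)p(b)} [a_{-λ-∂} b]`;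
* `[a_λ [b_μ c]] = [[a_λ b]_{λ+μ} c] + (-1)^{p(a)p(b)} [b_μ [a_λ c]]`. -/
structure LieConformalSuperalgebra (R : Type u) [AddCommGroup R] [Module ℂ R] where
  parity : ZMod 2 → Submodule ℂ R
  isCompl : IsCompl (parity 0) (parity 1)
  del : R →ₗ[ℂ] R
  del_mem : ∀ (α : ZMod 2) (a : R), a ∈ parity α → del a ∈ parity α
  lam : R →ₗ[ℂ] R →ₗ[ℂ] (ℕ →₀ R)
  lam_mem : ∀ (α β : ZMod 2) (a b : R), a ∈ parity α → b ∈ parity β →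
    ∀ n, lam a b n ∈ parity (α + β)
  lam_del_left : ∀ (a b : R) (n : ℕ), lam (del a) b n = -((n : ℂ) • lam a b (n - 1))
  lam_del_right : ∀ (a b : R) (n : ℕ),
    lam a (del b) n = del (lam a b n) + (n : ℂ) • lam a b (n - 1)
  skew : ∀ (α β : ZMod 2) (a b : R), a ∈ parity α → b ∈ parity β → ∀ n : ℕ,
    lam b a n = -(superSign α β • (lam a b).sum fun k x =>
      if n ≤ k then ((-1 : ℂ) ^ k / ((k - n).factorial : ℂ)) • (del ^ (k - n)) x else 0)
  jacobi : ∀ (α β : ZMod 2) (a b c : R), a ∈ parity α → b ∈ parity β → ∀ m n : ℕ,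
    lam a (lam b c n) m =
      (∑ j ∈ Finset.range (m + 1), (m.choose j : ℂ) • lam (lam a b j) c (m + n - j)) +
        superSign α β • lam b (lam a c m) n

namespace LieConformalSuperalgebra

variable {R : Type u} [AddCommGroup R] [Module ℂ R] (L : LieConformalSuperalgebra R)

/-- Ideals: graded `ℂ[∂]`-submodules `I` with `R_{(n)} I ⊆ I` for all `n ≥ 0`. -/
structure IsIdeal (I : Submodule ℂ R) : Prop where
  graded : IsGradedSubspace L.parity I
  del_mem : ∀ a ∈ I, L.del a ∈ I
  lam_mem : ∀ (a : R), ∀ b ∈ I, ∀ n : ℕ, L.lam a b n ∈ I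

/-- `R` is simple if its `λ`-bracket is not identically zero and its only ideals are `0` and
`R`. -/
structure IsSimple : Prop where
  lam_ne_zero : ∃ a b : R, L.lam a b ≠ 0
  ideal_trivial : ∀ I : Submodule ℂ R, L.IsIdeal I → I = ⊥ ∨ I = ⊤

/-- A finite set of generators of `R` as a `ℂ[∂]`-module; `R` is finite if there is one. -/
structure FiniteGenerators where
  gens : Finset R
  span_eq_top : Submodule.span ℂ {x : R | ∃ a ∈ gens, ∃ k : ℕ, x = (L.del ^ k) a} = ⊤

/-! ## The Lie superalgebra `Lie R` -/

/-- `∂̃ = ∂ ⊗ 1 + 1 ⊗ ∂_t` on `R[t, t⁻¹]`; here `R[t, t⁻¹]` is `ℤ →₀ R`, with `a t^n`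
represented by `Finsupp.single n a`. -/
def delTilde : (ℤ →₀ R) →ₗ[ℂ] (ℤ →₀ R) :=
  Finsupp.lsum ℂ fun n : ℤ =>
    (Finsupp.lsingle n).comp L.del + (n : ℂ) • Finsupp.lsingle (n - 1)

lemma delTilde_single (n : ℤ) (a : R) :
    L.delTilde (Finsupp.single n a) =
      Finsupp.single n (L.del a) + (n : ℂ) • Finsupp.single (n - 1) a := by
  simp [delTilde]

/-- The `0`-th product on the affinization `R[t, t⁻¹]`:
`(a t^m)_{(0)} (b t^n) = ∑_j (a_{(j)} b) (∂_t^j t^m) t^n / j! = ∑_j binom(m, j) (a_{(j)} b) t^{m+n-j}`. -/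
def affineProd : (ℤ →₀ R) →ₗ[ℂ] (ℤ →₀ R) →ₗ[ℂ] (ℤ →₀ R) :=
  Finsupp.lsum ℂ fun m : ℤ => LinearMap.flip <| Finsupp.lsum ℂ fun n : ℤ => LinearMap.flip <|
    L.lam.compr₂ <| Finsupp.lsum ℂ fun j : ℕ =>
      ((Ring.choose m j : ℤ) : ℂ) • Finsupp.lsingle (m + n - (j : ℤ))

lemma affineProd_single (m n : ℤ) (a b : R) :
    L.affineProd (Finsupp.single m a) (Finsupp.single n b) =
      (L.lam a b).sum fun j x =>
        ((Ring.choose m j : ℤ) : ℂ) • Finsupp.single (m + n - (j : ℤ)) x := by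
  rw [affineProd, Finsupp.lsum_single, LinearMap.flip_apply, Finsupp.lsum_single,
    LinearMap.flip_apply, LinearMap.compr₂_apply, Finsupp.lsum_apply]
  rfl

lemma affineProd_single' (m n : ℤ) (a b : R) (N : ℕ) (hN : ∀ j, N ≤ j → L.lam a b j = 0) :
    L.affineProd (Finsupp.single m a) (Finsupp.single n b) =
      ∑ j ∈ Finset.range N,
        ((Ring.choose m j : ℤ) : ℂ) • Finsupp.single (m + n - (j : ℤ)) (L.lam a b j) := by
  rw [affineProd_single]
  apply Finsupp.sum_of_support_subset
  · intro j hj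
    rw [Finset.mem_range]
    by_contra h
    exact Finsupp.mem_support_iff.1 hj (hN j (not_lt.1 h))
  · simp

lemma exists_bound {M : Type u} [AddCommGroup M] (x : ℕ →₀ M) : ∃ N, ∀ j, N ≤ j → x j = 0 := by
  refine ⟨x.support.sup id + 1, fun j hj => ?_⟩
  by_contra h
  have := Finset.le_sup (f := id) (Finsupp.mem_support_iff.2 h)
  simp only [id] at this
  omega

lemma choose_right (m : ℤ) (j : ℕ) :
    (((j + 1 : ℕ) : ℂ)) * ((Ring.choose m (j + 1) : ℤ) : ℂ) =
      ((m : ℂ) - j) * ((Ring.choose m j : ℤ) : ℂ) := by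
  have h := Ring.choose_smul_choose m (Nat.le_succ j)
  rw [Nat.choose_succ_self_right, Nat.succ_sub (le_refl j), Nat.sub_self, Ring.choose_one_right,
    nsmul_eq_mul, mul_comm (Ring.choose m j)] at h
  exact_mod_cast h

lemma choose_left (m : ℤ) (j : ℕ) :
    (((j + 1 : ℕ) : ℂ)) * ((Ring.choose m (j + 1) : ℤ) : ℂ) =
      (m : ℂ) * ((Ring.choose (m - 1) j : ℤ) : ℂ) := by
  have h := Ring.choose_smul_choose m (Nat.succ_le_succ (Nat.zero_le j))
  rw [Nat.choose_one_right, Nat.succ_sub_one, Ring.choose_one_right, nsmul_eq_mul] at h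
  exact_mod_cast h

lemma affineProd_delTilde_left (x y : ℤ →₀ R) : L.affineProd (L.delTilde x) y = 0 := by
  suffices h : L.affineProd.comp L.delTilde = 0 by
    exact LinearMap.congr_fun (LinearMap.congr_fun h x) y
  ext m a n b : 4
  simp only [LinearMap.comp_apply, Finsupp.lsingle_apply, LinearMap.zero_apply,
    delTilde_single, map_add, map_smul, LinearMap.add_apply, LinearMap.smul_apply]
  obtain ⟨N, hN⟩ := exists_bound (L.lam a b)
  have hN' : ∀ j, N + 1 ≤ j → L.lam (L.del a) b j = 0 := fun j hj => by
    rw [L.lam_del_left, hN _ (by omega), smul_zero, neg_zero]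
  rw [L.affineProd_single' m n _ b _ hN', L.affineProd_single' (m - 1) n a b N hN,
    Finset.sum_range_succ', L.lam_del_left a b 0, Finset.smul_sum]
  simp only [Nat.cast_zero, zero_smul, neg_zero, Finsupp.single_zero, smul_zero, add_zero,
    ← Finset.sum_add_distrib]
  refine Finset.sum_eq_zero fun j _ => ?_
  rw [L.lam_del_left, Nat.add_sub_cancel, smul_smul, ← choose_left,
    show m - 1 + n - (j : ℤ) = m + n - ((j + 1 : ℕ) : ℤ) by push_cast; ring, ← smul_neg,
    ← Finsupp.smul_single, smul_smul, mul_comm, Finsupp.single_neg, smul_neg, neg_add_cancel]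

lemma affineProd_delTilde_right (x y : ℤ →₀ R) :
    L.affineProd x (L.delTilde y) = L.delTilde (L.affineProd x y) := by
  suffices h : L.affineProd.compl₂ L.delTilde = L.affineProd.compr₂ L.delTilde by
    exact LinearMap.congr_fun (LinearMap.congr_fun h x) y
  ext m a n b : 4
  simp only [LinearMap.comp_apply, Finsupp.lsingle_apply, LinearMap.compl₂_apply,
    LinearMap.compr₂_apply, delTilde_single, map_add, map_smul]
  obtain ⟨N, hN⟩ := exists_bound (L.lam a b)
  have hN' : ∀ j, N + 1 ≤ j → L.lam a (L.del b) j = 0 := fun j hj => by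
    rw [L.lam_del_right, hN _ (by omega), hN _ (by omega), smul_zero, map_zero, add_zero]
  rw [L.affineProd_single' m n a _ _ hN', L.affineProd_single' m (n - 1) a b N hN,
    L.affineProd_single' m n a b N hN, map_sum]
  have e1 : ∑ j ∈ Finset.range (N + 1), ((Ring.choose m j : ℤ) : ℂ) •
        Finsupp.single (m + n - (j : ℤ)) (L.lam a (L.del b) j) =
      ∑ j ∈ Finset.range N, ((Ring.choose m j : ℤ) : ℂ) •
        Finsupp.single (m + n - (j : ℤ)) (L.del (L.lam a b j)) +
      ∑ j ∈ Finset.range N, (((m : ℂ) - j) * ((Ring.choose m j : ℤ) : ℂ)) •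
        Finsupp.single (m + n - 1 - (j : ℤ)) (L.lam a b j) := by
    simp only [L.lam_del_right, Finsupp.single_add, smul_add, Finset.sum_add_distrib]
    congr 1
    · rw [Finset.sum_range_succ, hN N le_rfl]
      simp
    · rw [Finset.sum_range_succ']
      simp only [Nat.cast_zero, zero_smul, Finsupp.single_zero, smul_zero, add_zero]
      refine Finset.sum_congr rfl fun j _ => ?_
      rw [Nat.add_sub_cancel, ← choose_right, ← Finsupp.smul_single, smul_smul, mul_comm,
        show m + n - 1 - (j : ℤ) = m + n - ((j + 1 : ℕ) : ℤ) by push_cast; ring]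
  rw [e1, Finset.smul_sum, add_assoc, ← Finset.sum_add_distrib, ← Finset.sum_add_distrib]
  refine Finset.sum_congr rfl fun j _ => ?_
  rw [map_smul, delTilde_single, smul_add, smul_smul, smul_smul,
    show m + (n - 1) - (j : ℤ) = m + n - 1 - (j : ℤ) by ring,
    show m + n - (j : ℤ) - 1 = m + n - 1 - (j : ℤ) by ring, ← add_smul]
  congr 2
  push_cast
  ring

/-- `Lie R = R[t, t⁻¹] / ∂̃ R[t, t⁻¹]` -/
abbrev LieAlg : Type u := (ℤ →₀ R) ⧸ LinearMap.range L.delTilde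

/-- `a_n`, the image of `a t^n` in `Lie R`. -/
def mode (n : ℤ) : R →ₗ[ℂ] L.LieAlg :=
  (LinearMap.range L.delTilde).mkQ.comp (Finsupp.lsingle n)

/-- The bracket of `Lie R`, induced by the `0`-th product of the affinization. -/
def lieBracket : L.LieAlg →ₗ[ℂ] L.LieAlg →ₗ[ℂ] L.LieAlg :=
  ((LinearMap.range L.delTilde).liftQ
    ((LinearMap.range L.delTilde).liftQ
      (L.affineProd.compr₂ (LinearMap.range L.delTilde).mkQ) (by
        rintro _ ⟨x, rfl⟩
        rw [LinearMap.mem_ker]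
        refine LinearMap.ext fun y => ?_
        rw [LinearMap.compr₂_apply, affineProd_delTilde_left, map_zero, LinearMap.zero_apply])).flip
        (by
      rintro _ ⟨y, rfl⟩
      rw [LinearMap.mem_ker]
      refine LinearMap.ext fun x => ?_
      obtain ⟨x, rfl⟩ := Submodule.mkQ_surjective _ x
      change (LinearMap.range L.delTilde).mkQ (L.affineProd x (L.delTilde y)) = 0
      rw [affineProd_delTilde_right]
      simp)).flip

/-- `[a_m, b_n] = ∑_j binom(m, j) (a_{(j)} b)_{m+n-j}` -/
lemma lieBracket_mode (m n : ℤ) (a b : R) :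
    L.lieBracket (L.mode m a) (L.mode n b) =
      (L.lam a b).sum fun j x => ((Ring.choose m j : ℤ) : ℂ) • L.mode (m + n - (j : ℤ)) x := by
  change (LinearMap.range L.delTilde).mkQ
    (L.affineProd (Finsupp.single m a) (Finsupp.single n b)) = _
  rw [affineProd_single, Finsupp.sum, map_sum]
  rfl

/-- `(∂a)_n = -n a_{n-1}` -/
lemma mode_del (n : ℤ) (a : R) : L.mode n (L.del a) = -((n : ℂ) • L.mode (n - 1) a) := by
  rw [eq_neg_iff_add_eq_zero]
  have h : (LinearMap.range L.delTilde).mkQ (L.delTilde (Finsupp.single n a)) = 0 := by simp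
  rw [delTilde_single, map_add, map_smul] at h
  exact h

/-! ## The subalgebra `(Lie R)_-` and its quasi-filtration -/

/-- `(Lie R)_- = ⟨a_n | a ∈ R, n ≥ 0⟩` -/
def lieMinus : Submodule ℂ L.LieAlg :=
  Submodule.span ℂ {x | ∃ (a : R) (n : ℕ), x = L.mode n a}

lemma mode_mem (a : R) (n : ℕ) : L.mode n a ∈ L.lieMinus := Submodule.subset_span ⟨a, n, rfl⟩

lemma lieBracket_mode_mem (U : Submodule ℂ L.LieAlg) (a b : R) (m n : ℕ)
    (h : ∀ j ≤ m, L.lam a b j ≠ 0 → L.mode ((m + n - j : ℕ) : ℤ) (L.lam a b j) ∈ U) :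
    L.lieBracket (L.mode m a) (L.mode n b) ∈ U := by
  rw [lieBracket_mode]
  refine Submodule.sum_mem _ fun j hj => ?_
  dsimp only
  by_cases hjm : j ≤ m
  · have e : (m : ℤ) + n - j = ((m + n - j : ℕ) : ℤ) := by omega
    rw [e]
    exact U.smul_mem _ (h j hjm (Finsupp.mem_support_iff.1 hj))
  · rw [Ring.choose_natCast, Nat.choose_eq_zero_of_lt (by omega)]
    simp

lemma lieBracket_mem {x y : L.LieAlg} (hx : x ∈ L.lieMinus) (hy : y ∈ L.lieMinus) :
    L.lieBracket x y ∈ L.lieMinus := by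
  induction hx, hy using Submodule.span_induction₂ with
  | mem_mem x y hx hy =>
    obtain ⟨a, m, rfl⟩ := hx
    obtain ⟨b, n, rfl⟩ := hy
    exact L.lieBracket_mode_mem _ a b m n fun j _ _ => L.mode_mem _ _
  | zero_left => simp
  | zero_right => simp
  | add_left x y z _ _ _ h h' => simpa using add_mem h h'
  | add_right x y z _ _ _ h h' => simpa using add_mem h h'
  | smul_left c x y _ _ h => simpa using Submodule.smul_mem _ c h
  | smul_right c x y _ _ h => simpa using Submodule.smul_mem _ c h

/-- The bracket of the subalgebra `(Lie R)_-`. -/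
def minusBracket : L.lieMinus →ₗ[ℂ] L.lieMinus →ₗ[ℂ] L.lieMinus :=
  LinearMap.mk₂ ℂ (fun x y => ⟨L.lieBracket x y, L.lieBracket_mem x.2 y.2⟩)
    (fun _ _ _ => by ext1; simp) (fun _ _ _ => by ext1; simp)
    (fun _ _ _ => by ext1; simp) (fun _ _ _ => by ext1; simp)

/-- The parity of `(Lie R)_-`: `p(a_n) = p(a)`. -/
def minusParity (α : ZMod 2) : Submodule ℂ L.lieMinus :=
  Submodule.span ℂ {x | ∃ a ∈ L.parity α, ∃ n : ℕ, (x : L.LieAlg) = L.mode n a}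

variable {L} (S : L.FiniteGenerators)

namespace FiniteGenerators

/-- `ℒ_m`, the span of the `a_i` with `a` among the generators and `i ≥ m`. -/
def filAux (m : ℕ) : Submodule ℂ L.LieAlg :=
  Submodule.span ℂ {x | ∃ a ∈ S.gens, ∃ i : ℕ, m ≤ i ∧ x = L.mode i a}

/-- `ℒ_m` as a subspace of `(Lie R)_-`. -/
def fil (m : ℕ) : Submodule ℂ L.lieMinus := (S.filAux m).comap L.lieMinus.subtype

lemma filAux_anti {m n : ℕ} (h : m ≤ n) : S.filAux n ≤ S.filAux m :=
  Submodule.span_mono fun _ ⟨a, ha, i, hi, e⟩ => ⟨a, ha, i, h.trans hi, e⟩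

lemma fil_anti {m n : ℕ} (h : m ≤ n) : S.fil n ≤ S.fil m :=
  Submodule.comap_mono (S.filAux_anti h)

lemma mode_pow_mem (a : R) (ha : a ∈ S.gens) (k : ℕ) : ∀ m n : ℕ, m + k ≤ n →
    L.mode n ((L.del ^ k) a) ∈ S.filAux m := by
  induction k with
  | zero => exact fun m n h => Submodule.subset_span ⟨a, ha, n, h, rfl⟩
  | succ k ih =>
    intro m n h
    obtain ⟨n, rfl⟩ : ∃ n', n = n' + 1 := ⟨n - 1, by omega⟩
    rw [pow_succ', Module.End.mul_apply, mode_del]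
    refine neg_mem (Submodule.smul_mem _ _ ?_)
    simpa using ih m n (by omega)

lemma mode_pow_mem_zero (a : R) (ha : a ∈ S.gens) (k : ℕ) : ∀ n : ℕ,
    L.mode n ((L.del ^ k) a) ∈ S.filAux 0 := by
  induction k with
  | zero => exact fun n => Submodule.subset_span ⟨a, ha, n, Nat.zero_le _, rfl⟩
  | succ k ih =>
    intro n
    rw [pow_succ', Module.End.mul_apply, mode_del]
    refine neg_mem ?_
    cases n with
    | zero => simp
    | succ n => exact Submodule.smul_mem _ _ (by simpa using ih n)

lemma exists_shift (a : R) : ∃ K : ℕ, ∀ m n : ℕ, m + K ≤ n → L.mode n a ∈ S.filAux m := by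
  have ha : a ∈ (⊤ : Submodule ℂ R) := trivial
  rw [← S.span_eq_top] at ha
  induction ha using Submodule.span_induction with
  | mem a h =>
    obtain ⟨b, hb, k, rfl⟩ := h
    exact ⟨k, S.mode_pow_mem b hb k⟩
  | zero => exact ⟨0, fun m n _ => by simp⟩
  | add a b _ _ h h' =>
    obtain ⟨K, hK⟩ := h
    obtain ⟨K', hK'⟩ := h'
    refine ⟨max K K', fun m n hmn => ?_⟩
    rw [map_add]
    exact add_mem (hK m n (by omega)) (hK' m n (by omega))
  | smul c a _ h =>
    obtain ⟨K, hK⟩ := h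
    refine ⟨K, fun m n hmn => ?_⟩
    rw [map_smul]
    exact Submodule.smul_mem _ _ (hK m n hmn)

lemma lieMinus_le : L.lieMinus ≤ S.filAux 0 := by
  refine Submodule.span_le.2 ?_
  rintro _ ⟨a, n, rfl⟩
  have ha : a ∈ (⊤ : Submodule ℂ R) := trivial
  rw [← S.span_eq_top] at ha
  induction ha using Submodule.span_induction with
  | mem a h =>
    obtain ⟨b, hb, k, rfl⟩ := h
    exact S.mode_pow_mem_zero b hb k n
  | zero => simp
  | add a b _ _ h h' => rw [map_add]; exact add_mem h h'
  | smul c a _ h => rw [map_smul]; exact Submodule.smul_mem _ _ h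

lemma exists_depth : ∃ d : ℕ, ∀ a ∈ S.gens, ∀ b ∈ S.gens, ∀ m n N : ℕ, N + d ≤ m + n →
    L.lieBracket (L.mode m a) (L.mode n b) ∈ S.filAux N := by
  choose K hK using S.exists_shift
  refine ⟨S.gens.sup fun a => S.gens.sup fun b => (L.lam a b).support.sup fun j =>
    K (L.lam a b j) + j, fun a ha b hb m n N h => ?_⟩
  refine L.lieBracket_mode_mem _ a b m n fun j hj hne => hK _ _ _ ?_
  have h1 := Finset.le_sup (f := fun j => K (L.lam a b j) + j) (Finsupp.mem_support_iff.2 hne)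
  have h2 := Finset.le_sup (f := fun b => (L.lam a b).support.sup fun j =>
    K (L.lam a b j) + j) hb
  have h3 := Finset.le_sup (f := fun a => S.gens.sup fun b => (L.lam a b).support.sup fun j =>
    K (L.lam a b j) + j) ha
  have h4 := h1.trans (h2.trans h3)
  omega

/-- The bracket is compatible with the quasi-filtration: `[ℒ_i, ℒ_j] ⊆ ℒ_{i+j-d}`. -/
lemma exists_lieBracket_mem : ∃ d : ℕ, ∀ i j N : ℕ, N + d ≤ i + j →
    ∀ x ∈ S.filAux i, ∀ y ∈ S.filAux j, L.lieBracket x y ∈ S.filAux N := by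
  obtain ⟨d, hd⟩ := S.exists_depth
  refine ⟨d, fun i j N h x hx y hy => ?_⟩
  induction hx, hy using Submodule.span_induction₂ with
  | mem_mem x y hx hy =>
    obtain ⟨a, ha, m, hm, rfl⟩ := hx
    obtain ⟨b, hb, n, hn, rfl⟩ := hy
    exact hd a ha b hb m n N (by omega)
  | zero_left => simp
  | zero_right => simp
  | add_left x y z _ _ _ h h' => simpa using add_mem h h'
  | add_right x y z _ _ _ h h' => simpa using add_mem h h'
  | smul_left c x y _ _ h => simpa using Submodule.smul_mem _ c h
  | smul_right c x y _ _ h => simpa using Submodule.smul_mem _ c h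

/-- An integer `d ≥ 0` with `[ℒ_i, ℒ_j] ⊆ ℒ_{i+j-d}`. -/
def depth : ℕ := S.exists_lieBracket_mem.choose

lemma minusBracket_mem_left (m : ℕ) (x y : L.lieMinus) (hx : x ∈ S.fil (m + S.depth)) :
    L.minusBracket x y ∈ S.fil m :=
  S.exists_lieBracket_mem.choose_spec _ 0 m le_rfl x.1 hx y.1 (S.lieMinus_le y.2)

lemma minusBracket_mem_right (m : ℕ) (x y : L.lieMinus) (hy : y ∈ S.fil (m + S.depth)) :
    L.minusBracket x y ∈ S.fil m :=
  S.exists_lieBracket_mem.choose_spec 0 _ m (by rw [Nat.zero_add]; exact le_rfl) x.1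
    (S.lieMinus_le x.2) y.1 hy

/-! ## The annihilation algebra -/

/-- `(Lie R)_- / ℒ_m` -/
def Level (m : ℕ) : Type u := L.lieMinus ⧸ S.fil m

instance (m : ℕ) : AddCommGroup (S.Level m) := inferInstanceAs (AddCommGroup (L.lieMinus ⧸ S.fil m))

instance (m : ℕ) : Module ℂ (S.Level m) :=
  inferInstanceAs (Module ℂ (L.lieMinus ⧸ S.fil m))

/-- The projection `(Lie R)_- → (Lie R)_- / ℒ_m`. -/
def toLevel (m : ℕ) : L.lieMinus →ₗ[ℂ] S.Level m := (S.fil m).mkQ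

lemma toLevel_surjective (m : ℕ) : Function.Surjective (S.toLevel m) :=
  Submodule.mkQ_surjective _

/-- The projection `(Lie R)_- / ℒ_n → (Lie R)_- / ℒ_m` for `m ≤ n`. -/
def transition {m n : ℕ} (h : m ≤ n) : S.Level n →ₗ[ℂ] S.Level m :=
  (S.fil n).mapQ (S.fil m) LinearMap.id (S.fil_anti h)

lemma transition_toLevel {m n : ℕ} (h : m ≤ n) (u : L.lieMinus) :
    S.transition h (S.toLevel n u) = S.toLevel m u := rfl

/-- The annihilation algebra `𝒜(R)`, i.e. the completion `lim_m (Lie R)_- / ℒ_m` of `(Lie R)_-`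
with respect to the (quasi-)filtration `ℒ_m`. -/
def annihilation : Submodule ℂ (∀ m : ℕ, S.Level m) where
  carrier := {x | ∀ (m n : ℕ) (h : m ≤ n), S.transition h (x n) = x m}
  zero_mem' := fun _ _ _ => map_zero _
  add_mem' := fun hx hy m n h => by
    rw [Pi.add_apply, map_add, hx m n h, hy m n h, Pi.add_apply]
  smul_mem' := fun c x hx m n h => by
    rw [Pi.smul_apply, map_smul, hx m n h, Pi.smul_apply]

/-- `𝒜(R)` as a type. -/
abbrev Annihilation : Type u := S.annihilation

/-- The projections `𝒜(R) → (Lie R)_- / ℒ_m`. -/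
def proj (m : ℕ) : S.Annihilation →ₗ[ℂ] S.Level m :=
  (LinearMap.proj m).comp S.annihilation.subtype

/-- The topology of the completion: the inverse limit of discrete topologies. -/
instance : TopologicalSpace S.Annihilation :=
  ⨅ m : ℕ, TopologicalSpace.induced (S.proj m) ⊥

/-- The bracket `(Lie R)_- / ℒ_{m+d} × (Lie R)_- / ℒ_{m+d} → (Lie R)_- / ℒ_m`. -/
def levelBracket (m : ℕ) :
    S.Level (m + S.depth) →ₗ[ℂ] S.Level (m + S.depth) →ₗ[ℂ] S.Level m :=
  ((S.fil (m + S.depth)).liftQ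
    ((S.fil (m + S.depth)).liftQ (L.minusBracket.compr₂ (S.toLevel m)) (by
        intro x hx
        rw [LinearMap.mem_ker]
        refine LinearMap.ext fun y => ?_
        exact (Submodule.Quotient.mk_eq_zero _).2 (S.minusBracket_mem_left m x y hx))).flip (by
      intro y hy
      rw [LinearMap.mem_ker]
      refine LinearMap.ext fun x => ?_
      obtain ⟨x, rfl⟩ := Submodule.mkQ_surjective _ x
      exact (Submodule.Quotient.mk_eq_zero _).2 (S.minusBracket_mem_right m x y hy))).flip

lemma levelBracket_toLevel (m : ℕ) (x y : L.lieMinus) :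
    S.levelBracket m (S.toLevel (m + S.depth) x) (S.toLevel (m + S.depth) y) =
      S.toLevel m (L.minusBracket x y) := rfl

lemma bracket_compat (x y : S.Annihilation) (m n : ℕ) (h : m ≤ n) :
    S.transition h
      (S.levelBracket n (S.proj (n + S.depth) x) (S.proj (n + S.depth) y)) =
      S.levelBracket m (S.proj (m + S.depth) x) (S.proj (m + S.depth) y) := by
  have hx : S.transition (Nat.add_le_add_right h S.depth)
    (S.proj (n + S.depth) x) = S.proj (m + S.depth) x := x.2 _ _ _
  have hy : S.transition (Nat.add_le_add_right h S.depth)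
    (S.proj (n + S.depth) y) = S.proj (m + S.depth) y := y.2 _ _ _
  rw [← hx, ← hy]
  obtain ⟨u, hu⟩ := S.toLevel_surjective _ (S.proj (n + S.depth) x)
  obtain ⟨v, hv⟩ := S.toLevel_surjective _ (S.proj (n + S.depth) y)
  rw [← hu, ← hv, levelBracket_toLevel, transition_toLevel, transition_toLevel,
    transition_toLevel, levelBracket_toLevel]

/-- The super structure of `𝒜(R)`: the bracket is the continuous extension of that of `(Lie R)_-`
(see `bracket_completionMap`), and the parity subspaces are the closures of those of
`(Lie R)_-`. -/
instance : SuperBracket S.Annihilation where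
  parity α := ⨅ m : ℕ, ((L.minusParity α).map (S.toLevel m)).comap (S.proj m)
  bracket := LinearMap.mk₂ ℂ
    (fun x y => (⟨fun m => S.levelBracket m (S.proj (m + S.depth) x) (S.proj (m + S.depth) y),
      fun m n h => S.bracket_compat x y m n h⟩ : S.annihilation))
    (fun _ _ _ => Subtype.ext (funext fun m => by simp))
    (fun _ _ _ => Subtype.ext (funext fun m => by simp))
    (fun _ _ _ => Subtype.ext (funext fun m => by simp))
    (fun _ _ _ => Subtype.ext (funext fun m => by simp))

/-- The canonical map `(Lie R)_- → 𝒜(R)`. -/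
def completionMap : L.lieMinus →ₗ[ℂ] S.Annihilation :=
  LinearMap.codRestrict S.annihilation (LinearMap.pi fun m => S.toLevel m)
    fun _ _ _ _ => rfl

theorem bracket_completionMap (x y : L.lieMinus) :
    bracket (S.completionMap x) (S.completionMap y) = S.completionMap (L.minusBracket x y) := rfl

end FiniteGenerators

end LieConformalSuperalgebra

end

/-!
The annihilation algebra `A = 𝒜(R)` is a linearly compact Lie superalgebra with a continuous even
derivation `T`, induced by `∂`. That the bracket of `(Lie R)_-` satisfies the axioms is checked on
generating functions: `[a_m, b_n]` is the image of the polynomial `(x + y)^m y^n` under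
`x^j y^l ↦ (a_{(j)} b)_l`, and skew-symmetry and the Jacobi identity become substitutions in
polynomials. Linear compactness (`isLinearlyCompact`) holds because `A` is an inverse limit of the
finite-dimensional spaces `(Lie R)_- / ℒ_m`.

Simplicity of `R` has three consequences for `A`.

* A `T`-invariant proper closed graded ideal `I` of `A` is central (`central_of_invariant`). For the
  action of `(Lie R)_-` on `R` by `a_n · b = a_{(n)} b`, the formula
  `(x · b)_n = ∑_k [T^k x / k!, b_{n+k}]` shows that for `x ∈ I` all modes of `x · b` lie in `I`.
  The elements of `R` all of whose modes lie in `I` form a proper ideal of `R`, so `x · b = 0`, and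
  `[x, b_n] = ∑_k ((-T)^k x / k! · b)_{n+k}` vanishes as well.
* `A = [A, A]` (`span_bracket_eq_top`): `R` is spanned by the products `a_{(m)} b`, so `A` is a
  finite sum of subspaces `[e, A]`, which are closed by linear compactness.
* `A` has a maximal closed graded ideal `M` (`exists_maximal_ideal`): an ideal which contains good
  approximations of these finitely many `e` is everything (`exists_eq_top_of_approx`), so the
  closure of the union of a chain of proper closed ideals is proper.

The quotient `𝔰 = A / M` is simple because `A` is perfect. Let `M_k` be the subspace of all `x` with
`x, T x, …, T^{k-1} x ∈ M`. The subspace `T^k M_k + M` (`leadingSubspace`) is a closed graded ideal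
containing `M`, so it is `M` or `A`. If it is `A` for all `k`, then the Taylor expansion
`x ↦ ∑_k t^k / k! (T^k x mod M)` is a homomorphism of `A` onto `𝔰[[t]]`, by linear compactness, and
its kernel is `T`-invariant, hence central; this is the case `r = 1`. Otherwise let `k` be minimal
with `T^k M_k + M = M`. If `k ≥ 2`, then `T^k [x, y] ≡ k [T x, T^{k-1} y]` modulo `M` for `x ∈ M_1`
and `y ∈ M_{k-1}`, and therefore `[A, A] ⊆ M` (`bracket_mem_of_leadingSubspace`), which is absurd.
So `k = 1`, i.e. `M` is `T`-invariant and hence central; this is the case `r = 0`. Both cases are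
`exists_irreducibleCentralExtension`.
-/

noncomputable section

open SuperBracket

/-! ### Linearly topologized spaces -/

/-- Hausdorff linearly topologized vector spaces over the discrete field `ℂ`: the conditions of
`IsLinearlyCompact` without the intersection property. -/
structure IsHausdorffLinear (V : Type u) [AddCommGroup V] [Module ℂ V] [TopologicalSpace V] :
    Prop where
  t2 : T2Space V
  addGroup : IsTopologicalAddGroup V
  smul : ContinuousConstSMul ℂ V
  linear : ∀ U ∈ nhds (0 : V), ∃ W : Submodule ℂ V, IsOpen (W : Set V) ∧ (W : Set V) ⊆ U

/-- The open subspaces of finite codimension form a fundamental system of neighbourhoods of `0`. -/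
def HasFiniteCodimBasis (V : Type u) [AddCommGroup V] [Module ℂ V] [TopologicalSpace V] : Prop :=
  ∀ U ∈ nhds (0 : V), ∃ W : Submodule ℂ V, IsOpen (W : Set V) ∧ (W : Set V) ⊆ U ∧
    FiniteDimensional ℂ (V ⧸ W)

section LinearTopology

variable {V : Type u} {Y : Type v} [AddCommGroup V] [Module ℂ V] [TopologicalSpace V]
  [AddCommGroup Y] [Module ℂ Y] [TopologicalSpace Y]

lemma IsLinearlyCompact.isHausdorffLinear (h : IsLinearlyCompact V) : IsHausdorffLinear V :=
  ⟨h.t2, h.addGroup, h.smul, h.linear⟩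

lemma exists_finite_forall_mem_of_iInf {V : Type u} [AddCommGroup V] [Module ℂ V]
    [t : TopologicalSpace V] {ι : Type*} {D : ι → Type*} [∀ i, AddCommGroup (D i)]
    [∀ i, Module ℂ (D i)] (f : ∀ i, V →ₗ[ℂ] D i)
    (ht : t = ⨅ i, TopologicalSpace.induced (f i) ⊥) {U : Set V} (hU : U ∈ nhds (0 : V)) :
    ∃ I : Set ι, I.Finite ∧ ∀ x, (∀ i ∈ I, f i x = 0) → x ∈ U := by
  subst ht
  rw [nhds_iInf, Filter.mem_iInf] at hU
  obtain ⟨I, hI, W, hW, rfl⟩ := hU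
  refine ⟨I, hI, fun x hx => ?_⟩
  rw [Set.mem_iInter]
  intro i
  obtain ⟨t, ht, hts⟩ := (@mem_nhds_induced (D i) V ⊥ _ _ _).1 (hW i)
  apply hts
  have h1 : f i x = f i 0 := by rw [map_zero, hx i i.2]
  change f i x ∈ t
  rw [h1]
  exact @mem_of_mem_nhds _ ⊥ _ _ ht

lemma isHausdorffLinear_iInf {V : Type u} [AddCommGroup V] [Module ℂ V] [t : TopologicalSpace V]
    {ι : Type*} {D : ι → Type*} [∀ i, AddCommGroup (D i)]
    [∀ i, Module ℂ (D i)] (f : ∀ i, V →ₗ[ℂ] D i) (hf : ∀ x, (∀ i, f i x = 0) → x = 0)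
    (ht : t = ⨅ i, TopologicalSpace.induced (f i) ⊥) :
    IsHausdorffLinear V := by
  subst ht
  let τ := ⨅ i, TopologicalSpace.induced (f i) ⊥
  have hopen : ∀ i, ∀ s : Set (D i), @IsOpen V τ (f i ⁻¹' s) := fun i s =>
    TopologicalSpace.le_def.1 (iInf_le _ i) _ ⟨s, trivial, rfl⟩
  refine ⟨?_, ?_, ⟨fun c => ?_⟩, ?_⟩
  · refine ⟨fun x y hxy => ?_⟩
    obtain ⟨i, hi⟩ : ∃ i, f i x ≠ f i y := by
      by_contra! h
      exact hxy (sub_eq_zero.1 (hf _ fun i => by rw [map_sub, h i, sub_self]))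
    exact ⟨f i ⁻¹' {f i x}, f i ⁻¹' {f i y}, hopen i _, hopen i _, rfl, rfl,
      Set.disjoint_left.2 fun z hz hz' => hi (hz.symm.trans hz')⟩
  · refine topologicalAddGroup_iInf fun i => ?_
    let _ : TopologicalSpace (D i) := ⊥
    have : DiscreteTopology (D i) := ⟨rfl⟩
    exact topologicalAddGroup_induced (f i)
  · refine continuous_iInf_rng.2 fun i => ?_
    let _ : TopologicalSpace (D i) := ⊥
    refine continuous_induced_rng.2 ⟨fun s _ => ?_⟩
    have e : (f i ∘ fun x => c • x) ⁻¹' s = f i ⁻¹' ((fun y => c • y) ⁻¹' s) := by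
      ext x
      simp
    rw [e]
    exact hopen i _
  · intro U hU
    obtain ⟨I, hI, hIU⟩ := exists_finite_forall_mem_of_iInf f rfl hU
    refine ⟨⨅ i : I, LinearMap.ker (f i), ?_, fun x hx => hIU x fun i hi => ?_⟩
    · have : Finite I := hI
      rw [Submodule.coe_iInf]
      exact isOpen_iInter_of_finite fun i => hopen i {0}
    · exact (Submodule.mem_iInf _).1 hx ⟨i, hi⟩

namespace IsHausdorffLinear

lemma mem_closure_iff (h : IsHausdorffLinear V) (s : Set V) (x : V) :
    x ∈ closure s ↔ ∀ W : Submodule ℂ V, IsOpen (W : Set V) → ∃ y ∈ s, y - x ∈ W := by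
  have := h.addGroup
  constructor
  · intro hx W hW
    obtain ⟨y, hy, hys⟩ := mem_closure_iff_nhds.1 hx ((fun y => y - x) ⁻¹' (W : Set V))
      ((hW.preimage (by fun_prop)).mem_nhds (by simp))
    exact ⟨y, hys, hy⟩
  · intro hx
    rw [mem_closure_iff_nhds]
    intro t ht
    obtain ⟨W, hW, hWt⟩ := h.linear ((fun y => y + x) ⁻¹' t)
      ((by fun_prop : Continuous fun y => y + x).continuousAt.preimage_mem_nhds (by simpa using ht))
    obtain ⟨y, hys, hy⟩ := hx W hW
    exact ⟨y, by simpa using hWt hy, hys⟩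

lemma isClosed_of_isOpen (h : IsHausdorffLinear V) (W : Submodule ℂ V) (hW : IsOpen (W : Set V)) :
    IsClosed (W : Set V) := by
  have := h.addGroup
  exact W.toAddSubgroup.isClosed_of_isOpen hW

lemma isOpen_mono (h : IsHausdorffLinear V) {U W : Submodule ℂ V} (hUW : U ≤ W)
    (hU : IsOpen (U : Set V)) : IsOpen (W : Set V) := by
  have := h.addGroup
  exact Submodule.isOpen_mono hUW hU

/-- The cosets of a closed subspace separate points: a vector lying in `W + O` for every open
subspace `O` lies in the closed subspace `W`. -/
lemma mem_of_forall_mem_sup (h : IsHausdorffLinear V) {W : Submodule ℂ V}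
    (hW : IsClosed (W : Set V)) {x : V}
    (hx : ∀ O : Submodule ℂ V, IsOpen (O : Set V) → x ∈ W ⊔ O) : x ∈ W := by
  rw [← SetLike.mem_coe, ← hW.closure_eq, h.mem_closure_iff]
  intro O hO
  obtain ⟨w, hw, o, ho, rfl⟩ := Submodule.mem_sup.1 (hx O hO)
  exact ⟨w, hw, by simpa using ho⟩

/-- Closed subspaces of finite codimension are open. -/
lemma isOpen_of_finiteDimensional_quotient (h : IsHausdorffLinear V) {W : Submodule ℂ V}
    (hW : IsClosed (W : Set V)) (hfd : FiniteDimensional ℂ (V ⧸ W)) : IsOpen (W : Set V) := by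
  let X : Set (Submodule ℂ (V ⧸ W)) :=
    {Q | ∃ O : Submodule ℂ V, IsOpen (O : Set V) ∧ O.map W.mkQ = Q}
  -- an open `O` with minimal image in `V ⧸ W` lies in `W + O'` for all open `O'`
  obtain ⟨_, ⟨O, hO, rfl⟩, hmin⟩ := wellFounded_lt.has_min X ⟨_, ⊤, isOpen_univ, rfl⟩
  refine h.isOpen_mono (fun x hx => h.mem_of_forall_mem_sup hW fun O' hO' => ?_) hO
  have h1 : (O ⊓ O').map W.mkQ = O.map W.mkQ := by
    by_contra hne
    exact hmin _ ⟨O ⊓ O', hO.inter hO', rfl⟩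
      (lt_of_le_of_ne (Submodule.map_mono inf_le_left) hne)
  obtain ⟨y, hy, hyx⟩ : W.mkQ x ∈ (O ⊓ O').map W.mkQ := h1 ▸ Submodule.mem_map_of_mem hx
  have h2 : x - y ∈ W := by
    rw [← Submodule.Quotient.mk_eq_zero, Submodule.Quotient.mk_sub]
    exact sub_eq_zero.2 hyx.symm
  rw [← sub_add_cancel x y]
  exact add_mem (Submodule.mem_sup_left h2) (Submodule.mem_sup_right hy.2)

end IsHausdorffLinear

/-- The set `{x ∈ U | f x - y ∈ W}` as an affine subspace. -/
def affineFiber (U : Submodule ℂ V) (f : V →ₗ[ℂ] Y) (y : Y) (W : Submodule ℂ Y) :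
    AffineSubspace ℂ V where
  carrier := {x | x ∈ U ∧ f x - y ∈ W}
  smul_vsub_vadd_mem' := by
    intro c p q s hp hq hs
    refine ⟨U.add_mem (U.smul_mem c (U.sub_mem hp.1 hq.1)) hs.1, ?_⟩
    have e : f (c • (p -ᵥ q) +ᵥ s) - y = c • ((f p - y) - (f q - y)) + (f s - y) := by
      simp only [vsub_eq_sub, vadd_eq_add, map_add, map_smul, map_sub]
      module
    rw [e]
    exact W.add_mem (W.smul_mem c (W.sub_mem hp.2 hq.2)) hs.2

lemma isClosed_affineFiber {U : Submodule ℂ V} (hU : IsClosed (U : Set V)) {f : V →ₗ[ℂ] Y}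
    (hf : Continuous f) (hY : IsHausdorffLinear Y) (y : Y) {W : Submodule ℂ Y}
    (hW : IsClosed (W : Set Y)) : IsClosed (affineFiber U f y W : Set V) := by
  have := hY.addGroup
  exact hU.inter (hW.preimage (by fun_prop : Continuous fun x => f x - y))

namespace IsLinearlyCompact

/-- A continuous linear image of a closed subspace of a linearly compact space, enlarged by a
closed subspace, is closed. -/
lemma isClosed_map_sup (hV : IsLinearlyCompact V) (hY : IsHausdorffLinear Y) {f : V →ₗ[ℂ] Y}
    (hf : Continuous f) {U : Submodule ℂ V} (hU : IsClosed (U : Set V)) {W : Submodule ℂ Y}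
    (hW : IsClosed (W : Set Y)) : IsClosed ((U.map f ⊔ W : Submodule ℂ Y) : Set Y) := by
  refine isClosed_of_closure_subset fun y hy => ?_
  rw [hY.mem_closure_iff] at hy
  have key := hV.inter
    (Set.range fun O : {O : Submodule ℂ Y // IsOpen (O : Set Y)} => affineFiber U f y (W ⊔ O.1))
    ?_ ?_
  · obtain ⟨x, hx⟩ := key
    simp only [Set.mem_iInter, Set.forall_mem_range, SetLike.mem_coe] at hx
    have hxU : x ∈ U := (hx ⟨⊤, isOpen_univ⟩).1
    have hxW : f x - y ∈ W := hY.mem_of_forall_mem_sup hW fun O hO => (hx ⟨O, hO⟩).2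
    rw [← sub_sub_cancel (f x) y]
    exact sub_mem (Submodule.mem_sup_left (Submodule.mem_map_of_mem hxU))
      (Submodule.mem_sup_right hxW)
  · rintro _ ⟨O, rfl⟩
    exact isClosed_affineFiber hU hf hY y
      (hY.isClosed_of_isOpen _ (hY.isOpen_mono le_sup_right O.2))
  · intro 𝓣 h𝓣 hfin
    obtain ⟨T, hT, rfl⟩ : ∃ T : Set {O : Submodule ℂ Y // IsOpen (O : Set Y)}, T.Finite ∧
        (fun O : {O : Submodule ℂ Y // IsOpen (O : Set Y)} => affineFiber U f y (W ⊔ O.1)) '' T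
          = 𝓣 := by
      rw [← Set.image_univ] at h𝓣
      obtain ⟨T, -, hT, e⟩ := Set.exists_subset_image_finite_and.1 ⟨𝓣, h𝓣, hfin, rfl⟩
      exact ⟨T, hT, e.symm⟩
    have : Finite T := hT
    have hO : IsOpen ((⨅ O : T, O.1.1 : Submodule ℂ Y) : Set Y) := by
      rw [Submodule.coe_iInf]
      exact isOpen_iInter_of_finite fun O => O.1.2
    obtain ⟨z, hz, hzy⟩ := hy _ hO
    obtain ⟨_, ⟨x, hx, rfl⟩, w, hw, rfl⟩ := Submodule.mem_sup.1 hz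
    refine ⟨x, ?_⟩
    simp only [Set.mem_iInter, Set.forall_mem_image, SetLike.mem_coe]
    intro O hO
    refine ⟨hx, ?_⟩
    have e : f x - y = -w + (f x + w - y) := by abel
    rw [e]
    exact add_mem (Submodule.mem_sup_left (neg_mem hw))
      (Submodule.mem_sup_right ((Submodule.mem_iInf _).1 hzy ⟨O, hO⟩))

lemma isClosed_map (hV : IsLinearlyCompact V) (hY : IsHausdorffLinear Y) {f : V →ₗ[ℂ] Y}
    (hf : Continuous f) {U : Submodule ℂ V} (hU : IsClosed (U : Set V)) :
    IsClosed ((U.map f : Submodule ℂ Y) : Set Y) := by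
  have := hY.t2
  have h := hV.isClosed_map_sup hY hf hU (W := ⊥) isClosed_singleton
  rwa [sup_bot_eq] at h

/-- Linear compactness passes to continuous linear images. -/
lemma of_surjective (hV : IsLinearlyCompact V) (hY : IsHausdorffLinear Y) {f : V →ₗ[ℂ] Y}
    (hf : Continuous f) (hs : Function.Surjective f) : IsLinearlyCompact Y where
  t2 := hY.t2
  addGroup := hY.addGroup
  smul := hY.smul
  linear := hY.linear
  inter := by
    intro 𝓕 hcl hfip
    have key := hV.inter ((fun A => A.comap f.toAffineMap) '' 𝓕) ?_ ?_
    · obtain ⟨x, hx⟩ := key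
      refine ⟨f x, ?_⟩
      simp only [Set.mem_iInter, Set.forall_mem_image, SetLike.mem_coe] at hx ⊢
      exact fun A hA => hx hA
    · rintro _ ⟨A, hA, rfl⟩
      exact (hcl A hA).preimage hf
    · intro 𝓣 h𝓣 hfin
      obtain ⟨T, hT𝓕, hT, rfl⟩ := Set.exists_subset_image_finite_and.1 ⟨𝓣, h𝓣, hfin, rfl⟩
      obtain ⟨y, hy⟩ := hfip T hT𝓕 hT
      obtain ⟨x, rfl⟩ := hs y
      refine ⟨x, ?_⟩
      simp only [Set.mem_iInter, Set.forall_mem_image, SetLike.mem_coe] at hy ⊢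
      exact fun A hA => hy A hA

/-- The open mapping theorem for linearly compact spaces. -/
lemma isOpenMap_of_surjective (hV : IsLinearlyCompact V) (hfd : HasFiniteCodimBasis V)
    (hY : IsHausdorffLinear Y) {f : V →ₗ[ℂ] Y} (hf : Continuous f)
    (hs : Function.Surjective f) : IsOpenMap f := by
  have := hV.addGroup
  have := hY.addGroup
  refine (IsTopologicalAddGroup.isOpenMap_iff_nhds_zero (f := f.toAddMonoidHom)).2 ?_
  intro U hU
  obtain ⟨W, hW, hWU, hWfd⟩ := hfd _ hU
  have hcl := hV.isClosed_map hY hf (hV.isHausdorffLinear.isClosed_of_isOpen W hW)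
  have hfin : FiniteDimensional ℂ (Y ⧸ W.map f) :=
    Module.Finite.of_surjective (W.mapQ (W.map f) f (Submodule.le_comap_map f W)) fun y => by
      obtain ⟨y, rfl⟩ := Submodule.mkQ_surjective _ y
      obtain ⟨x, rfl⟩ := hs y
      exact ⟨W.mkQ x, rfl⟩
  refine Filter.mem_of_superset
    ((hY.isOpen_of_finiteDimensional_quotient hcl hfin).mem_nhds (zero_mem _)) ?_
  rintro _ ⟨x, hx, rfl⟩
  exact hWU hx

end IsLinearlyCompact

lemma IsHausdorffLinear.quotient (h : IsHausdorffLinear V) (W : Submodule ℂ V)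
    (hW : IsClosed (W : Set V)) : IsHausdorffLinear (V ⧸ W) := by
  have := h.addGroup
  have := h.smul
  refine ⟨inferInstance, inferInstance, ⟨fun c => ?_⟩, fun U hU => ?_⟩
  · rw [W.isOpenQuotientMap_mkQ.isQuotientMap.continuous_iff]
    exact W.isOpenQuotientMap_mkQ.continuous.comp (continuous_const_smul c)
  · obtain ⟨O, hO, hOU⟩ := h.linear (W.mkQ ⁻¹' U)
      (W.isOpenQuotientMap_mkQ.continuous.continuousAt.preimage_mem_nhds (by simpa using hU))
    exact ⟨O.map W.mkQ, W.isOpenMap_mkQ _ hO, Set.image_subset_iff.2 hOU⟩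

end LinearTopology

/-! ### Homomorphic images of linearly compact Lie superalgebras -/

section Transfer

variable {E : Type u} {L : Type v}
    [AddCommGroup E] [Module ℂ E] [SuperBracket E]
    [AddCommGroup L] [Module ℂ L] [SuperBracket L]

lemma map_parity_eq (hE : IsCompl (parity (V := E) 0) (parity 1))
    (hL : IsCompl (parity (V := L) 0) (parity 1)) (π : E →ₗ[ℂ] L)
    (hs : Function.Surjective π) (heven : ∀ (α : ZMod 2) (x : E), x ∈ parity α → π x ∈ parity α)
    (α : ZMod 2) : (parity (V := E) α).map π = parity α := by
  refine le_antisymm (Submodule.map_le_iff_le_comap.2 (heven α)) fun y hy => ?_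
  obtain ⟨x, rfl⟩ := hs y
  have hx : x ∈ parity (V := E) 0 ⊔ parity 1 := hE.sup_eq_top ▸ Submodule.mem_top
  obtain ⟨x0, h0, x1, h1, rfl⟩ := Submodule.mem_sup.1 hx
  have hd := Submodule.disjoint_def.1 hL.disjoint
  rw [map_add] at hy ⊢
  have p0 := heven 0 x0 h0
  have p1 := heven 1 x1 h1
  fin_cases α
  · have : π x1 = 0 := hd _ (by simpa using (parity (V := L) 0).sub_mem hy p0) p1
    rw [this, add_zero]
    exact ⟨x0, h0, rfl⟩
  · have : π x0 = 0 := hd _ p0 (by simpa using (parity (V := L) 1).sub_mem hy p1)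
    rw [this, zero_add]
    exact ⟨x1, h1, rfl⟩

lemma IsLinearlyCompactLieSuperalgebra.of_surjective [TopologicalSpace E] [TopologicalSpace L]
    (hE : IsLinearlyCompactLieSuperalgebra E)
    (hlin : IsHausdorffLinear L) (hL : IsCompl (parity (V := L) 0) (parity 1))
    (π : E →ₗ[ℂ] L) (hs : Function.Surjective π) (hc : Continuous π) (ho : IsOpenMap π)
    (heven : ∀ (α : ZMod 2) (x : E), x ∈ parity α → π x ∈ parity α)
    (hbr : ∀ x y : E, π (bracket x y) = bracket (π x) (π y)) :
    IsLinearlyCompactLieSuperalgebra L := by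
  have hp := map_parity_eq hE.lie.isCompl hL π hs heven
  refine ⟨⟨hL, ?_, ?_, ?_⟩, hE.linearlyCompact.of_surjective hlin hc hs, ?_, ?_⟩
  · intro α β x y hx hy
    rw [← hp] at hx hy
    obtain ⟨x, hx, rfl⟩ := hx
    obtain ⟨y, hy, rfl⟩ := hy
    rw [← hbr]
    exact heven _ _ (hE.lie.bracket_mem α β x y hx hy)
  · intro α β x y hx hy
    rw [← hp] at hx hy
    obtain ⟨x, hx, rfl⟩ := hx
    obtain ⟨y, hy, rfl⟩ := hy
    rw [← hbr, ← hbr, hE.lie.skew α β x y hx hy, map_neg, map_smul]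
  · intro α β x y z hx hy
    rw [← hp] at hx hy
    obtain ⟨x, hx, rfl⟩ := hx
    obtain ⟨y, hy, rfl⟩ := hy
    obtain ⟨z, rfl⟩ := hs z
    simp only [← hbr]
    rw [hE.lie.jacobi α β x y z hx hy, map_add, map_smul]
  · intro α
    rw [← hp]
    exact hE.linearlyCompact.isClosed_map hlin hc (hE.parity_closed α)
  · have hq : IsOpenQuotientMap π := ⟨hs, hc, ho⟩
    rw [← (hq.prodMap hq).continuous_comp_iff]
    have : (fun p : L × L => bracket p.1 p.2) ∘ Prod.map π π =
        fun p : E × E => π (bracket p.1 p.2) := by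
      funext p
      exact (hbr _ _).symm
    rw [this]
    exact hc.comp hE.continuous_bracket

end Transfer

/-! ### The Lie superalgebra `(Lie R)_-` -/

namespace LieConformalSuperalgebra

variable {R : Type u} [AddCommGroup R] [Module ℂ R] (L : LieConformalSuperalgebra R)

section GeneratingFunctions

open MvPolynomial

/-- The linear map on polynomials with prescribed values on monomials. -/
def onMonomials {σ : Type} {M : Type u} [AddCommGroup M] [Module ℂ M] (F : (σ →₀ ℕ) → M) :
    MvPolynomial σ ℂ →ₗ[ℂ] M :=
  (basisMonomials σ ℂ).constr ℂ F

lemma onMonomials_monomial {σ : Type} {M : Type u} [AddCommGroup M] [Module ℂ M]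
    (F : (σ →₀ ℕ) → M) (s : σ →₀ ℕ) : onMonomials F (monomial s 1) = F s := by
  have h := (basisMonomials σ ℂ).constr_basis ℂ F s
  rwa [coe_basisMonomials] at h

/-- The linear map `ℂ[x, y] → Lie R`, `x^j y^l ↦ (a_{(j)} b)_l`. -/
def phi (a b : R) : MvPolynomial (Fin 2) ℂ →ₗ[ℂ] L.LieAlg :=
  onMonomials fun s => L.mode (s 1 : ℕ) (L.lam a b (s 0))

/-- The linear map `ℂ[x, y, z] → Lie R`, `x^h y^i z^l ↦ ((a_{(h)} b)_{(i)} c)_l`. -/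
def psi (a b c : R) : MvPolynomial (Fin 3) ℂ →ₗ[ℂ] L.LieAlg :=
  onMonomials fun s => L.mode (s 2 : ℕ) (L.lam (L.lam a b (s 0)) c (s 1))

lemma phi_monomial (a b : R) (j l : ℕ) :
    L.phi a b (X 0 ^ j * X 1 ^ l) = L.mode l (L.lam a b j) := by
  rw [X_pow_eq_monomial, X_pow_eq_monomial, monomial_mul, one_mul, phi, onMonomials_monomial]
  simp

lemma psi_monomial (a b c : R) (h i l : ℕ) :
    L.psi a b c (X 0 ^ h * X 1 ^ i * X 2 ^ l) = L.mode l (L.lam (L.lam a b h) c i) := by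
  rw [X_pow_eq_monomial, X_pow_eq_monomial, X_pow_eq_monomial, monomial_mul, monomial_mul,
    one_mul, one_mul, psi, onMonomials_monomial]
  simp

lemma linearMap_ext_monomials {M : Type u} [AddCommGroup M] [Module ℂ M]
    {f g : MvPolynomial (Fin 2) ℂ →ₗ[ℂ] M}
    (h : ∀ j l : ℕ, f (X 0 ^ j * X 1 ^ l) = g (X 0 ^ j * X 1 ^ l)) : f = g := by
  refine (basisMonomials (Fin 2) ℂ).ext fun s => ?_
  have e : monomial s (1 : ℂ) = X 0 ^ s 0 * X 1 ^ s 1 := by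
    rw [monomial_eq, Finsupp.prod_fintype _ _ (by simp)]
    simp
  rw [coe_basisMonomials]
  change f (monomial s 1) = g (monomial s 1)
  rw [e, h]

lemma lieBracket_mode_nat (m n : ℕ) (a b : R) :
    L.lieBracket (L.mode m a) (L.mode n b) = ∑ j ∈ Finset.range (m + 1),
      (m.choose j : ℂ) • L.mode ((m - j + n : ℕ) : ℤ) (L.lam a b j) := by
  classical
  rw [lieBracket_mode, Finsupp.sum_of_support_subset (s := (L.lam a b).support ∪
    Finset.range (m + 1)) _ Finset.subset_union_left _ (by simp)]
  symm
  refine Finset.sum_subset_zero_on_sdiff Finset.subset_union_right ?_ ?_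
  · intro j hj
    have hj' : m < j := by simpa using (Finset.mem_sdiff.1 hj).2
    rw [Ring.choose_natCast, Nat.choose_eq_zero_of_lt hj']
    simp
  · intro j hj
    have hj' : j ≤ m := by simpa [Nat.lt_succ_iff] using hj
    rw [Ring.choose_natCast, show (m : ℤ) + n - j = ((m - j + n : ℕ) : ℤ) by omega]
    simp

/-- Generating function form of the bracket: `[a_m, b_n]` is the image of `(x + y)^m y^n`. -/
lemma lieBracket_mode_eq_phi (m n : ℕ) (a b : R) :
    L.lieBracket (L.mode m a) (L.mode n b) = L.phi a b ((X 0 + X 1) ^ m * X 1 ^ n) := by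
  rw [lieBracket_mode_nat, add_pow, Finset.sum_mul, map_sum]
  refine Finset.sum_congr rfl fun j _ => ?_
  rw [← phi_monomial, ← map_smul]
  congr 1
  rw [smul_eq_C_mul, pow_add, map_natCast]
  ring

/-- The inverse of the commutator formula. -/
lemma mode_lam_eq_sum (m n : ℕ) (a b : R) :
    L.mode n (L.lam a b m) = ∑ k ∈ Finset.range (m + 1), ((-1) ^ k * (m.choose k : ℂ)) •
      L.lieBracket (L.mode ((m - k : ℕ) : ℤ) a) (L.mode ((n + k : ℕ) : ℤ) b) := by
  simp only [lieBracket_mode_eq_phi, ← map_smul]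
  rw [← map_sum, ← phi_monomial]
  congr 1
  have h : (X 0 : MvPolynomial (Fin 2) ℂ) = -X 1 + (X 0 + X 1) := by ring
  conv_lhs => rw [h, add_pow, Finset.sum_mul]
  refine Finset.sum_congr rfl fun j _ => ?_
  rw [smul_eq_C_mul, pow_add, map_mul, map_natCast, map_pow, map_neg, map_one,
    neg_pow (X 1 : MvPolynomial (Fin 2) ℂ)]
  ring

/-- `(∂^i x / i!)_l = (-1)^i binom(l, i) x_{l-i}` -/
lemma mode_del_pow (i l : ℕ) (x : R) :
    ((i.factorial : ℂ)⁻¹) • L.mode l ((L.del ^ i) x) =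
      ((-1) ^ i * (l.choose i : ℂ)) • L.mode ((l - i : ℕ) : ℤ) x := by
  induction i generalizing l with
  | zero => simp
  | succ i ih =>
    rw [pow_succ', Module.End.mul_apply, mode_del]
    cases l with
    | zero => simp
    | succ l =>
      have e : ((l + 1 : ℕ) : ℤ) - 1 = (l : ℕ) := by push_cast; ring
      have h := ih l
      have hc : ((l + 1 : ℕ) : ℂ) * (l.choose i : ℂ) =
          ((l + 1).choose (i + 1) : ℂ) * ((i + 1 : ℕ) : ℂ) := by
        exact_mod_cast Nat.add_one_mul_choose_eq l i
      have hi : ((i + 1 : ℕ) : ℂ) ≠ 0 := Nat.cast_ne_zero.2 (Nat.succ_ne_zero i)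
      rw [e, Nat.add_sub_add_right, Nat.factorial_succ, Nat.cast_mul, mul_inv, smul_neg,
        smul_smul, mul_comm ((((i + 1 : ℕ) : ℂ))⁻¹), mul_assoc, mul_comm, mul_smul, h, smul_smul,
        ← neg_smul]
      congr 1
      have e2 : (((l + 1 : ℕ) : ℤ) : ℂ) = ((l + 1 : ℕ) : ℂ) := by push_cast; ring
      rw [e2]
      field_simp
      rw [pow_succ]
      linear_combination (-(-1 : ℂ) ^ i) * hc

lemma mode_lam_swap {α β : ZMod 2} {a b : R} (ha : a ∈ L.parity α) (hb : b ∈ L.parity β)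
    (j l : ℕ) : L.mode l (L.lam b a j) =
      -(superSign α β • L.phi a b ((-X 0) ^ j * (X 0 + X 1) ^ l)) := by
  obtain ⟨N, hN⟩ := exists_bound (L.lam a b)
  rw [L.skew α β a b ha hb, Finsupp.sum_of_support_subset (s := Finset.range (j + (l + 1 + N))) _
    (fun k hk => by
      rw [Finset.mem_range]
      by_contra h
      exact Finsupp.mem_support_iff.1 hk (hN k (by omega))) _ (by simp)]
  rw [map_neg, map_smul, map_sum, Finset.sum_range_add, Finset.sum_range_add]
  rw [Finset.sum_eq_zero (s := Finset.range j) (fun k hk => by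
    rw [if_neg (by simpa using hk), map_zero]), zero_add]
  have h1 : ∀ i, L.mode l (if j ≤ j + i then ((-1 : ℂ) ^ (j + i) / ((j + i - j).factorial : ℂ)) •
      (L.del ^ (j + i - j)) (L.lam a b (j + i)) else 0) =
      ((-1) ^ j * (l.choose i : ℂ)) • L.mode ((l - i : ℕ) : ℤ) (L.lam a b (j + i)) := by
    intro i
    rw [if_pos (Nat.le_add_right j i), Nat.add_sub_cancel_left, map_smul, div_eq_mul_inv,
      mul_smul, mode_del_pow, smul_smul, ← mul_assoc, pow_add, mul_assoc ((-1 : ℂ) ^ j), ← mul_pow]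
    simp
  simp only [h1]
  rw [Finset.sum_eq_zero (s := Finset.range N) (fun k hk => by
    rw [Nat.choose_eq_zero_of_lt (by omega)]; simp), add_zero]
  congr 2
  rw [add_pow, Finset.mul_sum, map_sum]
  refine Finset.sum_congr rfl fun i _ => ?_
  rw [← phi_monomial, ← map_smul]
  congr 1
  rw [smul_eq_C_mul, pow_add, map_mul, map_natCast, map_pow, map_neg, map_one,
    neg_pow (X 0 : MvPolynomial (Fin 2) ℂ)]
  ring

/-- Skew-symmetry in generating function form: exchanging `a` and `b` amounts to the substitution
`x ↦ -x`, `y ↦ x + y`. -/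
lemma phi_swap {α β : ZMod 2} {a b : R} (ha : a ∈ L.parity α) (hb : b ∈ L.parity β)
    (p : MvPolynomial (Fin 2) ℂ) : L.phi b a p =
      -(superSign α β • L.phi a b (aeval ![-X 0, X 0 + X 1] p)) := by
  have h : L.phi b a = -(superSign α β •
      (L.phi a b).comp (aeval (R := ℂ) ![-X 0, X 0 + X 1] :
        MvPolynomial (Fin 2) ℂ →ₐ[ℂ] MvPolynomial (Fin 2) ℂ).toLinearMap) := by
    refine linearMap_ext_monomials fun j l => ?_
    rw [phi_monomial, L.mode_lam_swap ha hb]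
    simp
  rw [h]
  rfl

lemma lieBracket_mode_skew {α β : ZMod 2} {a b : R} (ha : a ∈ L.parity α) (hb : b ∈ L.parity β)
    (m n : ℕ) : L.lieBracket (L.mode m a) (L.mode n b) =
      -(superSign α β • L.lieBracket (L.mode n b) (L.mode m a)) := by
  have hs : superSign β α = superSign α β := by rw [superSign, superSign, mul_comm]
  rw [lieBracket_mode_eq_phi, lieBracket_mode_eq_phi, L.phi_swap hb ha, hs]
  congr 3
  simp only [map_mul, map_pow, map_add, aeval_X]
  simp [mul_comm]

lemma phi_lam (a b c : R) (h : ℕ) (p : MvPolynomial (Fin 2) ℂ) :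
    L.phi (L.lam a b h) c p = L.psi a b c (X 0 ^ h * aeval ![X 1, X 2] p) := by
  have e : L.phi (L.lam a b h) c = (L.psi a b c).comp ((LinearMap.mulLeft ℂ (X 0 ^ h)).comp
      (aeval (R := ℂ) ![X 1, X 2] :
        MvPolynomial (Fin 2) ℂ →ₐ[ℂ] MvPolynomial (Fin 3) ℂ).toLinearMap) := by
    refine linearMap_ext_monomials fun j l => ?_
    rw [phi_monomial, ← psi_monomial]
    simp [mul_assoc]
  rw [e]
  rfl

/-- The Jacobi identity in generating function form: `(a_{(j)} (b_{(i)} c))_l` is the image of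
`(x + y)^j y^i z^l`, up to the term with `a` and `b` exchanged. -/
lemma mode_lam_lam {α β : ZMod 2} {a b : R} (ha : a ∈ L.parity α) (hb : b ∈ L.parity β) (c : R)
    (i j l : ℕ) : L.mode l (L.lam a (L.lam b c i) j) =
      L.psi a b c ((X 0 + X 1) ^ j * X 1 ^ i * X 2 ^ l) +
        superSign α β • L.mode l (L.lam b (L.lam a c j) i) := by
  rw [L.jacobi α β a b c ha hb, map_add, map_smul, map_sum, add_pow, Finset.sum_mul,
    Finset.sum_mul, map_sum]
  congr 1
  refine Finset.sum_congr rfl fun h hh => ?_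
  have hh' : h ≤ j := by simpa [Nat.lt_succ_iff] using hh
  rw [map_smul, ← psi_monomial, ← map_smul]
  congr 1
  rw [smul_eq_C_mul, show j + i - h = j - h + i by omega, pow_add, map_natCast]
  ring

/-- The iterated brackets are images of `(x + y + z)^m (y + z)^n z^p`. -/
lemma lieBracket_mode_jacobi {α β : ZMod 2} {a b : R} (ha : a ∈ L.parity α)
    (hb : b ∈ L.parity β) (c : R) (m n p : ℕ) :
    L.lieBracket (L.mode m a) (L.lieBracket (L.mode n b) (L.mode p c)) =
      L.lieBracket (L.lieBracket (L.mode m a) (L.mode n b)) (L.mode p c) +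
        superSign α β • L.lieBracket (L.mode n b) (L.lieBracket (L.mode m a) (L.mode p c)) := by
  have h1 : L.lieBracket (L.lieBracket (L.mode m a) (L.mode n b)) (L.mode p c) =
      L.psi a b c ((X 0 + X 1 + X 2) ^ m * (X 1 + X 2) ^ n * X 2 ^ p) := by
    rw [L.lieBracket_mode_nat m n, map_sum, LinearMap.sum_apply]
    simp only [map_smul, LinearMap.smul_apply, lieBracket_mode_eq_phi, phi_lam]
    rw [add_assoc (X 0), add_pow, Finset.sum_mul, Finset.sum_mul, map_sum]
    refine Finset.sum_congr rfl fun h hh => ?_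
    rw [← map_smul]
    congr 1
    simp only [map_mul, map_pow, map_add, aeval_X]
    rw [smul_eq_C_mul, pow_add, map_natCast]
    simp
    ring
  have h2 : ∀ (m n : ℕ) (a b : R),
      L.lieBracket (L.mode m a) (L.lieBracket (L.mode n b) (L.mode p c)) =
      ∑ i ∈ Finset.range (n + 1), ∑ j ∈ Finset.range (m + 1),
        ((n.choose i : ℂ) * (m.choose j : ℂ)) •
          L.mode ((m - j + (n - i + p) : ℕ) : ℤ) (L.lam a (L.lam b c i) j) := by
    intro m n a b
    rw [L.lieBracket_mode_nat n p, map_sum]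
    refine Finset.sum_congr rfl fun i _ => ?_
    rw [map_smul, L.lieBracket_mode_nat m, Finset.smul_sum]
    simp only [smul_smul]
  rw [h1, h2, h2]
  simp only [L.mode_lam_lam ha hb, smul_add, Finset.sum_add_distrib]
  congr 1
  · simp only [← map_smul]
    simp only [← map_sum]
    congr 1
    rw [add_pow _ (X 2) m, add_pow _ (X 2) n, Finset.sum_mul_sum, Finset.sum_mul,
      Finset.sum_comm]
    refine Finset.sum_congr rfl fun j _ => ?_
    rw [Finset.sum_mul]
    refine Finset.sum_congr rfl fun i _ => ?_
    rw [smul_eq_C_mul, map_mul, map_natCast, map_natCast, pow_add, pow_add]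
    ring
  · rw [Finset.sum_comm, Finset.smul_sum]
    refine Finset.sum_congr rfl fun j _ => ?_
    rw [Finset.smul_sum]
    refine Finset.sum_congr rfl fun i _ => ?_
    rw [smul_comm, mul_comm, show m - j + (n - i + p) = n - i + (m - j + p) by omega]

end GeneratingFunctions

/-! ### Functoriality of `Lie R` and the action of `(Lie R)_-` on `R` -/

/-- The endomorphism `a_n ↦ (φ a)_n` of `Lie R` induced by a `ℂ[∂]`-linear map `φ`. -/
def induced (φ : R →ₗ[ℂ] R) (hφ : ∀ a, φ (L.del a) = L.del (φ a)) : L.LieAlg →ₗ[ℂ] L.LieAlg :=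
  (LinearMap.range L.delTilde).mapQ (LinearMap.range L.delTilde) (Finsupp.mapRange.linearMap φ) (by
    rintro _ ⟨x, rfl⟩
    refine ⟨Finsupp.mapRange.linearMap φ x, ?_⟩
    induction x using Finsupp.induction_linear with
    | zero => simp
    | add x y hx hy => simp only [map_add, hx, hy]
    | single n a =>
      have h : ∀ (k : ℤ) (b : R), Finsupp.mapRange.linearMap φ (Finsupp.single k b) =
          Finsupp.single k (φ b) := fun k b => by simp
      rw [h, delTilde_single, delTilde_single, map_add, map_smul, h, h, hφ])

lemma induced_mode (φ : R →ₗ[ℂ] R) (hφ : ∀ a, φ (L.del a) = L.del (φ a)) (n : ℤ) (a : R) :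
    L.induced φ hφ (L.mode n a) = L.mode n (φ a) := by
  change (LinearMap.range L.delTilde).mkQ (Finsupp.mapRange.linearMap φ (Finsupp.single n a)) = _
  simp [mode]

lemma induced_mem (φ : R →ₗ[ℂ] R) (hφ : ∀ a, φ (L.del a) = L.del (φ a)) {x : L.LieAlg}
    (hx : x ∈ L.lieMinus) : L.induced φ hφ x ∈ L.lieMinus := by
  induction hx using Submodule.span_induction with
  | mem x h =>
    obtain ⟨a, n, rfl⟩ := h
    rw [induced_mode]
    exact L.mode_mem _ _
  | zero => simp
  | add x y _ _ hx hy => rw [map_add]; exact add_mem hx hy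
  | smul c x _ hx => rw [map_smul]; exact Submodule.smul_mem _ c hx

/-- The element `a_n` of `(Lie R)_-`. -/
def minusMode (n : ℕ) : R →ₗ[ℂ] L.lieMinus :=
  LinearMap.codRestrict _ (L.mode n) fun a => L.mode_mem a n

lemma coe_minusMode (n : ℕ) (a : R) : (L.minusMode n a : L.LieAlg) = L.mode n a := rfl

lemma minusMode_induction {P : L.lieMinus → Prop} (mode : ∀ n a, P (L.minusMode n a))
    (zero : P 0) (add : ∀ x y, P x → P y → P (x + y)) (smul : ∀ (c : ℂ) x, P x → P (c • x))
    (x : L.lieMinus) : P x := by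
  obtain ⟨x, hx⟩ := x
  induction hx using Submodule.span_induction with
  | mem x h =>
    obtain ⟨a, n, rfl⟩ := h
    exact mode n a
  | zero => exact zero
  | add x y hx hy h h' => exact add ⟨x, hx⟩ ⟨y, hy⟩ h h'
  | smul c x hx h => exact smul c ⟨x, hx⟩ h

/-- The endomorphism `a_n ↦ (φ a)_n` of `(Lie R)_-` induced by a `ℂ[∂]`-linear map `φ`. -/
def minusInduced (φ : R →ₗ[ℂ] R) (hφ : ∀ a, φ (L.del a) = L.del (φ a)) :
    L.lieMinus →ₗ[ℂ] L.lieMinus :=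
  (L.induced φ hφ).restrict fun _ hx => L.induced_mem φ hφ hx

lemma minusInduced_mode (φ : R →ₗ[ℂ] R) (hφ : ∀ a, φ (L.del a) = L.del (φ a)) (n : ℕ) (a : R) :
    L.minusInduced φ hφ (L.minusMode n a) = L.minusMode n (φ a) :=
  Subtype.ext (L.induced_mode φ hφ n a)

lemma minusMode_mem_parity {α : ZMod 2} {a : R} (ha : a ∈ L.parity α) (n : ℕ) :
    L.minusMode n a ∈ L.minusParity α := Submodule.subset_span ⟨a, ha, n, rfl⟩

lemma minusParity_induction {α : ZMod 2} {P : L.lieMinus → Prop}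
    (mode : ∀ n, ∀ a ∈ L.parity α, P (L.minusMode n a))
    (zero : P 0) (add : ∀ x y, P x → P y → P (x + y)) (smul : ∀ (c : ℂ) x, P x → P (c • x))
    {x : L.lieMinus} (hx : x ∈ L.minusParity α) : P x := by
  induction hx using Submodule.span_induction with
  | mem x h =>
    obtain ⟨a, ha, n, e⟩ := h
    exact (Subtype.ext e : x = L.minusMode n a) ▸ mode n a ha
  | zero => exact zero
  | add x y _ _ hx hy => exact add x y hx hy
  | smul c x _ hx => exact smul c x hx

lemma coe_minusBracket (x y : L.lieMinus) :
    (L.minusBracket x y : L.LieAlg) = L.lieBracket x y := rfl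

lemma minusBracket_mem_parity {α β : ZMod 2} {x y : L.lieMinus} (hx : x ∈ L.minusParity α)
    (hy : y ∈ L.minusParity β) : L.minusBracket x y ∈ L.minusParity (α + β) := by
  refine L.minusParity_induction (P := fun x => L.minusBracket x y ∈ L.minusParity (α + β))
    (fun m a ha => ?_) (by simp)
    (fun x x' h h' => by rw [map_add, LinearMap.add_apply]; exact add_mem h h')
    (fun c x h => by rw [map_smul, LinearMap.smul_apply]; exact Submodule.smul_mem _ c h) hx
  refine L.minusParity_induction
    (P := fun y => L.minusBracket (L.minusMode m a) y ∈ L.minusParity (α + β)) (fun n b hb => ?_) (by simp)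
    (fun x x' h h' => by rw [map_add]; exact add_mem h h')
    (fun c x h => by rw [map_smul]; exact Submodule.smul_mem _ c h) hy
  have e : L.minusBracket (L.minusMode m a) (L.minusMode n b) = ∑ j ∈ Finset.range (m + 1),
      (m.choose j : ℂ) • L.minusMode (m - j + n) (L.lam a b j) := by
    refine Subtype.ext ?_
    rw [coe_minusBracket, coe_minusMode, coe_minusMode, lieBracket_mode_nat]
    simp [coe_minusMode]
  rw [e]
  exact Submodule.sum_mem _ fun j _ => Submodule.smul_mem _ _
    (L.minusMode_mem_parity (L.lam_mem α β a b ha hb j) _)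

lemma minusBracket_skew {α β : ZMod 2} {x y : L.lieMinus} (hx : x ∈ L.minusParity α)
    (hy : y ∈ L.minusParity β) :
    L.minusBracket x y = -(superSign α β • L.minusBracket y x) := by
  refine L.minusParity_induction
    (P := fun x => L.minusBracket x y = -(superSign α β • L.minusBracket y x)) (fun m a ha => ?_) (by simp)
    (fun x x' h h' => by simp only [map_add, LinearMap.add_apply, h, h', smul_add, neg_add])
    (fun c x h => by simp only [map_smul, LinearMap.smul_apply, h, smul_neg]; rw [smul_comm]) hx
  refine L.minusParity_induction (P := fun y => L.minusBracket (L.minusMode m a) y =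
    -(superSign α β • L.minusBracket y (L.minusMode m a))) (fun n b hb => ?_) (by simp)
    (fun x x' h h' => by simp only [map_add, LinearMap.add_apply, h, h', smul_add, neg_add])
    (fun c x h => by simp only [map_smul, LinearMap.smul_apply, h, smul_neg]; rw [smul_comm]) hy
  exact Subtype.ext (L.lieBracket_mode_skew ha hb m n)

lemma minusBracket_jacobi {α β : ZMod 2} {x y : L.lieMinus} (hx : x ∈ L.minusParity α)
    (hy : y ∈ L.minusParity β) (z : L.lieMinus) :
    L.minusBracket x (L.minusBracket y z) = L.minusBracket (L.minusBracket x y) z +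
      superSign α β • L.minusBracket y (L.minusBracket x z) := by
  refine L.minusParity_induction (P := fun x => L.minusBracket x (L.minusBracket y z) =
    L.minusBracket (L.minusBracket x y) z + superSign α β • L.minusBracket y (L.minusBracket x z))
    (fun m a ha => ?_) (by simp)
    (fun x x' h h' => by simp only [map_add, LinearMap.add_apply, h, h', smul_add]; abel)
    (fun c x h => by
      simp only [map_smul, LinearMap.smul_apply, h, smul_add]; rw [smul_comm c (superSign α β)]) hx
  refine L.minusParity_induction
    (P := fun y => L.minusBracket (L.minusMode m a) (L.minusBracket y z) =
    L.minusBracket (L.minusBracket (L.minusMode m a) y) z +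
      superSign α β • L.minusBracket y (L.minusBracket (L.minusMode m a) z))
    (fun n b hb => ?_) (by simp)
    (fun x x' h h' => by simp only [map_add, LinearMap.add_apply, h, h', smul_add]; abel)
    (fun c x h => by
      simp only [map_smul, LinearMap.smul_apply, h, smul_add]; rw [smul_comm c (superSign α β)]) hy
  refine L.minusMode_induction
    (P := fun z => L.minusBracket (L.minusMode m a) (L.minusBracket (L.minusMode n b) z) =
    L.minusBracket (L.minusBracket (L.minusMode m a) (L.minusMode n b)) z +
      superSign α β • L.minusBracket (L.minusMode n b) (L.minusBracket (L.minusMode m a) z))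
    (fun p c => ?_) (by simp)
    (fun x x' h h' => by simp only [map_add, h, h', smul_add]; abel)
    (fun c x h => by
      simp only [map_smul, h, smul_add]; rw [smul_comm c (superSign α β)]) z
  exact Subtype.ext (L.lieBracket_mode_jacobi ha hb c m n p)

lemma del_lam (a b : R) (n : ℕ) :
    L.del (L.lam a b n) = L.lam (L.del a) b n + L.lam a (L.del b) n := by
  rw [lam_del_left, lam_del_right]
  abel

/-- The derivation `a_n ↦ (∂a)_n = -n a_{n-1}` of `(Lie R)_-`. -/
def minusDel : L.lieMinus →ₗ[ℂ] L.lieMinus := L.minusInduced L.del fun _ => rfl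

lemma minusDel_bracket (x y : L.lieMinus) : L.minusDel (L.minusBracket x y) =
    L.minusBracket (L.minusDel x) y + L.minusBracket x (L.minusDel y) := by
  refine L.minusMode_induction (P := fun x => L.minusDel (L.minusBracket x y) =
    L.minusBracket (L.minusDel x) y + L.minusBracket x (L.minusDel y)) (fun m a => ?_) (by simp)
    (fun x x' h h' => by simp only [map_add, LinearMap.add_apply, h, h']; abel)
    (fun c x h => by simp only [map_smul, LinearMap.smul_apply, h, smul_add]) x
  refine L.minusMode_induction (P := fun y => L.minusDel (L.minusBracket (L.minusMode m a) y) =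
    L.minusBracket (L.minusDel (L.minusMode m a)) y +
      L.minusBracket (L.minusMode m a) (L.minusDel y)) (fun n b => ?_) (by simp)
    (fun x x' h h' => by simp only [map_add, h, h']; abel)
    (fun c x h => by simp only [map_smul, h, smul_add]) y
  rw [minusDel, minusInduced_mode, minusInduced_mode]
  refine Subtype.ext ?_
  change L.induced L.del (fun _ => rfl) (L.lieBracket (L.mode m a) (L.mode n b)) =
    L.lieBracket (L.mode m (L.del a)) (L.mode n b) + L.lieBracket (L.mode m a) (L.mode n (L.del b))
  simp only [lieBracket_mode_nat, map_sum, map_smul, induced_mode, del_lam, map_add, smul_add,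
    Finset.sum_add_distrib]

/-- The action `a_n ↦ a_{(n)}` of `(Lie R)_-` on `R`. -/
def action : L.lieMinus →ₗ[ℂ] R →ₗ[ℂ] R :=
  ((LinearMap.range L.delTilde).liftQ
    (Finsupp.lsum ℂ fun n : ℤ => if 0 ≤ n then L.lam.compr₂ (Finsupp.lapply n.toNat) else 0) (by
      rintro _ ⟨x, rfl⟩
      rw [LinearMap.mem_ker]
      induction x using Finsupp.induction_linear with
      | zero => simp
      | add x y hx hy => rw [map_add, map_add, hx, hy, add_zero]
      | single n a =>
        refine LinearMap.ext fun b => ?_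
        rw [delTilde_single, map_add, map_smul, Finsupp.lsum_single, Finsupp.lsum_single]
        rcases lt_trichotomy n 0 with h | rfl | h
        · rw [if_neg (by omega), if_neg (by omega)]
          simp
        · have := L.lam_del_left a b 0
          simp at this
          simp [this]
        · obtain ⟨k, rfl⟩ : ∃ k : ℕ, n = k + 1 := ⟨(n - 1).toNat, by omega⟩
          rw [if_pos (by omega), if_pos (by omega)]
          have h1 : ((k : ℤ) + 1).toNat = k + 1 := by omega
          have h2 : ((k : ℤ) + 1 - 1).toNat = k := by omega
          simp [h1, lam_del_left])).comp L.lieMinus.subtype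

lemma action_mode (n : ℕ) (a b : R) : L.action (L.minusMode n a) b = L.lam a b n := by
  change Finsupp.lsum ℂ (fun n : ℤ => if 0 ≤ n then L.lam.compr₂ (Finsupp.lapply n.toNat) else 0)
    (Finsupp.single (n : ℤ) a) b = _
  rw [Finsupp.lsum_single, if_pos (Int.natCast_nonneg n)]
  rfl

lemma minusDel_pow_mode (k m : ℕ) (a : R) :
    (L.minusDel ^ k) (L.minusMode m a) = L.minusMode m ((L.del ^ k) a) := by
  induction k with
  | zero => rfl
  | succ k ih =>
    rw [pow_succ', Module.End.mul_apply, ih, minusDel, minusInduced_mode, pow_succ',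
      Module.End.mul_apply]

lemma inv_factorial_smul_minusDel_pow_mode (k m : ℕ) (a : R) :
    ((k.factorial : ℂ)⁻¹) • (L.minusDel ^ k) (L.minusMode m a) =
      ((-1) ^ k * (m.choose k : ℂ)) • L.minusMode (m - k) a := by
  rw [minusDel_pow_mode]
  exact Subtype.ext (L.mode_del_pow k m a)

lemma smul_map_minusDel_pow_mode {M : Type v} [AddCommGroup M] [Module ℂ M]
    (f : L.lieMinus →ₗ[ℂ] M) (k m : ℕ) (a : R) :
    ((k.factorial : ℂ)⁻¹) • f ((L.minusDel ^ k) (L.minusMode m a)) =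
      ((-1) ^ k * (m.choose k : ℂ)) • f (L.minusMode (m - k) a) := by
  rw [← map_smul, inv_factorial_smul_minusDel_pow_mode, map_smul]

/-- `(x · b)_n = ∑_k [∂^k x / k!, b_{n+k}]` for the action of `x ∈ (Lie R)_-` on `b ∈ R`. -/
lemma exists_mode_action_eq_sum (x : L.lieMinus) : ∃ K₀ : ℕ, ∀ K ≥ K₀, ∀ (b : R) (n : ℕ),
    L.minusMode n (L.action x b) = ∑ k ∈ Finset.range K, ((k.factorial : ℂ)⁻¹) •
      L.minusBracket ((L.minusDel ^ k) x) (L.minusMode (n + k) b) := by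
  induction x using L.minusMode_induction with
  | mode m a =>
    refine ⟨m + 1, fun K hK b n => ?_⟩
    obtain ⟨Q, rfl⟩ := Nat.exists_eq_add_of_le hK
    have h := fun k =>
      L.smul_map_minusDel_pow_mode (L.minusBracket.flip (L.minusMode (n + k) b)) k m a
    simp only [LinearMap.flip_apply] at h
    simp only [h]
    rw [Finset.sum_range_add, Finset.sum_eq_zero (s := Finset.range Q) (fun k hk => by
      rw [Nat.choose_eq_zero_of_lt (by omega)]; simp), add_zero, action_mode]
    refine Subtype.ext ?_
    rw [coe_minusMode, mode_lam_eq_sum]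
    simp [coe_minusBracket, coe_minusMode]
  | zero => exact ⟨0, by simp⟩
  | add x y hx hy =>
    obtain ⟨K, hK⟩ := hx
    obtain ⟨K', hK'⟩ := hy
    refine ⟨max K K', fun k hk b n => ?_⟩
    simp only [map_add, LinearMap.add_apply, hK k (by omega), hK' k (by omega), smul_add,
      Finset.sum_add_distrib]
  | smul c x hx =>
    obtain ⟨K, hK⟩ := hx
    refine ⟨K, fun k hk b n => ?_⟩
    simp only [map_smul, LinearMap.smul_apply, hK k hk, Finset.smul_sum]
    exact Finset.sum_congr rfl fun _ _ => smul_comm _ _ _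

/-- `[x, b_n] = ∑_k ((-∂)^k x / k! · b)_{n+k}` for `x ∈ (Lie R)_-` and `b ∈ R`. -/
lemma exists_bracket_mode_eq_sum (x : L.lieMinus) : ∃ K₀ : ℕ, ∀ K ≥ K₀, ∀ (b : R) (n : ℕ),
    L.minusBracket x (L.minusMode n b) = ∑ k ∈ Finset.range K, ((-1) ^ k * (k.factorial : ℂ)⁻¹) •
      L.minusMode (n + k) (L.action ((L.minusDel ^ k) x) b) := by
  induction x using L.minusMode_induction with
  | mode m a =>
    refine ⟨m + 1, fun K hK b n => ?_⟩
    obtain ⟨Q, rfl⟩ := Nat.exists_eq_add_of_le hK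
    have h := fun k =>
      L.smul_map_minusDel_pow_mode ((L.minusMode (n + k)).comp (L.action.flip b)) k m a
    simp only [LinearMap.comp_apply, LinearMap.flip_apply] at h
    simp only [mul_smul, h]
    rw [Finset.sum_range_add, Finset.sum_eq_zero (s := Finset.range Q) (fun k hk => by
      rw [Nat.choose_eq_zero_of_lt (by omega)]; simp), add_zero]
    refine Subtype.ext ?_
    rw [coe_minusBracket, coe_minusMode, coe_minusMode, lieBracket_mode_nat,
      ← Finset.sum_range_reflect]
    simp only [Submodule.coe_sum]
    refine Finset.sum_congr rfl fun k hk => ?_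
    have hk' : k ≤ m := by simpa [Nat.lt_succ_iff] using hk
    rw [action_mode, smul_smul, ← mul_pow]
    rw [show m + 1 - 1 - k = m - k by omega, Nat.choose_symm hk',
      show m - (m - k) + n = n + k by omega]
    simp [coe_minusMode]
  | zero => exact ⟨0, by simp⟩
  | add x y hx hy =>
    obtain ⟨K, hK⟩ := hx
    obtain ⟨K', hK'⟩ := hy
    refine ⟨max K K', fun k hk b n => ?_⟩
    simp only [map_add, LinearMap.add_apply, hK k (by omega), hK' k (by omega), smul_add,
      Finset.sum_add_distrib]
  | smul c x hx =>
    obtain ⟨K, hK⟩ := hx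
    refine ⟨K, fun k hk b n => ?_⟩
    simp only [map_smul, LinearMap.smul_apply, hK k hk, Finset.smul_sum]
    exact Finset.sum_congr rfl fun _ _ => smul_comm _ _ _

end LieConformalSuperalgebra

/-! ### The annihilation algebra as a linearly compact Lie superalgebra -/

namespace LieConformalSuperalgebra

variable {R : Type u} [AddCommGroup R] [Module ℂ R] {L : LieConformalSuperalgebra R}
  (S : L.FiniteGenerators)

namespace FiniteGenerators

lemma ext_proj {x y : S.Annihilation} (h : ∀ m, S.proj m x = S.proj m y) : x = y :=
  Subtype.ext (funext h)

lemma transition_proj {m n : ℕ} (h : m ≤ n) (x : S.Annihilation) :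
    S.transition h (S.proj n x) = S.proj m x := x.2 m n h

lemma toLevel_eq_zero {m : ℕ} {u : L.lieMinus} : S.toLevel m u = 0 ↔ u ∈ S.fil m :=
  Submodule.Quotient.mk_eq_zero _

lemma proj_completionMap (m : ℕ) (u : L.lieMinus) :
    S.proj m (S.completionMap u) = S.toLevel m u := rfl

lemma proj_bracket (m : ℕ) (x y : S.Annihilation) : S.proj m (bracket x y) =
    S.levelBracket m (S.proj (m + S.depth) x) (S.proj (m + S.depth) y) := rfl

/-- `u ∈ (Lie R)_-` represents `x ∈ 𝒜(R)` modulo the closure of `ℒ_N`. -/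
def Approx (N : ℕ) (x : S.Annihilation) (u : L.lieMinus) : Prop := S.proj N x = S.toLevel N u

variable {S}

lemma exists_approx (N : ℕ) (x : S.Annihilation) : ∃ u, S.Approx N x u := by
  obtain ⟨u, hu⟩ := S.toLevel_surjective N (S.proj N x)
  exact ⟨u, hu.symm⟩

lemma Approx.mono {M N : ℕ} (h : M ≤ N) {x : S.Annihilation} {u : L.lieMinus}
    (hx : S.Approx N x u) : S.Approx M x u := by
  rw [Approx, ← S.transition_proj h, hx, transition_toLevel]

lemma approx_completionMap (N : ℕ) (u : L.lieMinus) : S.Approx N (S.completionMap u) u := rfl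

lemma Approx.add {N : ℕ} {x y : S.Annihilation} {u v : L.lieMinus} (hx : S.Approx N x u)
    (hy : S.Approx N y v) : S.Approx N (x + y) (u + v) := by
  rw [Approx, map_add, map_add, hx, hy]

lemma Approx.smul {N : ℕ} (c : ℂ) {x : S.Annihilation} {u : L.lieMinus} (hx : S.Approx N x u) :
    S.Approx N (c • x) (c • u) := by
  rw [Approx, map_smul, map_smul, hx]

lemma Approx.neg {N : ℕ} {x : S.Annihilation} {u : L.lieMinus} (hx : S.Approx N x u) :
    S.Approx N (-x) (-u) := by
  rw [Approx, map_neg, map_neg, hx]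

lemma Approx.sum {N : ℕ} {ι : Type*} (s : Finset ι) {x : ι → S.Annihilation} {u : ι → L.lieMinus}
    (h : ∀ i ∈ s, S.Approx N (x i) (u i)) : S.Approx N (∑ i ∈ s, x i) (∑ i ∈ s, u i) := by
  rw [Approx, map_sum, map_sum]
  exact Finset.sum_congr rfl h

lemma Approx.bracket {N : ℕ} {x y : S.Annihilation} {u v : L.lieMinus}
    (hx : S.Approx (N + S.depth) x u) (hy : S.Approx (N + S.depth) y v) :
    S.Approx N (bracket x y) (L.minusBracket u v) := by
  rw [Approx, proj_bracket, hx, hy, levelBracket_toLevel]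

lemma ext_approx {x y : S.Annihilation} (h : ∀ N, ∃ u, S.Approx N x u ∧ S.Approx N y u) : x = y :=
  S.ext_proj fun N => by
    obtain ⟨u, hx, hy⟩ := h N
    rw [hx, hy]

lemma mem_parity_iff {α : ZMod 2} {x : S.Annihilation} :
    x ∈ SuperBracket.parity α ↔ ∀ N, ∃ u ∈ L.minusParity α, S.Approx N x u := by
  change x ∈ ⨅ m : ℕ, ((L.minusParity α).map (S.toLevel m)).comap (S.proj m) ↔ _
  simp only [Submodule.mem_iInf, Submodule.mem_comap, Submodule.mem_map]
  exact forall_congr' fun N => exists_congr fun u => and_congr_right fun _ => eq_comm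

variable (S)

/-! ### Topology -/

lemma isHausdorffLinear : IsHausdorffLinear S.Annihilation :=
  isHausdorffLinear_iInf S.proj
    (fun x hx => S.ext_proj fun m => by rw [hx m, map_zero]) rfl

lemma isLocallyConstant_proj (m : ℕ) : IsLocallyConstant (S.proj m) := fun s =>
  TopologicalSpace.le_def.1 (iInf_le _ m) _ ⟨s, trivial, rfl⟩

lemma isOpen_ker_proj (m : ℕ) : IsOpen (LinearMap.ker (S.proj m) : Set S.Annihilation) :=
  S.isLocallyConstant_proj m {0}

lemma exists_ker_proj_subset {U : Set S.Annihilation} (hU : U ∈ nhds 0) :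
    ∃ N, (LinearMap.ker (S.proj N) : Set S.Annihilation) ⊆ U := by
  obtain ⟨I, hI, hIU⟩ := exists_finite_forall_mem_of_iInf S.proj rfl hU
  obtain ⟨N, hN⟩ := hI.bddAbove
  refine ⟨N, fun x hx => hIU x fun i hi => ?_⟩
  rw [← S.transition_proj (hN hi), LinearMap.mem_ker.1 hx, map_zero]

lemma mem_of_isClosed {I : Submodule ℂ S.Annihilation} (hI : IsClosed (I : Set S.Annihilation))
    {x : S.Annihilation} (h : ∀ N, ∃ y ∈ I, S.proj N y = S.proj N x) : x ∈ I := by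
  rw [← SetLike.mem_coe, ← hI.closure_eq, S.isHausdorffLinear.mem_closure_iff]
  intro W hW
  obtain ⟨N, hN⟩ := S.exists_ker_proj_subset (hW.mem_nhds (zero_mem W))
  obtain ⟨y, hy, hyx⟩ := h N
  exact ⟨y, hy, hN (by simp [hyx])⟩

lemma continuous_of_proj {X : Type*} [TopologicalSpace X] {g : X → S.Annihilation}
    (h : ∀ m, IsLocallyConstant fun x => S.proj m (g x)) : Continuous g := by
  refine continuous_iInf_rng.2 fun m => ?_
  let _ : TopologicalSpace (S.Level m) := ⊥
  exact continuous_induced_rng.2 (h m).continuous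

lemma continuous_bracket :
    Continuous fun p : S.Annihilation × S.Annihilation => bracket p.1 p.2 :=
  S.continuous_of_proj fun m =>
    ((S.isLocallyConstant_proj _).comp_continuous continuous_fst).comp₂
      ((S.isLocallyConstant_proj _).comp_continuous continuous_snd)
      fun a b => S.levelBracket m a b

instance (m : ℕ) : FiniteDimensional ℂ (S.Level m) := by
  let X : Set (S.Level m) :=
    (fun p : R × ℕ => S.toLevel m (L.minusMode p.2 p.1)) '' (S.gens ×ˢ Finset.range m : Finset _)
  have hX : X.Finite := (Finset.finite_toSet _).image _
  refine Module.Finite.of_fg_top ⟨hX.toFinset, ?_⟩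
  rw [hX.coe_toFinset, eq_top_iff]
  rintro x -
  obtain ⟨⟨u, hu⟩, rfl⟩ := S.toLevel_surjective m x
  have h0 := S.lieMinus_le hu
  suffices h : ∃ hu : u ∈ L.lieMinus, S.toLevel m ⟨u, hu⟩ ∈ Submodule.span ℂ X from h.2
  clear hu
  induction h0 using Submodule.span_induction with
  | mem x h =>
    obtain ⟨a, ha, i, -, rfl⟩ := h
    refine ⟨L.mode_mem a i, ?_⟩
    by_cases hi : i < m
    · exact Submodule.subset_span ⟨(a, i), by simp [ha, hi], rfl⟩
    · have : S.toLevel m ⟨L.mode i a, L.mode_mem a i⟩ = 0 :=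
        S.toLevel_eq_zero.2 (Submodule.subset_span ⟨a, ha, i, not_lt.1 hi, rfl⟩)
      rw [this]
      exact zero_mem _
  | zero => exact ⟨zero_mem _, zero_mem _⟩
  | add x y _ _ hx hy =>
    obtain ⟨hx, hx'⟩ := hx
    obtain ⟨hy, hy'⟩ := hy
    exact ⟨add_mem hx hy, add_mem hx' hy'⟩
  | smul c x _ hx =>
    obtain ⟨hx, hx'⟩ := hx
    exact ⟨Submodule.smul_mem _ c hx, Submodule.smul_mem _ c hx'⟩

lemma hasFiniteCodimBasis : HasFiniteCodimBasis S.Annihilation := fun U hU => by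
  obtain ⟨N, hN⟩ := S.exists_ker_proj_subset hU
  exact ⟨_, S.isOpen_ker_proj N, hN,
    Module.Finite.equiv (S.proj N).quotKerEquivRange.symm⟩

/-- A sequence in `𝒜(R)` whose successive terms agree at the successive levels converges. -/
lemma exists_limit (b : ℕ → S.Annihilation) (hb : ∀ m, S.proj m (b (m + 1)) = S.proj m (b m)) :
    ∃ x : S.Annihilation, ∀ m, S.proj m x = S.proj m (b m) := by
  have h : ∀ m n, m ≤ n → S.proj m (b n) = S.proj m (b m) := by
    intro m n hmn
    induction n, hmn using Nat.le_induction with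
    | base => rfl
    | succ n hmn ih => rw [← ih, ← S.transition_proj hmn, hb n, S.transition_proj]
  refine ⟨⟨fun m => S.proj m (b m), fun m n hmn => ?_⟩, fun m => rfl⟩
  rw [S.transition_proj, h m n hmn]

/-- An inverse limit of a sequence of finite-dimensional discrete spaces is linearly compact: the
images of a directed family of affine subspaces stabilize at each level. -/
theorem isLinearlyCompact : IsLinearlyCompact S.Annihilation where
  t2 := S.isHausdorffLinear.t2
  addGroup := S.isHausdorffLinear.addGroup
  smul := S.isHausdorffLinear.smul
  linear := S.isHausdorffLinear.linear
  inter := by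
    intro 𝓕 hcl hfip
    let 𝓓 : Set (AffineSubspace ℂ S.Annihilation) := {B | ∃ 𝓣 ⊆ 𝓕, 𝓣.Finite ∧ B = sInf 𝓣}
    have hne : ∀ B ∈ 𝓓, (B : Set S.Annihilation).Nonempty := by
      rintro _ ⟨𝓣, h𝓣, hfin, rfl⟩
      rw [AffineSubspace.coe_sInf]
      exact hfip 𝓣 h𝓣 hfin
    have hinf : ∀ B ∈ 𝓓, ∀ B' ∈ 𝓓, B ⊓ B' ∈ 𝓓 := by
      rintro _ ⟨𝓣, h𝓣, hfin, rfl⟩ _ ⟨𝓣', h𝓣', hfin', rfl⟩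
      exact ⟨𝓣 ∪ 𝓣', Set.union_subset h𝓣 h𝓣', hfin.union hfin', sInf_union.symm⟩
    -- an intersection `B` whose direction has the smallest image at level `m`: further
    -- intersections do not change the image of `B` at this level
    have hmin : ∀ m, ∃ B ∈ 𝓓, ∀ B' ∈ 𝓓, ∀ b ∈ B, ∃ b' ∈ B ⊓ B', S.proj m b' = S.proj m b := by
      intro m
      obtain ⟨_, ⟨B, hB, rfl⟩, hlt⟩ := wellFounded_lt.has_min
        ((fun B : AffineSubspace ℂ S.Annihilation => B.direction.map (S.proj m)) '' 𝓓)
        ⟨_, ⊤, ⟨∅, Set.empty_subset _, Set.finite_empty, sInf_empty.symm⟩, rfl⟩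
      refine ⟨B, hB, fun B' hB' b hb => ?_⟩
      obtain ⟨c, hc⟩ := hne _ (hinf B hB B' hB')
      have hle : (B ⊓ B').direction ≤ B.direction := AffineSubspace.direction_le inf_le_left
      have heq : (B ⊓ B').direction.map (S.proj m) = B.direction.map (S.proj m) := by
        by_contra h
        exact hlt _ ⟨B ⊓ B', hinf B hB B' hB', rfl⟩
          (lt_of_le_of_ne (Submodule.map_mono hle) h)
      have hbc : S.proj m (b -ᵥ c) ∈ (B ⊓ B').direction.map (S.proj m) :=
        heq ▸ Submodule.mem_map_of_mem (AffineSubspace.vsub_mem_direction hb hc.1)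
      obtain ⟨v, hv, hvb⟩ := hbc
      refine ⟨v +ᵥ c, AffineSubspace.vadd_mem_of_mem_direction hv hc, ?_⟩
      rw [vadd_eq_add, map_add, hvb, vsub_eq_sub, map_sub, sub_add_cancel]
    choose B hB hBmin using hmin
    -- lift a point of `B 0` successively to the `B m`, so that its images at the levels converge
    have step : ∀ (m : ℕ) (b : B m), ∃ b' : B (m + 1), S.proj m b' = S.proj m b := by
      rintro m ⟨b, hb⟩
      obtain ⟨b', hb', e⟩ := hBmin m _ (hB (m + 1)) b hb
      exact ⟨⟨b', hb'.2⟩, e⟩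
    choose next hnext using step
    let seq : ∀ m, B m := fun m =>
      Nat.rec ⟨(hne _ (hB 0)).some, (hne _ (hB 0)).some_mem⟩ next m
    have hseq : ∀ m, S.proj m (seq (m + 1)).1 = S.proj m (seq m).1 := fun m => hnext m (seq m)
    obtain ⟨x, hx⟩ := S.exists_limit (fun m => (seq m).1) hseq
    refine ⟨x, Set.mem_iInter₂.2 fun A hA => ?_⟩
    have hA𝓓 : A ∈ 𝓓 := ⟨{A}, by simpa using hA, Set.finite_singleton A, sInf_singleton.symm⟩
    rw [← (hcl A hA).closure_eq, S.isHausdorffLinear.mem_closure_iff]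
    intro W hW
    obtain ⟨N, hN⟩ := S.exists_ker_proj_subset (hW.mem_nhds (zero_mem W))
    obtain ⟨a, ha, e⟩ := hBmin N A hA𝓓 _ (seq N).2
    exact ⟨a, ha.2, hN (by simp [hx, e])⟩

/-! ### Continuous extensions of endomorphisms -/

/-- The continuous extension to `𝒜(R)` of an endomorphism `f` of `(Lie R)_-` with
`f ℒ_{m+K} ⊆ ℒ_m` for all `m`. -/
def extend (f : L.lieMinus →ₗ[ℂ] L.lieMinus) (K : ℕ)
    (hf : ∀ m, S.fil (m + K) ≤ (S.fil m).comap f) : S.Annihilation →ₗ[ℂ] S.Annihilation :=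
  LinearMap.codRestrict S.annihilation
    (LinearMap.pi fun m => ((S.fil (m + K)).mapQ (S.fil m) f (hf m)).comp (S.proj (m + K)))
    fun x m n h => by
      obtain ⟨u, hu⟩ := exists_approx (n + K) x
      have hu' := hu.mono (Nat.add_le_add_right h K)
      change S.transition h ((S.fil (n + K)).mapQ (S.fil n) f (hf n) (S.proj (n + K) x)) =
        (S.fil (m + K)).mapQ (S.fil m) f (hf m) (S.proj (m + K) x)
      rw [hu, hu']
      rfl

variable {S}

lemma Approx.extend {f : L.lieMinus →ₗ[ℂ] L.lieMinus} {K : ℕ}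
    {hf : ∀ m, S.fil (m + K) ≤ (S.fil m).comap f} {N : ℕ} {x : S.Annihilation} {u : L.lieMinus}
    (hx : S.Approx (N + K) x u) : S.Approx N (S.extend f K hf x) (f u) := by
  change (S.fil (N + K)).mapQ (S.fil N) f (hf N) (S.proj (N + K) x) = _
  rw [hx]
  rfl

variable (S)

lemma continuous_extend (f : L.lieMinus →ₗ[ℂ] L.lieMinus) (K : ℕ)
    (hf : ∀ m, S.fil (m + K) ≤ (S.fil m).comap f) : Continuous (S.extend f K hf) :=
  S.continuous_of_proj fun m => (S.isLocallyConstant_proj (m + K)).comp _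

lemma exists_shift_minusInduced (φ : R →ₗ[ℂ] R) (hφ : ∀ a, φ (L.del a) = L.del (φ a)) :
    ∃ K, ∀ m, S.fil (m + K) ≤ (S.fil m).comap (L.minusInduced φ hφ) := by
  choose K hK using S.exists_shift
  refine ⟨S.gens.sup fun a => K (φ a), fun m => ?_⟩
  have h : S.filAux (m + S.gens.sup fun a => K (φ a)) ≤ (S.filAux m).comap (L.induced φ hφ) := by
    refine Submodule.span_le.2 ?_
    rintro _ ⟨a, ha, i, hi, rfl⟩
    have := Finset.le_sup (f := fun a => K (φ a)) ha
    rw [SetLike.mem_coe, Submodule.mem_comap, induced_mode]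
    exact hK _ _ _ (by omega)
  exact fun u hu => h hu

/-- An integer `K ≥ 0` such that `a_n ↦ (φ a)_n` maps `ℒ_{m+K}` to `ℒ_m` for all `m`. -/
def shift (φ : R →ₗ[ℂ] R) (hφ : ∀ a, φ (L.del a) = L.del (φ a)) : ℕ :=
  (S.exists_shift_minusInduced φ hφ).choose

/-- The continuous endomorphism `a_n ↦ (φ a)_n` of `𝒜(R)` for a `ℂ[∂]`-linear map `φ`. -/
def extendInduced (φ : R →ₗ[ℂ] R) (hφ : ∀ a, φ (L.del a) = L.del (φ a)) :
    S.Annihilation →ₗ[ℂ] S.Annihilation :=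
  S.extend (L.minusInduced φ hφ) (S.shift φ hφ) (S.exists_shift_minusInduced φ hφ).choose_spec

/-! ### The Lie superalgebra axioms -/

variable (L) in
/-- The projection of `R` onto its even part. -/
def evenProj : R →ₗ[ℂ] R := (L.parity 0).projection (L.parity 1) L.isCompl

lemma evenProj_of_even {a : R} (ha : a ∈ L.parity 0) : evenProj L a = a := by
  simpa [evenProj] using ha

lemma evenProj_of_odd {a : R} (ha : a ∈ L.parity 1) : evenProj L a = 0 := by
  simpa [evenProj] using ha

lemma exists_even_add_odd (a : R) : ∃ b ∈ L.parity 0, ∃ c ∈ L.parity 1, b + c = a :=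
  Submodule.mem_sup.1 (L.isCompl.sup_eq_top ▸ Submodule.mem_top)

lemma evenProj_del (a : R) : evenProj L (L.del a) = L.del (evenProj L a) := by
  obtain ⟨b, hb, c, hc, rfl⟩ := exists_even_add_odd (L := L) a
  simp only [map_add, evenProj_of_even hb, evenProj_of_odd hc,
    evenProj_of_even (L.del_mem 0 b hb), evenProj_of_odd (L.del_mem 1 c hc), map_zero]

variable (L) in
/-- The projection of `(Lie R)_-` onto its even part. -/
def minusEven : L.lieMinus →ₗ[ℂ] L.lieMinus := L.minusInduced (evenProj L) evenProj_del

lemma minusEven_of_even {u : L.lieMinus} (hu : u ∈ L.minusParity 0) : minusEven L u = u := by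
  refine L.minusParity_induction (P := fun u => minusEven L u = u) (fun n a ha => ?_) (map_zero _)
    (fun x y hx hy => by rw [map_add, hx, hy]) (fun c x hx => by rw [map_smul, hx]) hu
  rw [minusEven, minusInduced_mode, evenProj_of_even ha]

lemma minusEven_of_odd {u : L.lieMinus} (hu : u ∈ L.minusParity 1) : minusEven L u = 0 := by
  refine L.minusParity_induction (P := fun u => minusEven L u = 0) (fun n a ha => ?_) (map_zero _)
    (fun x y hx hy => by rw [map_add, hx, hy, add_zero])
    (fun c x hx => by rw [map_smul, hx, smul_zero]) hu
  rw [minusEven, minusInduced_mode, evenProj_of_odd ha, map_zero]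

lemma minusEven_mem (u : L.lieMinus) :
    minusEven L u ∈ L.minusParity 0 ∧ u - minusEven L u ∈ L.minusParity 1 := by
  induction u using L.minusMode_induction with
  | mode n a =>
    obtain ⟨b, hb, c, hc, rfl⟩ := exists_even_add_odd (L := L) a
    rw [minusEven, minusInduced_mode, map_add, evenProj_of_even hb, evenProj_of_odd hc, add_zero,
      map_add, add_sub_cancel_left]
    exact ⟨L.minusMode_mem_parity hb n, L.minusMode_mem_parity hc n⟩
  | zero => simp
  | add x y hx hy =>
    rw [map_add, add_sub_add_comm]
    exact ⟨add_mem hx.1 hy.1, add_mem hx.2 hy.2⟩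
  | smul c x hx =>
    rw [map_smul, ← smul_sub c x]
    exact ⟨Submodule.smul_mem _ c hx.1, Submodule.smul_mem _ c hx.2⟩

/-- The projection of `𝒜(R)` onto its even part. -/
def evenPart : S.Annihilation →ₗ[ℂ] S.Annihilation := S.extendInduced (evenProj L) evenProj_del

lemma continuous_evenPart : Continuous S.evenPart := S.continuous_extend _ _ _

variable {S}

lemma Approx.evenPart {N : ℕ} {x : S.Annihilation} {u : L.lieMinus}
    (hx : S.Approx (N + S.shift (evenProj L) evenProj_del) x u) :
    S.Approx N (S.evenPart x) (minusEven L u) := hx.extend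

lemma mem_parity_zero_iff {x : S.Annihilation} : x ∈ SuperBracket.parity 0 ↔ S.evenPart x = x := by
  refine ⟨fun h => ext_approx fun N => ?_, fun h => mem_parity_iff.2 fun N => ?_⟩
  · obtain ⟨u, hu, hx⟩ := mem_parity_iff.1 h (N + S.shift (evenProj L) evenProj_del)
    exact ⟨u, minusEven_of_even hu ▸ hx.evenPart, hx.mono (Nat.le_add_right _ _)⟩
  · obtain ⟨u, hx⟩ := exists_approx (N + S.shift (evenProj L) evenProj_del) x
    exact ⟨_, (minusEven_mem u).1, h ▸ hx.evenPart⟩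

lemma mem_parity_one_iff {x : S.Annihilation} : x ∈ SuperBracket.parity 1 ↔ S.evenPart x = 0 := by
  refine ⟨fun h => S.ext_proj fun N => ?_, fun h => mem_parity_iff.2 fun N => ?_⟩
  · obtain ⟨u, hu, hx⟩ := mem_parity_iff.1 h (N + S.shift (evenProj L) evenProj_del)
    have h1 := hx.evenPart
    rw [Approx, minusEven_of_odd hu, map_zero] at h1
    rw [h1, map_zero]
  · obtain ⟨u, hx⟩ := exists_approx (N + S.shift (evenProj L) evenProj_del) x
    refine ⟨_, (minusEven_mem u).2, ?_⟩
    have h1 := (hx.mono (Nat.le_add_right _ _)).add hx.evenPart.neg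
    rwa [h, neg_zero, add_zero, ← sub_eq_add_neg] at h1

lemma evenPart_mem (x : S.Annihilation) :
    S.evenPart x ∈ SuperBracket.parity (V := S.Annihilation) 0 :=
  mem_parity_iff.2 fun N => by
    obtain ⟨u, hx⟩ := exists_approx (N + S.shift (evenProj L) evenProj_del) x
    exact ⟨_, (minusEven_mem u).1, hx.evenPart⟩

lemma sub_evenPart_mem (x : S.Annihilation) :
    x - S.evenPart x ∈ SuperBracket.parity (V := S.Annihilation) 1 :=
  mem_parity_one_iff.2 (by rw [map_sub, mem_parity_zero_iff.1 (evenPart_mem x), sub_self])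

variable (S)

theorem isLieSuperalgebra : IsLieSuperalgebra S.Annihilation where
  isCompl := by
    refine IsCompl.of_eq (Submodule.eq_bot_iff _ |>.2 fun x hx => ?_) (eq_top_iff.2 fun x _ => ?_)
    · rw [← mem_parity_zero_iff.1 hx.1, mem_parity_one_iff.1 hx.2]
    · exact Submodule.mem_sup.2 ⟨_, evenPart_mem x, _, sub_evenPart_mem x, by abel⟩
  bracket_mem := fun α β x y hx hy => mem_parity_iff.2 fun N => by
    obtain ⟨u, hu, hxu⟩ := mem_parity_iff.1 hx (N + S.depth)
    obtain ⟨v, hv, hyv⟩ := mem_parity_iff.1 hy (N + S.depth)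
    exact ⟨_, L.minusBracket_mem_parity hu hv, hxu.bracket hyv⟩
  skew := fun α β x y hx hy => ext_approx fun N => by
    obtain ⟨u, hu, hxu⟩ := mem_parity_iff.1 hx (N + S.depth)
    obtain ⟨v, hv, hyv⟩ := mem_parity_iff.1 hy (N + S.depth)
    exact ⟨_, hxu.bracket hyv, L.minusBracket_skew hu hv ▸ ((hyv.bracket hxu).smul _).neg⟩
  jacobi := fun α β x y z hx hy => ext_approx fun N => by
    obtain ⟨u, hu, hxu⟩ := mem_parity_iff.1 hx (N + S.depth + S.depth)
    obtain ⟨v, hv, hyv⟩ := mem_parity_iff.1 hy (N + S.depth + S.depth)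
    obtain ⟨w, hzw⟩ := exists_approx (N + S.depth + S.depth) z
    have h : N + S.depth ≤ N + S.depth + S.depth := Nat.le_add_right _ _
    exact ⟨_, (hxu.mono h).bracket (hyv.bracket hzw), L.minusBracket_jacobi hu hv w ▸
      ((hxu.bracket hyv).bracket (hzw.mono h)).add
        (((hyv.mono h).bracket (hxu.bracket hzw)).smul _)⟩

theorem isLinearlyCompactLieSuperalgebra : IsLinearlyCompactLieSuperalgebra S.Annihilation where
  lie := S.isLieSuperalgebra
  linearlyCompact := S.isLinearlyCompact
  parity_closed := fun α => by
    have := S.isHausdorffLinear.t2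
    fin_cases α
    · convert isClosed_eq S.continuous_evenPart continuous_id using 1
      ext x
      exact mem_parity_zero_iff
    · convert isClosed_eq S.continuous_evenPart (continuous_const (y := 0)) using 1
      ext x
      exact mem_parity_one_iff
  continuous_bracket := S.continuous_bracket

/-! ### The derivation `∂` -/

/-- The continuous derivation `a_n ↦ (∂a)_n` of `𝒜(R)`. -/
def derivation : S.Annihilation →ₗ[ℂ] S.Annihilation := S.extendInduced L.del fun _ => rfl

lemma continuous_derivation : Continuous S.derivation := S.continuous_extend _ _ _

variable {S}

lemma Approx.derivation {N : ℕ} {x : S.Annihilation} {u : L.lieMinus}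
    (hx : S.Approx (N + S.shift L.del fun _ => rfl) x u) :
    S.Approx N (S.derivation x) (L.minusDel u) := hx.extend

lemma Approx.derivation_pow {N : ℕ} {x : S.Annihilation} {u : L.lieMinus} (k : ℕ)
    (hx : S.Approx (N + k * S.shift L.del fun _ => rfl) x u) :
    S.Approx N ((S.derivation ^ k) x) ((L.minusDel ^ k) u) := by
  induction k generalizing N with
  | zero => simpa using hx
  | succ k ih =>
    rw [pow_succ', pow_succ']
    refine Approx.derivation (ih ?_)
    convert hx using 1
    ring

variable (S)

lemma derivation_bracket (x y : S.Annihilation) : S.derivation (bracket x y) =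
    bracket (S.derivation x) y + bracket x (S.derivation y) := ext_approx fun N => by
  set s := S.shift L.del fun _ => rfl with hs
  obtain ⟨u, hu⟩ := exists_approx (N + S.depth + s) x
  obtain ⟨v, hv⟩ := exists_approx (N + S.depth + s) y
  have h : N + S.depth ≤ N + S.depth + s := Nat.le_add_right _ _
  have h' : N + s + S.depth ≤ N + S.depth + s := by omega
  exact ⟨_, Approx.derivation ((hu.mono h').bracket (hv.mono h')), L.minusDel_bracket u v ▸
    (hu.derivation.bracket (hv.mono h)).add ((hu.mono h).bracket hv.derivation)⟩

lemma minusDel_mem_parity {α : ZMod 2} {u : L.lieMinus} (hu : u ∈ L.minusParity α) :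
    L.minusDel u ∈ L.minusParity α := by
  refine L.minusParity_induction (P := fun u => L.minusDel u ∈ L.minusParity α)
    (fun n a ha => ?_) (by simp)
    (fun x y hx hy => by rw [map_add]; exact add_mem hx hy)
    (fun c x hx => by rw [map_smul]; exact Submodule.smul_mem _ c hx) hu
  rw [minusDel, minusInduced_mode]
  exact L.minusMode_mem_parity (L.del_mem α a ha) n

lemma derivation_mem_parity (α : ZMod 2) (x : S.Annihilation) (hx : x ∈ SuperBracket.parity α) :
    S.derivation x ∈ SuperBracket.parity α := mem_parity_iff.2 fun N => by
  obtain ⟨u, hu, hxu⟩ := mem_parity_iff.1 hx (N + S.shift L.del fun _ => rfl)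
  exact ⟨_, minusDel_mem_parity hu, hxu.derivation⟩

end FiniteGenerators
end LieConformalSuperalgebra

/-! ### Ideals of the annihilation algebra -/

/-- Left ideals that are graded are two-sided, by skew-symmetry. -/
lemma IsLieSuperalgebra.bracket_mem_of_left {V : Type u} [AddCommGroup V] [Module ℂ V]
    [SuperBracket V] (h : IsLieSuperalgebra V) {I : Submodule ℂ V}
    (hg : IsGradedSubspace parity I) (hI : ∀ x : V, ∀ y ∈ I, bracket x y ∈ I) {x : V} (hx : x ∈ I)
    (y : V) : bracket x y ∈ I := by
  have key : ∀ (α β : ZMod 2) (x y : V), x ∈ I → x ∈ parity α → y ∈ parity β → bracket x y ∈ I :=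
    fun α β x y hx hxα hyβ => by
      rw [h.skew α β x y hxα hyβ]
      exact neg_mem (I.smul_mem _ (hI y x hx))
  obtain ⟨x0, hx0, x1, hx1, rfl⟩ := Submodule.mem_sup.1 (hg hx)
  obtain ⟨y0, hy0, y1, hy1, rfl⟩ :=
    Submodule.mem_sup.1 (h.isCompl.sup_eq_top ▸ Submodule.mem_top : y ∈ _)
  simp only [map_add, LinearMap.add_apply]
  exact add_mem (add_mem (key 0 0 _ _ hx0.1 hx0.2 hy0) (key 1 0 _ _ hx1.1 hx1.2 hy0))
    (add_mem (key 0 1 _ _ hx0.1 hx0.2 hy1) (key 1 1 _ _ hx1.1 hx1.2 hy1))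

/-- Closed graded ideals of a topological Lie superalgebra. -/
structure IsClosedGradedIdeal {V : Type u} [AddCommGroup V] [Module ℂ V] [TopologicalSpace V]
    [SuperBracket V] (I : Submodule ℂ V) : Prop where
  graded : IsGradedSubspace parity I
  isClosed : IsClosed (I : Set V)
  bracket_mem : ∀ x : V, ∀ y ∈ I, bracket x y ∈ I

namespace LieConformalSuperalgebra

variable {R : Type u} [AddCommGroup R] [Module ℂ R] {L : LieConformalSuperalgebra R}

/-- A simple Lie conformal superalgebra is spanned by the products `a_{(n)} b`. -/
lemma IsSimple.span_lam_eq_top (hL : L.IsSimple) :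
    Submodule.span ℂ {x : R | ∃ (a b : R) (n : ℕ), x = L.lam a b n} = ⊤ := by
  refine (hL.ideal_trivial _ ⟨?_, ?_, ?_⟩).resolve_left fun h => ?_
  · refine Submodule.span_le.2 ?_
    rintro _ ⟨a, b, n, rfl⟩
    obtain ⟨a0, ha0, a1, ha1, rfl⟩ := FiniteGenerators.exists_even_add_odd (L := L) a
    obtain ⟨b0, hb0, b1, hb1, rfl⟩ := FiniteGenerators.exists_even_add_odd (L := L) b
    simp only [map_add, LinearMap.add_apply, Finsupp.add_apply]
    have h : ∀ a b, L.lam a b n ∈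
        Submodule.span ℂ {x : R | ∃ (a b : R) (n : ℕ), x = L.lam a b n} :=
      fun a b => Submodule.subset_span ⟨a, b, n, rfl⟩
    exact add_mem (add_mem (Submodule.mem_sup_left ⟨h _ _, L.lam_mem 0 0 _ _ ha0 hb0 n⟩)
      (Submodule.mem_sup_right ⟨h _ _, L.lam_mem 1 0 _ _ ha1 hb0 n⟩))
      (add_mem (Submodule.mem_sup_right ⟨h _ _, L.lam_mem 0 1 _ _ ha0 hb1 n⟩)
      (Submodule.mem_sup_left ⟨h _ _, L.lam_mem 1 1 _ _ ha1 hb1 n⟩))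
  · intro x hx
    induction hx using Submodule.span_induction with
    | mem x h =>
      obtain ⟨a, b, n, rfl⟩ := h
      rw [del_lam]
      exact add_mem (Submodule.subset_span ⟨_, _, n, rfl⟩) (Submodule.subset_span ⟨_, _, n, rfl⟩)
    | zero => simp
    | add x y _ _ hx hy => rw [map_add]; exact add_mem hx hy
    | smul c x _ hx => rw [map_smul]; exact Submodule.smul_mem _ c hx
  · exact fun a b _ n => Submodule.subset_span ⟨a, b, n, rfl⟩
  · obtain ⟨a, b, hab⟩ := hL.lam_ne_zero
    refine hab (Finsupp.ext fun n => ?_)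
    have : L.lam a b n ∈ (⊥ : Submodule ℂ R) := h ▸ Submodule.subset_span ⟨a, b, n, rfl⟩
    simpa using this

namespace FiniteGenerators

variable (S : L.FiniteGenerators)

lemma fil_eq_span (m : ℕ) : S.fil m =
    Submodule.span ℂ {x | ∃ a ∈ S.gens, ∃ i : ℕ, m ≤ i ∧ x = L.minusMode i a} := by
  have h : S.filAux m = (Submodule.span ℂ
      {x | ∃ a ∈ S.gens, ∃ i : ℕ, m ≤ i ∧ x = L.minusMode i a}).map L.lieMinus.subtype := by
    rw [Submodule.map_span, filAux]
    congr 1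
    ext x
    constructor
    · rintro ⟨a, ha, i, hi, rfl⟩
      exact ⟨L.minusMode i a, ⟨a, ha, i, hi, rfl⟩, rfl⟩
    · rintro ⟨_, ⟨a, ha, i, hi, rfl⟩, rfl⟩
      exact ⟨a, ha, i, hi, rfl⟩
  rw [fil, h, Submodule.comap_map_eq_of_injective L.lieMinus.injective_subtype]

lemma fil_zero : S.fil 0 = ⊤ := eq_top_iff.2 fun x _ => S.lieMinus_le x.2

lemma minusBracket_mem_fil {i j N : ℕ} (h : N + S.depth ≤ i + j) {x y : L.lieMinus}
    (hx : x ∈ S.fil i) (hy : y ∈ S.fil j) : L.minusBracket x y ∈ S.fil N :=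
  S.exists_lieBracket_mem.choose_spec i j N h x hx y hy

lemma exists_minusMode_mem (a : R) : ∃ K : ℕ, ∀ m n : ℕ, m + K ≤ n → L.minusMode n a ∈ S.fil m :=
  S.exists_shift a

variable {S}

lemma Approx.sub_mem {N : ℕ} {x : S.Annihilation} {u v : L.lieMinus} (hu : S.Approx N x u)
    (hv : S.Approx N x v) : u - v ∈ S.fil N := by
  rw [← toLevel_eq_zero, map_sub, ← hu, ← hv, sub_self]

variable (S)

/-! ### The action on `R` -/

/-- The action of `(Lie R)_-` on a vector of `R` is continuous. -/
lemma exists_action_eq_zero (b : R) : ∃ N, ∀ u ∈ S.fil N, L.action u b = 0 := by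
  choose B hB using fun a => exists_bound (L.lam a b)
  refine ⟨S.gens.sup B, fun u hu => ?_⟩
  rw [fil_eq_span] at hu
  induction hu using Submodule.span_induction with
  | mem x h =>
    obtain ⟨a, ha, i, hi, rfl⟩ := h
    rw [action_mode]
    exact hB a i ((Finset.le_sup ha).trans hi)
  | zero => simp
  | add x y _ _ hx hy => rw [map_add, LinearMap.add_apply, hx, hy, add_zero]
  | smul c x _ hx => rw [map_smul, LinearMap.smul_apply, hx, smul_zero]

/-- The vectors `u · b`, `u ∈ (Lie R)_-`, span a finite-dimensional space, so that the modes
`(u · b)_n` tend to `0` uniformly in `u`. -/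
lemma exists_minusMode_action_mem (b : R) : ∃ K : ℕ, ∀ (u : L.lieMinus) (m n : ℕ), m + K ≤ n →
    L.minusMode n (L.action u b) ∈ S.fil m := by
  obtain ⟨N, hN⟩ := S.exists_action_eq_zero b
  choose K hK using S.exists_minusMode_mem
  refine ⟨S.gens.sup fun a => (Finset.range N).sup fun j => K (L.lam a b j), fun u m n h => ?_⟩
  have hu : u ∈ S.fil 0 := S.fil_zero ▸ Submodule.mem_top
  rw [fil_eq_span] at hu
  induction hu using Submodule.span_induction with
  | mem x hx =>
    obtain ⟨a, ha, i, -, rfl⟩ := hx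
    by_cases hi : i < N
    · rw [action_mode]
      have h1 := Finset.le_sup (f := fun j => K (L.lam a b j)) (Finset.mem_range.2 hi)
      have h2 := Finset.le_sup
        (f := fun a => (Finset.range N).sup fun j => K (L.lam a b j)) ha
      have h3 := h1.trans h2
      exact hK _ _ _ (by omega)
    · have hm : L.minusMode i a ∈ S.fil N := by
        rw [fil_eq_span]
        exact Submodule.subset_span ⟨a, ha, i, not_lt.1 hi, rfl⟩
      rw [hN _ hm]
      simp
  | zero => simp
  | add x y _ _ hx hy => rw [map_add, LinearMap.add_apply, map_add]; exact add_mem hx hy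
  | smul c x _ hx =>
    rw [map_smul, LinearMap.smul_apply, map_smul]
    exact Submodule.smul_mem _ c hx

/-! ### Ideals of `𝒜(R)` and ideals of `R` -/

/-- The elements of `R` all of whose modes `a_n`, `n ≥ 0`, lie in a given subspace of `𝒜(R)`. -/
def coeffSubspace (I : Submodule ℂ S.Annihilation) : Submodule ℂ R :=
  ⨅ n : ℕ, I.comap (S.completionMap.comp (L.minusMode n))

variable {S}

lemma mem_coeffSubspace {I : Submodule ℂ S.Annihilation} {a : R} :
    a ∈ S.coeffSubspace I ↔ ∀ n, S.completionMap (L.minusMode n a) ∈ I := by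
  simp [coeffSubspace]

lemma completionMap_mem_parity {α : ZMod 2} {u : L.lieMinus} (hu : u ∈ L.minusParity α) :
    S.completionMap u ∈ SuperBracket.parity α :=
  mem_parity_iff.2 fun N => ⟨u, hu, approx_completionMap N u⟩

lemma isGradedSubspace_iff {I : Submodule ℂ S.Annihilation} :
    IsGradedSubspace SuperBracket.parity I ↔ ∀ x ∈ I, S.evenPart x ∈ I := by
  constructor
  · intro h x hx
    obtain ⟨x0, h0, x1, h1, rfl⟩ := Submodule.mem_sup.1 (h hx)
    rw [map_add, mem_parity_zero_iff.1 h0.2, mem_parity_one_iff.1 h1.2, add_zero]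
    exact h0.1
  · intro h x hx
    exact Submodule.mem_sup.2 ⟨_, ⟨h x hx, evenPart_mem x⟩, _,
      ⟨sub_mem hx (h x hx), sub_evenPart_mem x⟩, by abel⟩

/-- An ideal of `𝒜(R)` defines an ideal of `R`. -/
lemma isIdeal_coeffSubspace {I : Submodule ℂ S.Annihilation}
    (hg : IsGradedSubspace SuperBracket.parity I)
    (hI : ∀ x : S.Annihilation, ∀ y ∈ I, bracket x y ∈ I) : L.IsIdeal (S.coeffSubspace I) where
  graded := by
    intro a ha
    obtain ⟨b, hb, c, hc, rfl⟩ := exists_even_add_odd (L := L) a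
    rw [mem_coeffSubspace] at ha
    have hb' : b ∈ S.coeffSubspace I := mem_coeffSubspace.2 fun n => by
      have h := isGradedSubspace_iff.1 hg _ (ha n)
      rwa [map_add, map_add, map_add,
        mem_parity_zero_iff.1 (completionMap_mem_parity (L.minusMode_mem_parity hb n)),
        mem_parity_one_iff.1 (completionMap_mem_parity (L.minusMode_mem_parity hc n)),
        add_zero] at h
    have hc' : c ∈ S.coeffSubspace I := by
      have := sub_mem (mem_coeffSubspace.2 ha) hb'
      rwa [add_sub_cancel_left] at this
    exact Submodule.mem_sup.2 ⟨b, ⟨hb', hb⟩, c, ⟨hc', hc⟩, rfl⟩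
  del_mem := fun a ha => mem_coeffSubspace.2 fun n => by
    rw [mem_coeffSubspace] at ha
    have h : L.minusMode n (L.del a) = -((n : ℂ) • L.minusMode (n - 1) a) := Subtype.ext (by
      cases n with
      | zero => simp [coe_minusMode, mode_del]
      | succ n => simp [coe_minusMode, mode_del])
    rw [h, map_neg, map_smul]
    exact neg_mem (I.smul_mem _ (ha _))
  lam_mem := fun a b hb m => mem_coeffSubspace.2 fun n => by
    rw [mem_coeffSubspace] at hb
    have h : L.minusMode n (L.lam a b m) = ∑ k ∈ Finset.range (m + 1),
        ((-1) ^ k * (m.choose k : ℂ)) •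
          L.minusBracket (L.minusMode (m - k) a) (L.minusMode (n + k) b) := Subtype.ext (by
      rw [coe_minusMode, mode_lam_eq_sum]
      simp [coe_minusBracket, coe_minusMode])
    rw [h, map_sum]
    refine Submodule.sum_mem _ fun k _ => ?_
    rw [map_smul, ← bracket_completionMap]
    exact I.smul_mem _ (hI _ _ (hb _))

lemma eq_top_of_coeffSubspace_eq_top {I : Submodule ℂ S.Annihilation}
    (hI : IsClosed (I : Set S.Annihilation)) (h : S.coeffSubspace I = ⊤) : I = ⊤ := by
  have h1 : ∀ u, S.completionMap u ∈ I := L.minusMode_induction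
    (fun n a => mem_coeffSubspace.1 (h ▸ Submodule.mem_top : a ∈ S.coeffSubspace I) n)
    (by simp) (fun x y hx hy => by rw [map_add]; exact add_mem hx hy)
    (fun c x hx => by rw [map_smul]; exact I.smul_mem c hx)
  refine eq_top_iff.2 fun x _ => S.mem_of_isClosed hI fun N => ?_
  obtain ⟨u, hu⟩ := exists_approx N x
  exact ⟨_, h1 u, hu.symm⟩

/-- If `I` is a closed `∂`-invariant ideal of `𝒜(R)` and `x ∈ I`, then `x · b` has all its modes
in `I`, by the formula `(x · b)_n = ∑_k [∂^k x / k!, b_{n+k}]`. -/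
lemma action_mem_coeffSubspace {I : Submodule ℂ S.Annihilation}
    (hcl : IsClosed (I : Set S.Annihilation))
    (hI : ∀ y ∈ I, ∀ x : S.Annihilation, bracket y x ∈ I) (hT : ∀ x ∈ I, S.derivation x ∈ I)
    {b : R} {M : ℕ} (hM : ∀ u ∈ S.fil M, L.action u b = 0) {x : S.Annihilation} (hx : x ∈ I)
    {u : L.lieMinus} (hu : S.Approx M x u) : L.action u b ∈ S.coeffSubspace I := by
  have hTk : ∀ k, (S.derivation ^ k) x ∈ I := fun k => by
    induction k with
    | zero => exact hx
    | succ k ih => rw [pow_succ', Module.End.mul_apply]; exact hT _ ih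
  refine mem_coeffSubspace.2 fun n => S.mem_of_isClosed hcl fun N => ?_
  obtain ⟨K, hK⟩ := S.exists_minusMode_mem b
  -- the terms of index `≥ K₁` vanish modulo `ℒ_N`
  obtain ⟨K₁, hK₁⟩ : ∃ K₁, K₁ = N + S.depth + K := ⟨_, rfl⟩
  obtain ⟨v, hv⟩ := exists_approx (M + (N + S.depth + K₁ * S.shift L.del fun _ => rfl)) x
  have huv : L.action u b = L.action v b := by
    rw [← sub_eq_zero, ← LinearMap.sub_apply, ← map_sub]
    exact hM _ (hu.sub_mem (hv.mono (Nat.le_add_right _ _)))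
  obtain ⟨K₀, hK₀⟩ := L.exists_mode_action_eq_sum v
  refine ⟨∑ k ∈ Finset.range K₁, ((k.factorial : ℂ)⁻¹) •
    bracket ((S.derivation ^ k) x) (S.completionMap (L.minusMode (n + k) b)),
    Submodule.sum_mem _ fun k _ => I.smul_mem _ (hI _ (hTk k) _), ?_⟩
  have happ : S.Approx N (∑ k ∈ Finset.range K₁, ((k.factorial : ℂ)⁻¹) •
      bracket ((S.derivation ^ k) x) (S.completionMap (L.minusMode (n + k) b)))
      (∑ k ∈ Finset.range K₁, ((k.factorial : ℂ)⁻¹) •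
        L.minusBracket ((L.minusDel ^ k) v) (L.minusMode (n + k) b)) := by
    refine Approx.sum _ fun k hk => Approx.smul _ (Approx.bracket ?_ (approx_completionMap _ _))
    refine Approx.derivation_pow k (hv.mono ?_)
    have := Nat.mul_le_mul_right (S.shift L.del fun _ => rfl) (Finset.mem_range.1 hk).le
    omega
  rw [happ, huv, hK₀ (K₁ + K₀) (Nat.le_add_left _ _), Finset.sum_range_add, proj_completionMap,
    map_add, left_eq_add, toLevel_eq_zero]
  refine Submodule.sum_mem _ fun k _ => Submodule.smul_mem _ _ (S.minusBracket_mem_right _ _ _ ?_)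
  exact hK _ _ (by omega)

/-- If `x` and all its derivatives act trivially on `b`, then `x` commutes with all `b_n`, by the
formula `[x, b_n] = ∑_k ((-∂)^k x / k! · b)_{n+k}`. -/
lemma bracket_minusMode_eq_zero {b : R} {M : ℕ} {x : S.Annihilation}
    (h : ∀ k u, S.Approx M ((S.derivation ^ k) x) u → L.action u b = 0) (n : ℕ) :
    bracket x (S.completionMap (L.minusMode n b)) = 0 := by
  refine S.ext_proj fun N => ?_
  obtain ⟨K, hK⟩ := S.exists_minusMode_action_mem b
  -- the terms of index `≥ N + K` vanish modulo `ℒ_N`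
  obtain ⟨u, hu⟩ := exists_approx (M + (N + S.depth + (N + K) * S.shift L.del fun _ => rfl)) x
  have happ : S.Approx N (bracket x (S.completionMap (L.minusMode n b))) _ :=
    Approx.bracket (hu.mono (by omega)) (approx_completionMap _ _)
  obtain ⟨K₀, hK₀⟩ := L.exists_bracket_mode_eq_sum u
  rw [happ, map_zero, toLevel_eq_zero, hK₀ (N + K + K₀) (Nat.le_add_left _ _), Finset.sum_range_add]
  refine add_mem (Submodule.sum_mem _ fun k hk => ?_)
    (Submodule.sum_mem _ fun k _ => Submodule.smul_mem _ _ (hK _ _ _ (by omega)))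
  have := Nat.mul_le_mul_right (S.shift L.del fun _ => rfl) (Finset.mem_range.1 hk).le
  rw [h k _ (Approx.derivation_pow k (hu.mono (by omega)))]
  simp

/-- The `∂`-invariant closed ideals of `𝒜(R)` are central or everything: they come from ideals of
the simple conformal superalgebra `R`. -/
theorem central_of_invariant (hL : L.IsSimple) {I : Submodule ℂ S.Annihilation}
    (hI : IsClosedGradedIdeal I) (hT : ∀ x ∈ I, S.derivation x ∈ I)
    (hne : I ≠ ⊤) : ∀ x ∈ I, ∀ y : S.Annihilation, bracket x y = 0 := by
  obtain ⟨hg, hcl, hI⟩ := hI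
  have hbot : S.coeffSubspace I = ⊥ :=
    (hL.ideal_trivial _ (isIdeal_coeffSubspace hg hI)).resolve_right
      fun h => hne (eq_top_of_coeffSubspace_eq_top hcl h)
  have hright : ∀ y ∈ I, ∀ x : S.Annihilation, bracket y x ∈ I := fun y hy x =>
    S.isLieSuperalgebra.bracket_mem_of_left hg hI hy x
  intro x hx y
  have hTk : ∀ k, (S.derivation ^ k) x ∈ I := fun k => by
    induction k with
    | zero => exact hx
    | succ k ih => rw [pow_succ', Module.End.mul_apply]; exact hT _ ih
  have h1 : ∀ v, bracket x (S.completionMap v) = 0 := L.minusMode_induction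
    (fun n b => by
      obtain ⟨M, hM⟩ := S.exists_action_eq_zero b
      refine bracket_minusMode_eq_zero (M := M) (fun k u hu => ?_) n
      have := action_mem_coeffSubspace hcl hright hT hM (hTk k) hu
      rwa [hbot, Submodule.mem_bot] at this)
    (by simp) (fun u v hu hv => by rw [map_add, map_add, hu, hv, add_zero])
    (fun c u hu => by rw [map_smul, map_smul, hu, smul_zero])
  refine S.ext_proj fun N => ?_
  obtain ⟨v, hv⟩ := exists_approx (N + S.depth) y
  rw [proj_bracket, hv, ← proj_completionMap, ← proj_bracket, h1]

/-! ### Perfectness and maximal ideals -/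

/-- Each `a_i` is a sum of commutators `[e, y]` with `e` in a finite set independent of `i`, and
with `y` tending to `0` as `i` grows. -/
lemma exists_minusMode_mem_span (S : L.FiniteGenerators) (hL : L.IsSimple) (a : R) :
    ∃ (E : Finset L.lieMinus) (c : ℕ), ∀ i, L.minusMode i a ∈
      Submodule.span ℂ {x | ∃ e ∈ E, ∃ y ∈ S.fil (i - c), x = L.minusBracket e y} := by
  classical
  have hmono : ∀ {E E' : Finset L.lieMinus} {c c' i : ℕ}, E ⊆ E' → c ≤ c' →
      Submodule.span ℂ {x | ∃ e ∈ E, ∃ y ∈ S.fil (i - c), x = L.minusBracket e y} ≤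
      Submodule.span ℂ {x | ∃ e ∈ E', ∃ y ∈ S.fil (i - c'), x = L.minusBracket e y} :=
    fun hE hc => Submodule.span_mono fun x ⟨e, he, y, hy, h⟩ =>
      ⟨e, hE he, y, S.fil_anti (by omega) hy, h⟩
  have ha : a ∈ (⊤ : Submodule ℂ R) := trivial
  rw [← hL.span_lam_eq_top] at ha
  induction ha using Submodule.span_induction with
  | mem x h =>
    obtain ⟨a, b, m, rfl⟩ := h
    obtain ⟨K, hK⟩ := S.exists_minusMode_mem b
    refine ⟨(Finset.range (m + 1)).image fun k => L.minusMode k a, K, fun n => ?_⟩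
    have h : L.minusMode n (L.lam a b m) = ∑ k ∈ Finset.range (m + 1),
        ((-1) ^ k * (m.choose k : ℂ)) •
          L.minusBracket (L.minusMode (m - k) a) (L.minusMode (n + k) b) := Subtype.ext (by
      rw [coe_minusMode, mode_lam_eq_sum]
      simp [coe_minusBracket, coe_minusMode])
    rw [h]
    refine Submodule.sum_mem _ fun k _ => Submodule.smul_mem _ _ (Submodule.subset_span
      ⟨_, Finset.mem_image_of_mem _ (Finset.mem_range.2 (by omega)), _, ?_, rfl⟩)
    by_cases hnK : K ≤ n
    · exact hK _ _ (by omega)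
    · rw [Nat.sub_eq_zero_of_le (by omega), fil_zero]
      trivial
  | zero => exact ⟨∅, 0, fun i => by simp⟩
  | add x y _ _ hx hy =>
    obtain ⟨E, c, h⟩ := hx
    obtain ⟨E', c', h'⟩ := hy
    refine ⟨E ∪ E', max c c', fun i => ?_⟩
    rw [map_add]
    exact add_mem (hmono Finset.subset_union_left (le_max_left _ _) (h i))
      (hmono Finset.subset_union_right (le_max_right _ _) (h' i))
  | smul r x _ hx =>
    obtain ⟨E, c, h⟩ := hx
    refine ⟨E, c, fun i => ?_⟩
    rw [map_smul]
    exact Submodule.smul_mem _ r (h i)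

lemma exists_forall_gens_mem_span (S : L.FiniteGenerators) (hL : L.IsSimple) :
    ∃ (E : Finset L.lieMinus) (c : ℕ), ∀ a ∈ S.gens, ∀ i, L.minusMode i a ∈
      Submodule.span ℂ {x | ∃ e ∈ E, ∃ y ∈ S.fil (i - c), x = L.minusBracket e y} := by
  classical
  choose E c h using S.exists_minusMode_mem_span hL
  refine ⟨S.gens.biUnion E, S.gens.sup c, fun a ha i => Submodule.span_mono ?_ (h a i)⟩
  rintro x ⟨e, he, y, hy, hx⟩
  have := Finset.le_sup (f := c) ha
  exact ⟨e, Finset.mem_biUnion.2 ⟨a, ha, he⟩, y, S.fil_anti (by omega) hy, hx⟩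

variable (S)

/-- `𝒜(R)` is the sum of the closed subspaces `[e, 𝒜(R)]` for `e` in a finite set. -/
theorem span_bracket_eq_top (hL : L.IsSimple) :
    Submodule.span ℂ {z : S.Annihilation | ∃ x y : S.Annihilation, z = bracket x y} = ⊤ := by
  classical
  obtain ⟨E, c, h⟩ := S.exists_forall_gens_mem_span hL
  let P : Finset L.lieMinus → Submodule ℂ S.Annihilation := fun E =>
    ⨆ e ∈ E, LinearMap.range (bracket (S.completionMap e))
  have hcl : ∀ E, IsClosed (P E : Set S.Annihilation) := fun E => by
    induction E using Finset.induction_on with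
    | empty =>
      have := S.isHausdorffLinear.t2
      simp only [P, Finset.notMem_empty, iSup_false, iSup_bot]
      exact isClosed_singleton
    | insert e E _ ih =>
      simp only [P, Finset.iSup_insert]
      rw [LinearMap.range_eq_map]
      exact S.isLinearlyCompact.isClosed_map_sup S.isHausdorffLinear
        (S.continuous_bracket.comp (by fun_prop : Continuous fun y => (S.completionMap e, y)))
        isClosed_univ ih
  have htop : P E = ⊤ := by
    refine eq_top_iff.2 fun x _ => S.mem_of_isClosed (hcl E) fun N => ?_
    obtain ⟨u, hu⟩ := exists_approx N x
    refine ⟨S.completionMap u, ?_, hu.symm⟩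
    have hu0 : u ∈ S.fil 0 := S.fil_zero ▸ Submodule.mem_top
    rw [fil_eq_span] at hu0
    suffices hle : Submodule.span ℂ {x | ∃ a ∈ S.gens, ∃ i : ℕ, 0 ≤ i ∧ x = L.minusMode i a} ≤
      (P E).comap S.completionMap from hle hu0
    refine Submodule.span_le.2 ?_
    rintro _ ⟨a, ha, i, -, rfl⟩
    refine (Submodule.span_le.2 ?_ : Submodule.span ℂ _ ≤ (P E).comap S.completionMap) (h a ha i)
    rintro _ ⟨e, he, y, -, rfl⟩
    rw [SetLike.mem_coe, Submodule.mem_comap, ← bracket_completionMap]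
    exact Submodule.mem_iSup_of_mem e (Submodule.mem_iSup_of_mem he ⟨_, rfl⟩)
  refine eq_top_iff.2 (htop ▸ iSup₂_le fun e _ => ?_)
  rintro _ ⟨y, rfl⟩
  exact Submodule.subset_span ⟨_, y, rfl⟩

/-- A closed ideal containing good approximations of the elements `e` of a certain finite set is
everything, because `𝒜(R)` remains the sum of the `[e', 𝒜(R)]` for `e'` close to `e`. -/
lemma exists_eq_top_of_approx (hL : L.IsSimple) : ∃ (E : Finset L.lieMinus) (m : ℕ),
    ∀ I : Submodule ℂ S.Annihilation, IsClosed (I : Set S.Annihilation) →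
      (∀ y ∈ I, ∀ x : S.Annihilation, bracket y x ∈ I) →
      (∀ e ∈ E, ∃ x ∈ I, S.Approx m x e) → I = ⊤ := by
  obtain ⟨E, c, h⟩ := S.exists_forall_gens_mem_span hL
  refine ⟨E, c + S.depth + 1, fun I hcl hI hE => ?_⟩
  -- modulo `ℒ_{n+1}`, the commutators `[e, y]` with `y ∈ ℒ_{n-c}`, whose span contains
  -- `ℒ_n`, agree with the elements `[x, y]` of `I`, because `x - e ∈ ℒ_{c+d+1}` for the depth `d`
  have hstep : ∀ n, S.fil n ≤ (I.map (S.proj (n + 1))).comap (S.toLevel (n + 1)) := by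
    intro n
    rw [fil_eq_span]
    refine Submodule.span_le.2 ?_
    rintro _ ⟨a, ha, i, hi, rfl⟩
    refine (Submodule.span_le.2 ?_ : Submodule.span ℂ _ ≤
      (I.map (S.proj (n + 1))).comap (S.toLevel (n + 1))) (h a ha i)
    rintro _ ⟨e, he, y, hy, rfl⟩
    obtain ⟨x, hx, hxe⟩ := hE e he
    obtain ⟨w, hw⟩ := exists_approx (n + 1 + S.depth + (c + S.depth + 1)) x
    refine ⟨bracket x (S.completionMap y), hI x hx _, ?_⟩
    have h1 : S.Approx (n + 1) (bracket x (S.completionMap y)) (L.minusBracket w y) :=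
      Approx.bracket (hw.mono (by omega)) (approx_completionMap _ _)
    rw [h1, ← sub_eq_zero, ← map_sub, ← LinearMap.sub_apply, ← map_sub L.minusBracket,
      toLevel_eq_zero]
    exact S.minusBracket_mem_fil (by omega) ((hw.mono (by omega)).sub_mem hxe) hy
  have hall : ∀ n (x : S.Annihilation), ∃ z ∈ I, S.proj n z = S.proj n x := by
    intro n
    induction n with
    | zero =>
      intro x
      obtain ⟨u, hu⟩ := exists_approx 0 x
      refine ⟨0, zero_mem _, ?_⟩
      rw [hu, map_zero, S.toLevel_eq_zero.2 (S.fil_zero ▸ Submodule.mem_top)]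
    | succ n ih =>
      intro x
      obtain ⟨z, hz, hzx⟩ := ih x
      obtain ⟨u, hu⟩ := exists_approx (n + 1) (x - z)
      have hu' : u ∈ S.fil n := by
        rw [← toLevel_eq_zero, ← hu.mono (Nat.le_succ n), map_sub, hzx, sub_self]
      obtain ⟨w, hw, hwu⟩ := hstep n hu'
      refine ⟨z + w, add_mem hz hw, ?_⟩
      rw [map_add, hwu, ← hu, map_sub, add_sub_cancel]
  exact eq_top_iff.2 fun x _ => S.mem_of_isClosed hcl fun N => hall N x

lemma bot_ne_top (hL : L.IsSimple) : (⊥ : Submodule ℂ S.Annihilation) ≠ ⊤ := by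
  intro h
  obtain ⟨a, b, hab⟩ := hL.lam_ne_zero
  refine hab (Finsupp.ext fun n => ?_)
  obtain ⟨N, hN⟩ := S.exists_action_eq_zero b
  rw [← action_mode]
  refine hN _ ?_
  have h0 : S.completionMap (L.minusMode n a) ∈ (⊥ : Submodule ℂ S.Annihilation) :=
    h ▸ Submodule.mem_top
  rw [← toLevel_eq_zero, ← proj_completionMap, (Submodule.mem_bot ℂ).1 h0, map_zero]

/-- Maximal closed graded ideals exist, because the union of a chain of proper closed ideals is
not dense. -/
theorem exists_maximal_ideal (hL : L.IsSimple) : ∃ M : Submodule ℂ S.Annihilation,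
    Maximal (fun I : Submodule ℂ S.Annihilation => IsClosedGradedIdeal I ∧ I ≠ ⊤) M := by
  have := S.isHausdorffLinear.t2
  have := S.isHausdorffLinear.addGroup
  have := S.isHausdorffLinear.smul
  obtain ⟨E, m, hE⟩ := S.exists_eq_top_of_approx hL
  have key := zorn_le_nonempty₀ {I : Submodule ℂ S.Annihilation |
      IsClosedGradedIdeal I ∧ I ≠ ⊤} ?_ ⊥
    ⟨⟨isGradedSubspace_iff.2 (by simp), isClosed_singleton, by simp⟩, S.bot_ne_top hL⟩
  · obtain ⟨M, -, hM⟩ := key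
    exact ⟨M, hM⟩
  · intro C hC hchain I₀ hI₀
    have hdir : DirectedOn (· ≤ ·) C := hchain.directedOn
    have hmem : ∀ x, x ∈ sSup C ↔ ∃ I ∈ C, x ∈ I := fun x =>
      Submodule.mem_sSup_of_directed ⟨I₀, hI₀⟩ hdir
    refine ⟨(sSup C).topologicalClosure, ⟨⟨?_, Submodule.isClosed_topologicalClosure _, ?_⟩, ?_⟩,
      fun I hI => (le_sSup hI).trans (Submodule.le_topologicalClosure _)⟩
    · refine isGradedSubspace_iff.2 fun x hx => map_mem_closure S.continuous_evenPart hx ?_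
      intro y hy
      obtain ⟨I, hI, hyI⟩ := (hmem y).1 hy
      exact (hmem _).2 ⟨I, hI, isGradedSubspace_iff.1 (hC hI).1.graded y hyI⟩
    · intro x y hy
      refine map_mem_closure (f := fun y => bracket x y)
        (S.continuous_bracket.comp (by fun_prop : Continuous fun y => (x, y))) hy ?_
      intro z hz
      obtain ⟨I, hI, hzI⟩ := (hmem z).1 hz
      exact (hmem _).2 ⟨I, hI, (hC hI).1.bracket_mem x z hzI⟩
    · intro htop
      have hex : ∀ e : L.lieMinus, ∃ I ∈ C, ∃ x ∈ I, S.Approx m x e := by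
        intro e
        have he : S.completionMap e ∈
            closure ((sSup C : Submodule ℂ S.Annihilation) : Set S.Annihilation) := by
          rw [← Submodule.topologicalClosure_coe, htop]
          trivial
        obtain ⟨x, hx, hxe⟩ :=
          (S.isHausdorffLinear.mem_closure_iff _ _).1 he _ (S.isOpen_ker_proj m)
        obtain ⟨I, hI, hxI⟩ := (hmem x).1 hx
        refine ⟨I, hI, x, hxI, ?_⟩
        rwa [LinearMap.mem_ker, map_sub, sub_eq_zero] at hxe
      choose J hJ x hx hxe using hex
      have : Nonempty C := ⟨⟨I₀, hI₀⟩⟩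
      classical
      obtain ⟨⟨I, hI⟩, hle⟩ := hdir.directed_val.finset_le
        (E.image fun e => (⟨J e, hJ e⟩ : C))
      obtain ⟨⟨hg, hcl, hid⟩, hne⟩ := hC hI
      refine hne (hE I hcl
        (fun y hy x => S.isLieSuperalgebra.bracket_mem_of_left hg hid hy x) fun e he => ?_)
      exact ⟨x e, hle ⟨J e, hJ e⟩ (Finset.mem_image_of_mem _ he) (hx e), hxe e⟩

end FiniteGenerators
end LieConformalSuperalgebra

/-! ### Graded subspaces and quotients by closed graded ideals -/

section Graded

variable {V : Type u} [AddCommGroup V] [Module ℂ V] {p : ZMod 2 → Submodule ℂ V}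

lemma IsGradedSubspace.mem_of_add_mem (hp : IsCompl (p 0) (p 1)) {U : Submodule ℂ V}
    (hU : IsGradedSubspace p U) {x y : V} (hx : x ∈ p 0) (hy : y ∈ p 1) (hxy : x + y ∈ U) :
    x ∈ U ∧ y ∈ U := by
  obtain ⟨a, ha, b, hb, e⟩ := Submodule.mem_sup.1 (hU hxy)
  have h1 : x - a = b - y := by
    rw [sub_eq_sub_iff_add_eq_add, ← e, add_comm b]
  have h2 : x - a = 0 := Submodule.disjoint_def.1 hp.disjoint _ (sub_mem hx ha.2)
    (h1 ▸ sub_mem hb.2 hy)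
  rw [h2] at h1
  exact ⟨sub_eq_zero.1 h2 ▸ ha.1, sub_eq_zero.1 h1.symm ▸ hb.1⟩

lemma isGradedSubspace_of_forall (hp : IsCompl (p 0) (p 1)) {U : Submodule ℂ V}
    (h : ∀ x ∈ p 0, ∀ y ∈ p 1, x + y ∈ U → x ∈ U ∧ y ∈ U) : IsGradedSubspace p U := by
  intro z hz
  obtain ⟨x, hx, y, hy, rfl⟩ :=
    Submodule.mem_sup.1 (hp.sup_eq_top ▸ Submodule.mem_top : z ∈ p 0 ⊔ p 1)
  obtain ⟨hx', hy'⟩ := h x hx y hy hz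
  exact Submodule.mem_sup.2 ⟨x, ⟨hx', hx⟩, y, ⟨hy', hy⟩, rfl⟩

lemma IsGradedSubspace.sup {U W : Submodule ℂ V} (hU : IsGradedSubspace p U)
    (hW : IsGradedSubspace p W) : IsGradedSubspace p (U ⊔ W) :=
  sup_le
    (hU.trans (sup_le_sup (inf_le_inf_right _ le_sup_left) (inf_le_inf_right _ le_sup_left)))
    (hW.trans (sup_le_sup (inf_le_inf_right _ le_sup_right) (inf_le_inf_right _ le_sup_right)))

lemma IsGradedSubspace.map {U : Submodule ℂ V} (hU : IsGradedSubspace p U) {f : V →ₗ[ℂ] V}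
    (hf : ∀ α, ∀ x ∈ p α, f x ∈ p α) : IsGradedSubspace p (U.map f) := by
  rintro _ ⟨x, hx, rfl⟩
  obtain ⟨a, ha, b, hb, rfl⟩ := Submodule.mem_sup.1 (hU hx)
  rw [map_add]
  exact add_mem (Submodule.mem_sup_left ⟨Submodule.mem_map_of_mem ha.1, hf 0 a ha.2⟩)
    (Submodule.mem_sup_right ⟨Submodule.mem_map_of_mem hb.1, hf 1 b hb.2⟩)

end Graded

section Quotient

variable {A : Type u} [AddCommGroup A] [Module ℂ A] [TopologicalSpace A] [SuperBracket A]

lemma IsClosedGradedIdeal.bracket_mem_right (hA : IsLieSuperalgebra A) {M : Submodule ℂ A}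
    (hM : IsClosedGradedIdeal M) : ∀ x ∈ M, ∀ y : A, bracket x y ∈ M := fun _ hx y =>
  hA.bracket_mem_of_left hM.graded hM.bracket_mem hx y

/-- The super structure of the quotient of a Lie superalgebra by a graded ideal. -/
@[reducible] def quotientSuperBracket (M : Submodule ℂ A) (hl : ∀ x : A, ∀ y ∈ M, bracket x y ∈ M)
    (hr : ∀ x ∈ M, ∀ y : A, bracket x y ∈ M) : SuperBracket (A ⧸ M) where
  parity α := (parity α).map M.mkQ
  bracket := (M.liftQ (M.liftQ ((bracket (V := A)).compr₂ M.mkQ) (by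
      intro x hx
      rw [LinearMap.mem_ker]
      refine LinearMap.ext fun y => ?_
      exact (Submodule.Quotient.mk_eq_zero _).2 (hr x hx y))).flip (by
    intro y hy
    rw [LinearMap.mem_ker]
    refine LinearMap.ext fun x => ?_
    obtain ⟨x, rfl⟩ := Submodule.mkQ_surjective _ x
    exact (Submodule.Quotient.mk_eq_zero _).2 (hl x y hy))).flip

/-- The quotient by a closed graded ideal is a linearly compact Lie superalgebra. -/
lemma isLinearlyCompactLieSuperalgebra_quotient (hA : IsLinearlyCompactLieSuperalgebra A)
    {M : Submodule ℂ A} (hM : IsClosedGradedIdeal M) :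
    letI := quotientSuperBracket M hM.bracket_mem (hM.bracket_mem_right hA.lie)
    IsLinearlyCompactLieSuperalgebra (A ⧸ M) := by
  let _ := quotientSuperBracket M hM.bracket_mem (hM.bracket_mem_right hA.lie)
  have := hA.linearlyCompact.addGroup
  have hcompl : IsCompl (parity (V := A ⧸ M) 0) (parity 1) := by
    refine IsCompl.of_eq ((Submodule.eq_bot_iff _).2 ?_) ?_
    · rintro _ ⟨⟨x, hx, rfl⟩, ⟨y, hy, e⟩⟩
      have hxy : x + -y ∈ M := by
        rw [← sub_eq_add_neg, ← Submodule.Quotient.mk_eq_zero, Submodule.Quotient.mk_sub]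
        exact sub_eq_zero.2 e.symm
      exact (Submodule.Quotient.mk_eq_zero _).2
        (hM.graded.mem_of_add_mem hA.lie.isCompl hx (neg_mem hy) hxy).1
    · change (parity (V := A) 0).map M.mkQ ⊔ (parity (V := A) 1).map M.mkQ = ⊤
      rw [← Submodule.map_sup, hA.lie.isCompl.sup_eq_top, Submodule.map_top, Submodule.range_mkQ]
  exact hA.of_surjective (hA.linearlyCompact.isHausdorffLinear.quotient M hM.isClosed) hcompl
    M.mkQ M.mkQ_surjective M.isOpenQuotientMap_mkQ.continuous M.isOpenMap_mkQ
    (fun α x hx => Submodule.mem_map_of_mem hx) (fun _ _ => rfl)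

/-- The quotient of a perfect Lie superalgebra by a maximal closed graded ideal is simple. -/
lemma isSimple_quotient (hA : IsLinearlyCompactLieSuperalgebra A)
    (hperf : Submodule.span ℂ {z : A | ∃ x y : A, z = bracket x y} = ⊤) {M : Submodule ℂ A}
    (hM : Maximal (fun I : Submodule ℂ A => IsClosedGradedIdeal I ∧ I ≠ ⊤) M) :
    letI := quotientSuperBracket M hM.prop.1.bracket_mem (hM.prop.1.bracket_mem_right hA.lie)
    IsSimpleTopLieSuperalgebra (A ⧸ M) := by
  let _ := quotientSuperBracket M hM.prop.1.bracket_mem (hM.prop.1.bracket_mem_right hA.lie)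
  have hQ := isLinearlyCompactLieSuperalgebra_quotient hA hM.prop.1
  have := hA.linearlyCompact.addGroup
  constructor
  · by_contra! h
    refine hM.prop.2 (eq_top_iff.2 (hperf ▸ Submodule.span_le.2 ?_))
    rintro _ ⟨x, y, rfl⟩
    exact (Submodule.Quotient.mk_eq_zero _).1 (h (M.mkQ x) (M.mkQ y))
  · intro J hg hcl hJ
    have hle : M ≤ J.comap M.mkQ := fun x hx => by
      rw [Submodule.mem_comap, Submodule.mkQ_apply, (Submodule.Quotient.mk_eq_zero M).2 hx]
      exact zero_mem J
    have hid : IsClosedGradedIdeal (J.comap M.mkQ) := by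
      refine ⟨isGradedSubspace_of_forall hA.lie.isCompl fun x hx y hy hxy => ?_,
        hcl.preimage M.isOpenQuotientMap_mkQ.continuous, fun x y hy => hJ (M.mkQ x) (M.mkQ y) hy⟩
      rw [Submodule.mem_comap, map_add] at hxy
      exact hg.mem_of_add_mem hQ.lie.isCompl (Submodule.mem_map_of_mem hx)
        (Submodule.mem_map_of_mem hy) hxy
    by_cases htop : J.comap M.mkQ = ⊤
    · refine Or.inr (eq_top_iff.2 fun x _ => ?_)
      obtain ⟨x, rfl⟩ := M.mkQ_surjective x
      exact (htop ▸ Submodule.mem_top : x ∈ J.comap M.mkQ)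
    · refine Or.inl ((Submodule.eq_bot_iff _).2 fun x hx => ?_)
      obtain ⟨x, rfl⟩ := M.mkQ_surjective x
      exact (Submodule.Quotient.mk_eq_zero _).2 (hM.2 ⟨hid, htop⟩ hle hx)

end Quotient

/-! ### Homomorphisms to `ℂ[[t_1, …, t_r]] ⊗̂ 𝔰` -/

namespace CompletedTensor

section

variable {V : Type u} {W : Type v} [AddCommGroup V] [Module ℂ V] [TopologicalSpace V]
    [AddCommGroup W] [Module ℂ W] [TopologicalSpace W]

variable (V W) in
lemma isHausdorffLinear : IsHausdorffLinear (CompletedTensor V W) :=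
  isHausdorffLinear_iInf
    (fun z => (LinearMap.applyₗ z).comp (toDual (V := V) (W := W)).toLinearMap)
    (fun _ hx => toDual.injective (LinearMap.ext hx)) rfl

end

variable {r : ℕ} {V : Type u} [AddCommGroup V] [Module ℂ V] [TopologicalSpace V]

lemma continuous_ofSeries_comp {X : Type*} [TopologicalSpace X] (F : X → (Fin r →₀ ℕ) → V)
    (hF : ∀ n, Continuous fun x => F x n) : Continuous fun x => ofSeries r V (F x) := by
  have key : ∀ z, IsLocallyConstant fun x => toDual (ofSeries r V (F x)) z := by
    intro z
    induction z using TensorProduct.induction_on with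
    | zero =>
      simp only [map_zero]
      exact IsLocallyConstant.const 0
    | tmul φ ψ =>
      have hφ := FormalSeries.topDual_eq_span φ
      induction hφ using Submodule.span_induction with
      | mem φ h =>
        obtain ⟨n, rfl⟩ := h
        exact IsLocallyConstant.comp_continuous ψ.2 (hF n)
      | zero =>
        simp only [TensorProduct.zero_tmul, map_zero]
        exact IsLocallyConstant.const 0
      | add φ φ' _ _ h h' =>
        simp only [TensorProduct.add_tmul, map_add]
        exact h.comp₂ h' (· + ·)
      | smul c φ _ h =>
        simp only [← TensorProduct.smul_tmul', map_smul]
        exact h.comp (c • ·)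
    | add z z' h h' =>
      simp only [map_add]
      exact h.comp₂ h' (· + ·)
  refine continuous_iInf_rng.2 fun z => ?_
  let _ : TopologicalSpace ℂ := ⊥
  exact continuous_induced_rng.2 (key z).continuous

variable [IsLinearlyCompact V] [SuperBracket V]

lemma seriesEquiv_mem_parity {α : ZMod 2} {f : (Fin r →₀ ℕ) → V} :
    seriesEquiv r V f ∈ parity (V := CompletedTensor (FormalSeries r) V) α ↔
      ∀ n, f n ∈ parity α := by
  constructor
  · rintro ⟨g, hg, e⟩ n
    rw [← (seriesEquiv r V).injective e]
    exact hg n trivial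
  · exact fun h => ⟨f, fun n _ => h n, rfl⟩

variable (r) in
lemma isCompl_parity (hV : IsCompl (parity (V := V) 0) (parity 1)) :
    IsCompl (parity (V := CompletedTensor (FormalSeries r) V) 0) (parity 1) := by
  refine IsCompl.of_eq ((Submodule.eq_bot_iff _).2 fun x hx => ?_) (eq_top_iff.2 fun x _ => ?_)
  · obtain ⟨f, rfl⟩ := (seriesEquiv r V).surjective x
    have h0 := seriesEquiv_mem_parity.1 hx.1
    have h1 := seriesEquiv_mem_parity.1 hx.2
    have : f = 0 := funext fun n => Submodule.disjoint_def.1 hV.disjoint _ (h0 n) (h1 n)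
    rw [this, map_zero]
  · obtain ⟨f, rfl⟩ := (seriesEquiv r V).surjective x
    have h : ∀ n, ∃ y ∈ parity (V := V) 0, ∃ z ∈ parity (V := V) 1, y + z = f n := fun n =>
      Submodule.mem_sup.1 (hV.sup_eq_top ▸ Submodule.mem_top)
    choose g hg k hk hgk using h
    exact Submodule.mem_sup.2 ⟨_, seriesEquiv_mem_parity.2 hg, _, seriesEquiv_mem_parity.2 hk, by
      rw [← map_add]; exact congrArg _ (funext hgk)⟩

lemma bracket_seriesEquiv (f g : (Fin r →₀ ℕ) → V) :
    bracket (seriesEquiv r V f) (seriesEquiv r V g) = seriesEquiv r V (seriesBracket r V f g) := by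
  change (seriesEquiv r V).arrowCongr ((seriesEquiv r V).arrowCongr (seriesEquiv r V))
    (seriesBracket r V) _ _ = _
  rw [LinearEquiv.arrowCongr_apply, LinearEquiv.arrowCongr_apply, LinearEquiv.symm_apply_apply,
    LinearEquiv.symm_apply_apply]

end CompletedTensor

section Extension

variable {A : Type u} [AddCommGroup A] [Module ℂ A] [TopologicalSpace A] [SuperBracket A]

open CompletedTensor in
/-- A surjective homomorphism from a perfect linearly compact Lie superalgebra to `𝔰[[t_1, …, t_r]]`
with central kernel, all of whose coefficients are continuous and even, is an irreducible central
extension. -/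
theorem isIrreducibleCentralExtension_of_series (hA : IsLinearlyCompactLieSuperalgebra A)
    (hfd : HasFiniteCodimBasis A)
    (hperf : Submodule.span ℂ {z : A | ∃ x y : A, z = bracket x y} = ⊤) {𝔰 : Type u}
    [AddCommGroup 𝔰] [Module ℂ 𝔰] [TopologicalSpace 𝔰] [SuperBracket 𝔰] [IsLinearlyCompact 𝔰]
    (hs : IsLinearlyCompactLieSuperalgebra 𝔰) {r : ℕ} (F : A →ₗ[ℂ] ((Fin r →₀ ℕ) → 𝔰))
    (hsurj : Function.Surjective F) (hcont : ∀ n, Continuous fun x => F x n)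
    (heven : ∀ (α : ZMod 2) (x : A), x ∈ parity α → ∀ n, F x n ∈ parity α)
    (hbr : ∀ x y, F (bracket x y) = seriesBracket r 𝔰 (F x) (F y))
    (hker : ∀ x, F x = 0 → ∀ y : A, bracket x y = 0) :
    IsIrreducibleCentralExtension ((seriesEquiv r 𝔰).toLinearMap.comp F) := by
  set π := (seriesEquiv r 𝔰).toLinearMap.comp F with hπ
  have hlin := CompletedTensor.isHausdorffLinear (FormalSeries r) 𝔰
  have hps : Function.Surjective π := (seriesEquiv r 𝔰).surjective.comp hsurj
  have hpc : Continuous π := continuous_ofSeries_comp (fun x => F x) hcont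
  have hpo : IsOpenMap π := hA.linearlyCompact.isOpenMap_of_surjective hfd hlin hpc hps
  have hpe : ∀ (α : ZMod 2) (x : A), x ∈ parity α → π x ∈ parity α := fun α x hx =>
    seriesEquiv_mem_parity.2 (heven α x hx)
  have hpb : ∀ x y : A, π (bracket x y) = bracket (π x) (π y) := fun x y => by
    simp only [hπ, LinearMap.comp_apply, LinearEquiv.coe_coe, bracket_seriesEquiv, hbr]
  exact ⟨hA, hA.of_surjective hlin (isCompl_parity r hs.lie.isCompl) π hps hpc hpo hpe hpb, hpe,
    hpb, hps, hpc, hpo, fun x hx => hker x ((seriesEquiv r 𝔰).map_eq_zero_iff.1 hx), hperf⟩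

end Extension

/-! ### Linearly compact Lie superalgebras with a derivation -/

section Derivation

variable {A : Type u} [AddCommGroup A] [Module ℂ A] [SuperBracket A] {T : A →ₗ[ℂ] A}

lemma iterate_derivation_bracket
    (hT : ∀ x y : A, T (bracket x y) = bracket (T x) y + bracket x (T y)) (n : ℕ) (x y : A) :
    (T ^ n) (bracket x y) = ∑ p ∈ Finset.HasAntidiagonal.antidiagonal n,
      n.choose p.1 • bracket ((T ^ p.1) x) ((T ^ p.2) y) := by
  induction n with
  | zero => simp
  | succ n ih =>
    rw [Finset.sum_antidiagonal_choose_succ_nsmul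
      (fun i j => bracket ((T ^ i) x) ((T ^ j) y)), pow_succ', Module.End.mul_apply, ih, map_sum,
      add_comm, ← Finset.sum_add_distrib]
    refine Finset.sum_congr rfl fun p hp => ?_
    rw [map_nsmul, hT, ← Nat.choose_symm_of_eq_add (Finset.HasAntidiagonal.mem_antidiagonal.1 hp).symm,
      nsmul_add]
    simp only [pow_succ', Module.End.mul_apply]

/-- The subspace of all `x` with `x, T x, …, T^{k-1} x ∈ M`. -/
def jetKernel (T : A →ₗ[ℂ] A) (M : Submodule ℂ A) (k : ℕ) : Submodule ℂ A where
  carrier := {x | ∀ i < k, (T ^ i) x ∈ M}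
  zero_mem' := fun i _ => by simp
  add_mem' := fun hx hy i hi => by rw [map_add]; exact add_mem (hx i hi) (hy i hi)
  smul_mem' := fun c x hx i hi => by rw [map_smul]; exact M.smul_mem c (hx i hi)

omit [SuperBracket A] in
lemma mem_jetKernel {M : Submodule ℂ A} {k : ℕ} {x : A} :
    x ∈ jetKernel T M k ↔ ∀ i < k, (T ^ i) x ∈ M := Iff.rfl

/-- The subspace `T^k(M_k) + M` of leading coefficients in degree `k`, where `M_k` is the subspace
of all `x` with `x, T x, …, T^{k-1} x ∈ M`. -/
def leadingSubspace (T : A →ₗ[ℂ] A) (M : Submodule ℂ A) (k : ℕ) : Submodule ℂ A :=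
  (jetKernel T M k).map (T ^ k) ⊔ M

variable [TopologicalSpace A]

omit [SuperBracket A] in
lemma continuous_iterate (hTc : Continuous T) (k : ℕ) : Continuous (T ^ k : A →ₗ[ℂ] A) := by
  induction k with
  | zero => exact continuous_id
  | succ k ih =>
    rw [pow_succ']
    exact hTc.comp ih

omit [TopologicalSpace A] in
lemma iterate_mem_parity (hTe : ∀ (α : ZMod 2) (x : A), x ∈ parity α → T x ∈ parity α) (k : ℕ) :
    ∀ (α : ZMod 2) (x : A), x ∈ parity α → (T ^ k) x ∈ parity α := fun α x hx => by
  induction k with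
  | zero => exact hx
  | succ k ih => rw [pow_succ', Module.End.mul_apply]; exact hTe α _ ih

lemma isClosedGradedIdeal_jetKernel (hA : IsLieSuperalgebra A) (hTc : Continuous T)
    (hTe : ∀ (α : ZMod 2) (x : A), x ∈ parity α → T x ∈ parity α)
    (hTd : ∀ x y : A, T (bracket x y) = bracket (T x) y + bracket x (T y)) {M : Submodule ℂ A}
    (hM : IsClosedGradedIdeal M) (k : ℕ) : IsClosedGradedIdeal (jetKernel T M k) := by
  refine ⟨isGradedSubspace_of_forall hA.isCompl fun x hx y hy hxy => ?_, ?_, fun x y hy i hi => ?_⟩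
  · have h : ∀ i < k, (T ^ i) x ∈ M ∧ (T ^ i) y ∈ M := fun i hi => by
      have h1 := hxy i hi
      rw [map_add] at h1
      exact hM.graded.mem_of_add_mem hA.isCompl (iterate_mem_parity hTe i 0 x hx)
        (iterate_mem_parity hTe i 1 y hy) h1
    exact ⟨fun i hi => (h i hi).1, fun i hi => (h i hi).2⟩
  · have h : (jetKernel T M k : Set A) = ⋂ i : Fin k, (T ^ (i : ℕ)) ⁻¹' (M : Set A) := by
      ext x
      simp only [SetLike.mem_coe, mem_jetKernel, Set.mem_iInter, Set.mem_preimage, Fin.forall_iff]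
    rw [h]
    exact isClosed_iInter fun i => hM.isClosed.preimage (continuous_iterate hTc i)
  · rw [iterate_derivation_bracket hTd]
    refine Submodule.sum_mem _ fun p hp => nsmul_mem (hM.bracket_mem _ _ (hy _ ?_)) _
    have := Finset.HasAntidiagonal.mem_antidiagonal.1 hp
    omega

lemma isClosedGradedIdeal_leadingSubspace (hA : IsLinearlyCompactLieSuperalgebra A)
    (hTc : Continuous T) (hTe : ∀ (α : ZMod 2) (x : A), x ∈ parity α → T x ∈ parity α)
    (hTd : ∀ x y : A, T (bracket x y) = bracket (T x) y + bracket x (T y)) {M : Submodule ℂ A}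
    (hM : IsClosedGradedIdeal M) (k : ℕ) : IsClosedGradedIdeal (leadingSubspace T M k) := by
  have hJ := isClosedGradedIdeal_jetKernel hA.lie hTc hTe hTd hM k
  refine ⟨(hJ.graded.map (iterate_mem_parity hTe k)).sup hM.graded,
    hA.linearlyCompact.isClosed_map_sup hA.linearlyCompact.isHausdorffLinear
      (continuous_iterate hTc k) hJ.isClosed hM.isClosed, fun y z hz => ?_⟩
  obtain ⟨_, ⟨x, hx, rfl⟩, m, hm, rfl⟩ := Submodule.mem_sup.1 hz
  rw [map_add]
  refine add_mem ?_ (Submodule.mem_sup_right (hM.bracket_mem y m hm))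
  -- `[y, T^k x]` and `T^k [y, x]` differ by terms `[T^i y, T^j x]` with `j < k`
  have hmem : ((0, k) : ℕ × ℕ) ∈ Finset.HasAntidiagonal.antidiagonal k := by simp
  have e := iterate_derivation_bracket hTd k y x
  rw [← Finset.add_sum_erase _ _ hmem, Nat.choose_zero_right, one_smul, pow_zero,
    Module.End.one_apply] at e
  change _ = bracket y ((T ^ k) x) + _ at e
  rw [eq_sub_of_add_eq e.symm]
  refine sub_mem (Submodule.mem_sup_left ⟨_, hJ.bracket_mem y x hx, rfl⟩)
    (Submodule.mem_sup_right (Submodule.sum_mem _ fun p hp => ?_))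
  obtain ⟨hne, hp⟩ := Finset.mem_erase.1 hp
  refine nsmul_mem (hM.bracket_mem _ _ (hx _ ?_)) _
  have h1 := Finset.HasAntidiagonal.mem_antidiagonal.1 hp
  by_contra hk
  exact hne (Prod.ext (by simp; omega) (by simp; omega))

omit [TopologicalSpace A] [SuperBracket A] in
/-- If every leading subspace is everything, then jets can be prescribed to finite order. -/
lemma exists_jet {M : Submodule ℂ A} (h : ∀ k, leadingSubspace T M k = ⊤) (y : ℕ → A) (n : ℕ) :
    ∃ x, ∀ k < n, (T ^ k) x - y k ∈ M := by
  induction n with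
  | zero => exact ⟨0, by simp⟩
  | succ n ih =>
    obtain ⟨x, hx⟩ := ih
    have hz : y n - (T ^ n) x ∈ leadingSubspace T M n := h n ▸ Submodule.mem_top
    obtain ⟨_, ⟨z, hz, rfl⟩, m, hm, e⟩ := Submodule.mem_sup.1 hz
    refine ⟨x + z, fun k hk => ?_⟩
    rcases Nat.lt_succ_iff_lt_or_eq.1 hk with hk | rfl
    · rw [map_add, add_sub_right_comm]
      exact add_mem (hx k hk) (hz k hk)
    · have : (T ^ k) (x + z) - y k = -m := by
        rw [eq_sub_iff_add_eq] at e
        rw [map_add, eq_neg_iff_add_eq_zero, ← sub_eq_zero.2 e]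
        abel
      rw [this]
      exact neg_mem hm

omit [SuperBracket A] in
/-- If every leading subspace is everything, then all jets can be prescribed, by linear
compactness. -/
lemma exists_infinite_jet (hA : IsLinearlyCompact A) (hTc : Continuous T) {M : Submodule ℂ A}
    (hM : IsClosed (M : Set A)) (h : ∀ k, leadingSubspace T M k = ⊤) (y : ℕ → A) :
    ∃ x, ∀ k, (T ^ k) x - y k ∈ M := by
  have key := hA.inter (Set.range fun k => affineFiber ⊤ (T ^ k) (y k) M) ?_ ?_
  · obtain ⟨x, hx⟩ := key
    simp only [Set.mem_iInter, Set.forall_mem_range, SetLike.mem_coe] at hx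
    exact ⟨x, fun k => (hx k).2⟩
  · rintro _ ⟨k, rfl⟩
    exact isClosed_affineFiber isClosed_univ (continuous_iterate hTc k) hA.isHausdorffLinear _ hM
  · intro 𝓣 h𝓣 hfin
    obtain ⟨K, hK, rfl⟩ : ∃ K : Set ℕ, K.Finite ∧
        (fun k => affineFiber ⊤ (T ^ k) (y k) M) '' K = 𝓣 := by
      rw [← Set.image_univ] at h𝓣
      obtain ⟨K, -, hK, e⟩ := Set.exists_subset_image_finite_and.1 ⟨𝓣, h𝓣, hfin, rfl⟩
      exact ⟨K, hK, e.symm⟩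
    obtain ⟨n, hn⟩ := hK.bddAbove
    obtain ⟨x, hx⟩ := exists_jet h y (n + 1)
    refine ⟨x, ?_⟩
    simp only [Set.mem_iInter, Set.forall_mem_image, SetLike.mem_coe]
    intro k hk
    exact ⟨trivial, hx k (Nat.lt_succ_of_le (hn hk))⟩

omit [TopologicalSpace A] in
/-- If the leading subspaces are everything in degrees `1` and `k + 1`, but `M` in degree `k + 2`,
then `[A, A] ⊆ M`: for `x ∈ M_1` and `y ∈ M_{k+1}`, the element `T^{k+2} [x, y]` is
`(k + 2) [T x, T^{k+1} y]` modulo `M`. -/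
lemma bracket_mem_of_leadingSubspace
    (hTd : ∀ x y : A, T (bracket x y) = bracket (T x) y + bracket x (T y)) {M : Submodule ℂ A}
    (hl : ∀ x : A, ∀ y ∈ M, bracket x y ∈ M) (hr : ∀ x ∈ M, ∀ y : A, bracket x y ∈ M) {k : ℕ}
    (h1 : leadingSubspace T M 1 = ⊤) (hk : leadingSubspace T M (k + 1) = ⊤)
    (hk' : leadingSubspace T M (k + 2) = M) (x y : A) : bracket x y ∈ M := by
  obtain ⟨_, ⟨x, hx, rfl⟩, m, hm, rfl⟩ :=
    Submodule.mem_sup.1 (h1 ▸ Submodule.mem_top : x ∈ leadingSubspace T M 1)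
  obtain ⟨_, ⟨y, hy, rfl⟩, n, hn, rfl⟩ :=
    Submodule.mem_sup.1 (hk ▸ Submodule.mem_top : y ∈ leadingSubspace T M (k + 1))
  have hterm : ∀ i j : ℕ, i = 0 ∨ j < k + 1 → bracket ((T ^ i) x) ((T ^ j) y) ∈ M := by
    rintro i j (rfl | hj)
    · exact hr _ (hx 0 one_pos) _
    · exact hl _ _ (hy j hj)
  have hxy : bracket x y ∈ jetKernel T M (k + 2) := fun i hi => by
    rw [iterate_derivation_bracket hTd]
    refine Submodule.sum_mem _ fun p hp => nsmul_mem (hterm _ _ ?_) _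
    have := Finset.HasAntidiagonal.mem_antidiagonal.1 hp
    omega
  have hlead : (T ^ (k + 2)) (bracket x y) ∈ M :=
    hk' ▸ (Submodule.mem_sup_left ⟨_, hxy, rfl⟩ : _ ∈ leadingSubspace T M (k + 2))
  have hmem : ((1, k + 1) : ℕ × ℕ) ∈ Finset.HasAntidiagonal.antidiagonal (k + 2) := by
    rw [Finset.HasAntidiagonal.mem_antidiagonal]
    ring
  rw [iterate_derivation_bracket hTd, ← Finset.add_sum_erase _ _ hmem] at hlead
  have hrest : ∑ p ∈ (Finset.HasAntidiagonal.antidiagonal (k + 2)).erase (1, k + 1),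
      (k + 2).choose p.1 • bracket ((T ^ p.1) x) ((T ^ p.2) y) ∈ M := by
    refine Submodule.sum_mem _ fun p hp => nsmul_mem (hterm _ _ ?_) _
    obtain ⟨hne, hp⟩ := Finset.mem_erase.1 hp
    have h2 := Finset.HasAntidiagonal.mem_antidiagonal.1 hp
    by_contra hk
    exact hne (Prod.ext (by simp; omega) (by simp; omega))
  have hmain := (M.add_mem_iff_left hrest).1 hlead
  rw [Nat.choose_one_right, ← Nat.cast_smul_eq_nsmul ℂ] at hmain
  have hne : ((k + 2 : ℕ) : ℂ) ≠ 0 := Nat.cast_ne_zero.2 (by omega)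
  have hfin := (M.smul_mem_iff hne).1 hmain
  simp only [map_add, LinearMap.add_apply]
  exact add_mem (add_mem hfin (hr m hm _)) (add_mem (hl _ n hn) (hr m hm _))

/-- The Taylor expansion `x ↦ ∑_k t^k / k! (T^k x mod M)`, as a map to power series in one
variable with coefficients in `A / M`. -/
def taylor (T : A →ₗ[ℂ] A) (M : Submodule ℂ A) : A →ₗ[ℂ] ((Fin 1 →₀ ℕ) → A ⧸ M) :=
  LinearMap.pi fun n => (((n 0).factorial : ℂ)⁻¹) • M.mkQ.comp (T ^ n 0)

lemma sum_antidiagonal_fin_one {B : Type*} [AddCommMonoid B] (f : ℕ → ℕ → B) (n : Fin 1 →₀ ℕ) :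
    ∑ p ∈ Finset.HasAntidiagonal.antidiagonal n, f (p.1 0) (p.2 0) =
      ∑ q ∈ Finset.HasAntidiagonal.antidiagonal (n 0), f q.1 q.2 := by
  refine Finset.sum_nbij' (fun p => (p.1 0, p.2 0))
    (fun q => (Finsupp.single 0 q.1, Finsupp.single 0 q.2)) ?_ ?_ ?_ ?_ ?_
  · intro p hp
    rw [Finset.HasAntidiagonal.mem_antidiagonal] at hp ⊢
    rw [← hp, Finsupp.add_apply]
  · intro q hq
    rw [Finset.HasAntidiagonal.mem_antidiagonal] at hq ⊢
    refine Finsupp.ext fun i => ?_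
    rw [Subsingleton.elim i 0, ← hq]
    simp
  · intro p _
    refine Prod.ext ?_ ?_ <;>
    · refine Finsupp.ext fun i => ?_
      rw [Subsingleton.elim i 0]
      simp
  · intro q _
    simp
  · intro p _
    rfl

open CompletedTensor in
/-- A perfect linearly compact Lie superalgebra with an even continuous derivation `T`, all of whose
proper `T`-invariant closed graded ideals are central, is a central extension of
`ℂ[[t_1, …, t_r]] ⊗̂ 𝔰`, where `𝔰` is the quotient by a maximal closed graded ideal and
`r ∈ {0, 1}`. -/
theorem exists_irreducibleCentralExtension (hA : IsLinearlyCompactLieSuperalgebra A)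
    (hfd : HasFiniteCodimBasis A)
    (hperf : Submodule.span ℂ {z : A | ∃ x y : A, z = bracket x y} = ⊤)
    (hTc : Continuous T) (hTe : ∀ (α : ZMod 2) (x : A), x ∈ parity α → T x ∈ parity α)
    (hTd : ∀ x y : A, T (bracket x y) = bracket (T x) y + bracket x (T y))
    (hcentral : ∀ I : Submodule ℂ A, IsClosedGradedIdeal I → (∀ x ∈ I, T x ∈ I) → I ≠ ⊤ →
      ∀ x ∈ I, ∀ y : A, bracket x y = 0)
    {M : Submodule ℂ A}
    (hM : Maximal (fun I : Submodule ℂ A => IsClosedGradedIdeal I ∧ I ≠ ⊤) M) :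
    ∃ r : ℕ, (r = 0 ∨ r = 1) ∧
      ∃ (𝔰 : Type u) (_ : AddCommGroup 𝔰) (_ : Module ℂ 𝔰) (_ : TopologicalSpace 𝔰)
        (_ : SuperBracket 𝔰) (_ : IsLinearlyCompact 𝔰),
        IsLinearlyCompactLieSuperalgebra 𝔰 ∧ IsSimpleTopLieSuperalgebra 𝔰 ∧
        ∃ π : A →ₗ[ℂ] CompletedTensor (FormalSeries r) 𝔰, IsIrreducibleCentralExtension π := by
  obtain ⟨hMi, hMne⟩ := hM.prop
  have hMr := hMi.bracket_mem_right hA.lie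
  let _ := quotientSuperBracket M hMi.bracket_mem hMr
  have hQ : IsLinearlyCompactLieSuperalgebra (A ⧸ M) :=
    isLinearlyCompactLieSuperalgebra_quotient hA hMi
  have hlc : IsLinearlyCompact (A ⧸ M) := hQ.linearlyCompact
  have := hA.linearlyCompact.addGroup
  have hmk : Continuous M.mkQ := M.isOpenQuotientMap_mkQ.continuous
  have hmk0 : ∀ {x}, M.mkQ x = 0 ↔ x ∈ M := fun {x} => Submodule.Quotient.mk_eq_zero M
  have hlead : ∀ k, leadingSubspace T M k ≠ ⊤ → leadingSubspace T M k = M := fun k hk =>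
    le_antisymm (hM.2 ⟨isClosedGradedIdeal_leadingSubspace hA hTc hTe hTd hMi k, hk⟩ le_sup_right)
      le_sup_right
  by_cases h : ∀ k, leadingSubspace T M k = ⊤
  · refine ⟨1, Or.inr rfl, A ⧸ M, inferInstance, inferInstance, inferInstance, inferInstance, hlc,
      hQ, isSimple_quotient hA hperf hM, _,
      isIrreducibleCentralExtension_of_series hA hfd hperf hQ (taylor T M) ?_ ?_ ?_ ?_ ?_⟩
    · intro f
      choose y hy using fun k : ℕ => M.mkQ_surjective ((k.factorial : ℂ) • f (Finsupp.single 0 k))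
      obtain ⟨x, hx⟩ := exists_infinite_jet hA.linearlyCompact hTc hMi.isClosed h y
      refine ⟨x, funext fun n => ?_⟩
      have hn : n = Finsupp.single 0 (n 0) := by
        refine Finsupp.ext fun i => ?_
        rw [Subsingleton.elim i 0]
        simp
      have e : M.mkQ ((T ^ n 0) x) = ((n 0).factorial : ℂ) • f n := by
        have h1 := hmk0.2 (hx (n 0))
        rw [map_sub, sub_eq_zero, hy, ← hn] at h1
        exact h1
      change (((n 0).factorial : ℂ)⁻¹) • M.mkQ ((T ^ n 0) x) = f n
      rw [e, smul_smul, inv_mul_cancel₀ (Nat.cast_ne_zero.2 (Nat.factorial_ne_zero _)), one_smul]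
    · intro n
      have := hlc.smul
      change Continuous fun x => (((n 0).factorial : ℂ)⁻¹) • M.mkQ ((T ^ n 0) x)
      exact (hmk.comp (continuous_iterate hTc (n 0))).const_smul (((n 0).factorial : ℂ)⁻¹)
    · intro α x hx n
      exact Submodule.smul_mem _ _ (Submodule.mem_map_of_mem (iterate_mem_parity hTe (n 0) α x hx))
    · intro x y
      funext n
      have e : seriesBracket 1 (A ⧸ M) (taylor T M x) (taylor T M y) n =
          ∑ q ∈ Finset.HasAntidiagonal.antidiagonal (n 0),
            bracket (((q.1.factorial : ℂ)⁻¹) • M.mkQ ((T ^ q.1) x))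
            (((q.2.factorial : ℂ)⁻¹) • M.mkQ ((T ^ q.2) y)) :=
        sum_antidiagonal_fin_one (fun i j => bracket (((i.factorial : ℂ)⁻¹) • M.mkQ ((T ^ i) x))
            (((j.factorial : ℂ)⁻¹) • M.mkQ ((T ^ j) y))) n
      rw [e]
      change (((n 0).factorial : ℂ)⁻¹) • M.mkQ ((T ^ n 0) (bracket x y)) = _
      rw [iterate_derivation_bracket hTd, map_sum, Finset.smul_sum]
      refine Finset.sum_congr rfl fun q hq => ?_
      have hsmul : ∀ (a b : ℂ) (u v : A ⧸ M), bracket (a • u) (b • v) = (b * a) • bracket u v :=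
        fun a b u v => by rw [map_smul, map_smul, LinearMap.smul_apply, smul_smul]
      rw [hsmul, ← Nat.cast_smul_eq_nsmul ℂ, map_smul, smul_smul]
      have hc : ((n 0).factorial : ℂ)⁻¹ * ((n 0).choose q.1 : ℂ) =
          (q.2.factorial : ℂ)⁻¹ * (q.1.factorial : ℂ)⁻¹ := by
        have hq' := Finset.HasAntidiagonal.mem_antidiagonal.1 hq
        have hn := Nat.choose_mul_factorial_mul_factorial
          (Nat.le_of_add_right_le (hq'.le : q.1 + q.2 ≤ n 0))
        rw [← hq', Nat.add_sub_cancel_left, hq'] at hn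
        have h0 : ∀ m : ℕ, (m.factorial : ℂ) ≠ 0 := fun m =>
          Nat.cast_ne_zero.2 (Nat.factorial_ne_zero m)
        have := h0 (n 0)
        have := h0 q.1
        have := h0 q.2
        field_simp
        have hn' : ((n 0).choose q.1 : ℂ) * q.1.factorial * q.2.factorial = (n 0).factorial := by
          exact_mod_cast hn
        linear_combination hn'
      rw [hc]
      rfl
    · have hK : IsClosedGradedIdeal (⨅ k, jetKernel T M k) := by
        have hJ := isClosedGradedIdeal_jetKernel hA.lie hTc hTe hTd hMi
        refine ⟨isGradedSubspace_of_forall hA.lie.isCompl fun x hx y hy hxy => ?_, ?_, ?_⟩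
        · simp only [Submodule.mem_iInf] at hxy ⊢
          exact forall_and.1 fun k => (hJ k).graded.mem_of_add_mem hA.lie.isCompl hx hy (hxy k)
        · rw [Submodule.coe_iInf]
          exact isClosed_iInter fun k => (hJ k).isClosed
        · intro x y hy
          simp only [Submodule.mem_iInf] at hy ⊢
          exact fun k => (hJ k).bracket_mem x y (hy k)
      have hKM : (⨅ k, jetKernel T M k) ≤ M := fun x hx =>
        (Submodule.mem_iInf _).1 hx 1 0 one_pos
      intro x hx
      refine hcentral _ hK (fun z hz => ?_) (fun htop => hMne (top_le_iff.1 (htop ▸ hKM))) x ?_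
      · simp only [Submodule.mem_iInf] at hz ⊢
        intro k i hi
        have := hz (k + 1) (i + 1) (by omega)
        rwa [pow_succ, Module.End.mul_apply] at this
      · refine (Submodule.mem_iInf _).2 fun k i _ => hmk0.1 ?_
        have h1 := congrFun hx (Finsupp.single 0 i)
        change ((((Finsupp.single 0 i : Fin 1 →₀ ℕ) 0).factorial : ℂ)⁻¹) •
          M.mkQ ((T ^ ((Finsupp.single 0 i : Fin 1 →₀ ℕ) 0)) x) = 0 at h1
        rw [Finsupp.single_eq_same] at h1
        exact (smul_eq_zero.1 h1).resolve_left
          (inv_ne_zero (Nat.cast_ne_zero.2 (Nat.factorial_ne_zero i)))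
  · have hTM : ∀ x ∈ M, T x ∈ M := by
      push Not at h
      classical
      obtain ⟨k, hk, hmin⟩ : ∃ k, leadingSubspace T M k ≠ ⊤ ∧
          ∀ j < k, leadingSubspace T M j = ⊤ :=
        ⟨Nat.find h, Nat.find_spec h, fun j hj => not_not.1 (Nat.find_min h hj)⟩
      match k with
      | 0 =>
        refine absurd (eq_top_iff.2 fun x _ => ?_) hk
        exact Submodule.mem_sup_left ⟨x, fun i hi => absurd hi (Nat.not_lt_zero i), rfl⟩
      | 1 =>
        intro x hx
        rw [← hlead 1 hk]
        refine Submodule.mem_sup_left ⟨x, fun i hi => ?_, by rw [pow_one]⟩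
        rw [Nat.lt_one_iff.1 hi]
        exact hx
      | k + 2 =>
        refine absurd (eq_top_iff.2 (hperf ▸ Submodule.span_le.2 ?_)) hMne
        rintro _ ⟨x, y, rfl⟩
        exact bracket_mem_of_leadingSubspace hTd hMi.bracket_mem hMr (hmin 1 (by omega))
          (hmin (k + 1) (by omega)) (hlead _ hk) x y
    refine ⟨0, Or.inl rfl, A ⧸ M, inferInstance, inferInstance, inferInstance, inferInstance, hlc,
      hQ, isSimple_quotient hA hperf hM, _,
      isIrreducibleCentralExtension_of_series hA hfd hperf hQ (LinearMap.pi fun _ => M.mkQ)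
        ?_ ?_ ?_ ?_ ?_⟩
    · intro f
      obtain ⟨x, hx⟩ := M.mkQ_surjective (f 0)
      exact ⟨x, funext fun n => by rw [Subsingleton.elim n 0, ← hx]; rfl⟩
    · exact fun n => hmk
    · exact fun α x hx n => Submodule.mem_map_of_mem hx
    · intro x y
      funext n
      rw [Subsingleton.elim n 0]
      change M.mkQ (bracket x y) = ∑ p ∈ Finset.HasAntidiagonal.antidiagonal (0 : Fin 0 →₀ ℕ),
        bracket (M.mkQ x) (M.mkQ y)
      rw [Finsupp.antidiagonal_zero, Finset.sum_singleton]
      rfl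
    · intro x hx
      exact hcentral M hMi hTM hMne x (hmk0.1 (congrFun hx 0))

end Derivation

end

/-- Let `R` be a simple Lie conformal superalgebra which is finite, i.e. finitely generated over
`ℂ[∂]`, with `S` a finite set of generators (any choice defines the same completion `𝒜(R)`).  Then
`𝒜(R)` is an irreducible central extension of `ℂ[[t_1, …, t_r]] ⊗̂ 𝔰` with `r ∈ {0, 1}` and `𝔰` a
simple linearly compact Lie superalgebra. -/
theorem mainTheorem7 {R : Type u} [AddCommGroup R] [Module ℂ R] (L : LieConformalSuperalgebra R)
    (hL : L.IsSimple) (S : L.FiniteGenerators) :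
    ∃ r : ℕ, (r = 0 ∨ r = 1) ∧
      ∃ (𝔰 : Type u) (_ : AddCommGroup 𝔰) (_ : Module ℂ 𝔰) (_ : TopologicalSpace 𝔰)
        (_ : SuperBracket 𝔰) (_ : IsLinearlyCompact 𝔰),
        IsLinearlyCompactLieSuperalgebra 𝔰 ∧ IsSimpleTopLieSuperalgebra 𝔰 ∧
        ∃ π : S.Annihilation →ₗ[ℂ] CompletedTensor (FormalSeries r) 𝔰,
          IsIrreducibleCentralExtension π := by
  obtain ⟨M, hM⟩ := S.exists_maximal_ideal hL
  exact exists_irreducibleCentralExtension S.isLinearlyCompactLieSuperalgebra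
    S.hasFiniteCodimBasis (S.span_bracket_eq_top hL) S.continuous_derivation
    S.derivation_mem_parity S.derivation_bracket
    (fun I hI hT hne => LieConformalSuperalgebra.FiniteGenerators.central_of_invariant hL hI hT hne)
    hM
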